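/- **Setting.** Let $0<q<1$, $r>1$, $r^*=r-1$, $p=q^{2r}$, $p^*=q^{2r^*}$ (level $c=1$), $z=q^{2u}$, $[x]_q=\frac{q^x-q^{-x}}{q-q^{-1}}$, $(x;t)_\infty=\prod_{n\ge0}(1-xt^n)$, $\Theta_p(x)=(x;p)_\infty(p/x;p)_\infty(p;p)_\infty$, $\{x\}=(x;p,q^6)_\infty=\prod_{i,j\ge0}(1-xp^iq^{6j})$, $$[u]=q^{\frac{u^2}{r}-u}\Theta_p(q^{2u}),\quad [u]_+=q^{\frac{u^2}{r}-u}\Theta_p(-q^{2u}),$$ $$\rho^+(u)=-qz^{1/r}\frac{\{pq^2z\}\{pq^3z\}^2\{pq^4z\}\{1/z\}\{q/z\}\{q^5/z\}\{q^6/z\}}{\{pz\}\{pqz\}\{pq^5z\}\{pq^6z\}\{q^2/z\}\{q^3/z\}^2\{q^4/z\}},$$ and let $[u]^*,[u]^*_+,\rho^{+*}$ be the same with $r\to r^*$. Let $a_m$ $(m\ne0)$ satisfy $[a_m,a_n]=\delta_{m+n,0}\frac1m([2m]_q-[m]_q)q^{-|m|}[m]_q$; for $m>0$ put $\alpha_m=a_m$,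 $\alpha_{-m}=\frac{[rm]_q}{[r^*m]_q}q^{m}a_{-m}$, and $\beta_m=\frac{[r^*m]_q}{[rm]_q}\alpha_m$ for all $m\neq 0$. The zero modes satisfy $[P,Q]=1$, $[h,\hat\alpha]=2$, $[Q,\hat\alpha]=\pi i$, other commutators zero. All operators act on the level-one module with basis (monomials in $a_{-m}$, $m>0$) $\otimes\, e^{n\hat\alpha}e^{\mu Q}$, $n,\mu\in\mathbb Z$, on which $h=2n+1$ and $P=s+\mu$, where $s\in\mathbb C$ is generic: $[2s+k],[2s+k]^*,[s+\frac k2]_+,[s+\frac k2]_+^*$ are nonzero for all $k\in\mathbb Z$. With $\epsilon(q)=(q^{1/2}+q^{-1/2})^{-1/2}$ let $$E(z)=\epsilon(q):\!e^{-\sum_{m\ne0}\frac{\alpha_m}{[m]_q}z^{-m}}\!:e^{\hat\alpha}z^{\frac h2+\frac12}e^{-Q}z^{-\frac{P-1/2}{r^*}},\quad F(z)=\epsilon(q):\!e^{\sum_{m\ne0}\frac{\beta_m}{[m]_q}z^{-m}}\!:e^{-\hat\alpha}z^{-\frac h2+\frac12}z^{\frac{P-1/2}{r}+\frac h{2r}},$$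 $$K(z)=:\!e^{-\sum_{m\ne0}\frac{[m]_q}{[rm]_q([2m]_q-[m]_q)}\alpha_mz^{-m}}\!:e^{-Q}z^{(\frac1r-\frac1{r^*})(P-\frac12)+\frac h{2r}},\qquad K_-(z)=K(q^{r+1}z)^{-1}.$$ Operators are also written as functions of $u$. For $a,a^*\in\mathbb C$ the half currents are the operators (with $S=P+\frac h2$) $$F_{0,-}(v)=a\oint\frac{dz'}{2\pi iz'}F(z')\frac{[v-u'+S-\frac12]_+[1]}{[v-u'][S-\frac12]_+},\qquad E_{-,0}(v)=a^*\oint\frac{dz'}{2\pi iz'}E(z')\frac{[v-u'-P+1]^*_+[1]^*}{[v-u'+\frac12]^*[P-\frac12]^*_+},$$ $$F_{+,-}(v)=a^2\oint\!\!\oint\frac{dz'}{2\pi iz'}\frac{dz''}{2\pi iz''}F(z')F(z'')\frac{[S-1]_+[1]^2}{[S-\frac32]_+[S-2]_+[2S-2]}\frac{[v-u'+2S-3][v-u''+1][u'-u''+S-1]_+}{[v-u'][v-u''][u'-u''+\frac12]},$$ $$E_{-,+}(v)=a^{*2}\oint\!\!\oint\frac{dz'}{2\pi iz'}\frac{dz''}{2\pi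 iz''}E(z')E(z'')\frac{[1]^{*2}}{[P-\frac12]_+^*[2P-2]^*}\frac{[v-u'-2P+\frac52]^*[u'-u''-P]^*_+}{[v-u'+\frac12]^*[u'-u''-\frac12]^*},$$ with $z_v=q^{2v}$ and contours $|pz_v|<|z'|<|z_v|$ for $F_{0,-}$; $|pz_v|<|z'|,|z''|<|z_v|$, $|pqz'|<|z''|<|qz'|$ for $F_{+,-}$; $|p^*qz_v|<|z'|<|qz_v|$ for $E_{-,0}$, $E_{-,+}$, where in $E_{-,+}$ the $z''$-contour encircles $q^{-1}p^{*k}z'$ but neither $qp^{*-k}z'$ nor $q^{-2}p^{*-1-k}z'$ $(k\ge0)$. Products of currents are understood through matrix coefficients: they converge for $|z_1|\gg|z_2|\gg\cdots$ and are continued meromorphically; relations between products are identities of these continuations. **Theorem.** Put $$\Phi_-(u)=:\!\exp\Big(-\sum_{m\neq0}\frac{\beta_mz^{-m}}{[2m]_q-[m]_q}\Big)\!:e^{\hat\alpha}z^{\frac h2+\frac12}z^{-\frac Pr-\frac h{2r}-\frac1r},\qquad \Psi^*_-(u)=:\!\exp\Big(\sum_{m\neq0}\frac{\alpha_mz^{-m}}{[2m]_q-[m]_q}\Big)\!:e^{-\hat\alpha}z^{-\frac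 h2+\frac12}e^Qz^{\frac P{r^*}+\frac1{r^*}}.$$ (1) These solve the conditions on the highest type-I and type-II components: $$\Phi_-(u_2+\tfrac12)K_-(u_1)=\rho^+(u_1-u_2)K_-(u_1)\Phi_-(u_2+\tfrac12),\quad \Phi_-(u_1)E(u_2)=E(u_2)\Phi_-(u_1),\quad [\Phi_-(u),P]=0,$$ $$\Phi_-(u_1)F(u_2)=-\frac{[u_1-u_2+\frac12]}{[u_1-u_2-\frac12]}F(u_2)\Phi_-(u_1);$$ $$K_-(u_1)\Psi_-^*(u_2+1)=\rho^{+*}(u_1-u_2)\Psi_-^*(u_2+1)K_-(u_1),\quad \Psi^*_-(u_1)F(u_2)=F(u_2)\Psi^*_-(u_1),\quad [\Psi^*_-(u),P+\tfrac h2]=0,$$ $$\Psi_-^*(u_1)E(u_2)=-\frac{[u_1-u_2-\frac12]^*}{[u_1-u_2+\frac12]^*}E(u_2)\Psi^*_-(u_1).$$ (2) The compositions $\Phi_0(u)=F_{0,-}(u-r-\frac12)\Phi_-(u)$ and $\Phi_+(u)=-F_{+,-}(u-r-\frac12)\Phi_-(u)$ converge, and (with $S=P+\frac h2$) $$\Phi_0(u)=a\oint\frac{dz'}{2\pi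 iz'}\Phi_-(u)F(z')\frac{[u-u'+S]_+[1]}{[u-u'+\frac12][S+\frac12]_+}=-a\oint\frac{dz'}{2\pi iz'}F(z')\Phi_-(u)\frac{[u-u'+S]_+[1]}{[u-u'-\frac12][S+\frac12]_+},$$ $$\Phi_+(u)=-a^2\oint\!\!\oint\frac{dz'}{2\pi iz'}\frac{dz''}{2\pi iz''}\Phi_-(u)F(z')F(z'')\,C\,\frac{[u-u'+2S-\frac32][u'-u''+S]_+}{[u-u'+\frac12][u'-u''+\frac12]}$$ $$=-a^2\oint\!\!\oint\frac{dz'}{2\pi iz'}\frac{dz''}{2\pi iz''}F(z')F(z'')\Phi_-(u)\,C\,\frac{[u-u'+2S-\frac32][u'-u''+S]_+[u-u''+\frac12]}{[u-u'-\frac12][u-u''-\frac12][u'-u''+\frac12]},\quad C=\frac{[S]_+[1]^2}{[S-\frac12]_+[S-1]_+[2S]},$$ on circles with $|q^{-1}z|<|z'|,|z''|<|p^{-1}q^{-1}z|$ and $|pqz'|<|z''|<|qz'|$. (3) Where they converge, the compositions $\Psi^*_-(u)E_{-,0}(v)$ and $\Psi_-^*(u)E_{-,+}(v)$ are given by the contour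 integrals of the products of currents. With $\Psi_0^*(u)=\Psi_-^*(u)E_{-,0}(u-1-r^*)$ and $\Psi^*_+(u)=-\Psi^*_-(u)E_{-,+}(u-1-r^*)$ given by the same integrals on the contours below, $$\Psi_0^*(u)=-a^*\oint\frac{dz'}{2\pi iz'}\Psi_-^*(u)E(z')\frac{[u-u'-P]_+^*[1]^*}{[u-u'-\frac12]^*[P-\frac12]_+^*}=a^*\oint\frac{dz'}{2\pi iz'}E(z')\Psi_-^*(u)\frac{[u-u'-P]_+^*[1]^*}{[u-u'+\frac12]^*[P-\frac12]_+^*},$$ $$\Psi_+^*(u)=-a^{*2}\oint\!\!\oint\frac{dz'}{2\pi iz'}\frac{dz''}{2\pi iz''}\Psi_-^*(u)E(z')E(z'')\,C^*\,\frac{[u-u'-2P+\frac32]^*[u'-u''-P]_+^*}{[u-u'-\frac12]^*[u'-u''-\frac12]^*}$$ $$=-a^{*2}\oint\!\!\oint\frac{dz'}{2\pi iz'}\frac{dz''}{2\pi iz''}E(z')E(z'')\Psi_-^*(u)\,C^*\,\frac{[u-u'-2P+\frac32]^*[u'-u''-P]_+^*[u-u''-\frac12]^*}{[u-u'+\frac12]^*[u-u''+\frac12]^*[u'-u''-\frac12]^*},\quad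 C^*=\frac{[1]^{*2}}{[P-\frac12]_+^*[2P-2]^*}.$$ Write $x\prec\gamma\prec y$ if the closed curve $\gamma$, winding once around $0$, encircles all $xp^{*k}$ but no $yp^{*-k}$ $(k\ge0)$, and avoids $xp^{*\mathbb Z}\cup yp^{*\mathbb Z}$. The contours satisfy $q^{-1}z\prec z'\prec qz$ for $\Psi^*_0$; for $\Psi^*_+$ they satisfy $q^{-1}z\prec z'\prec qz$, $q^{-2}z\prec z'\prec q^2z$, and, for each $z'$, $q^{-1}z\prec z''\prec qz$, $q^{-1}z'\prec z''\prec qz'$, with no $q^{-2}p^{*-1-k}z'$ $(k\ge 0)$ inside the $z''$-contour. -/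

import Mathlib

open scoped BigOperators Nat

noncomputable section

namespace EllA22

/-! ### Theta functions and scalar factors

The base `q` is real with `0 < q < 1`; a spectral variable `z` is written `z = q^(2u)` with `u : ℂ`,
so that all powers `z ^ a = q ^ (2 * u * a)` are unambiguous.  The elliptic nome attached to a
parameter `R` is `q ^ (2R)`; starred objects are the same objects with `R = r - 1`. -/

/-- `z ^ a = q ^ (2 u a)` for `z = q ^ (2u)`. -/
def zpw (q : ℝ) (u a : ℂ) : ℂ := (q : ℂ) ^ (2 * u * a)

/-- the point `z = q ^ (2u)` -/
def zOf (q : ℝ) (u : ℂ) : ℂ := (q : ℂ) ^ (2 * u)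

/-- the nome `q ^ (2R)` -/
def nome (q R : ℝ) : ℝ := q ^ (2 * R)

/-- `(z; t)_∞` -/
def poch (z t : ℂ) : ℂ := ∏' n : ℕ, (1 - z * t ^ n)

/-- `(z; t₁, t₂)_∞` -/
def poch₂ (z t₁ t₂ : ℂ) : ℂ := ∏' n : ℕ × ℕ, (1 - z * t₁ ^ n.1 * t₂ ^ n.2)

/-- `Θ_p(z) = (z;p)_∞ (p/z;p)_∞ (p;p)_∞` -/
def Theta (p z : ℂ) : ℂ := poch z p * poch (p * z⁻¹) p * poch p p

/-- `[u] = q^(u²/R - u) Θ_p(q^(2u))`, `p = q^(2R)` -/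
def br (q R : ℝ) (u : ℂ) : ℂ :=
  (q : ℂ) ^ (u ^ 2 / (R : ℂ) - u) * Theta (nome q R : ℂ) (zOf q u)

/-- `[u]_+ = q^(u²/R - u) Θ_p(-q^(2u))`, `p = q^(2R)` -/
def brP (q R : ℝ) (u : ℂ) : ℂ :=
  (q : ℂ) ^ (u ^ 2 / (R : ℂ) - u) * Theta (nome q R : ℂ) (-zOf q u)

/-- the scalar factor `ρ⁺(u)` of the `R`-matrix, with `{x} = (x; p, q⁶)_∞` and `p = q^(2R)` -/
def rhoPlus (q R : ℝ) (u : ℂ) : ℂ :=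
  let p : ℂ := (nome q R : ℂ)
  let Q : ℂ := (q : ℂ)
  let z : ℂ := zOf q u
  let b : ℂ → ℂ := fun x => poch₂ x p (Q ^ 6);
  -(Q * zpw q u (1 / (R : ℂ))) *
    (b (p * Q ^ 2 * z) * b (p * Q ^ 3 * z) ^ 2 * b (p * Q ^ 4 * z) *
      b (1 / z) * b (Q / z) * b (Q ^ 5 / z) * b (Q ^ 6 / z)) /
    (b (p * z) * b (p * Q * z) * b (p * Q ^ 5 * z) * b (p * Q ^ 6 * z) *
      b (Q ^ 2 / z) * b (Q ^ 3 / z) ^ 2 * b (Q ^ 4 / z))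

/-- the `q`-number `[x]_q` -/
def qnum (q x : ℝ) : ℝ := (q ^ x - q ^ (-x)) / (q - q⁻¹)

/-! ### The level-one Fock module

The bosons satisfy `[a_m, a_n] = δ_{m+n,0} (1/m) ([2m]_q - [m]_q) q^{-|m|} [m]_q`.  They act on
`ℂ[a_{-1}, a_{-2}, …] = MvPolynomial ℕ+ ℂ`: `a_{-m}` is multiplication by `X m`, and `a_m` is
`heis q m • ∂/∂(X m)`.  The zero modes act on the span of the vectors
`e^{n α̂} e^{μ Q}` times a highest weight vector, where `h = 2n + 1` and `P = s + μ`. -/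

/-- `[a_m, a_{-m}]` for `m > 0` at level one -/
def heis (q : ℝ) (m : ℕ+) : ℝ :=
  1 / (m : ℝ) * (qnum q (2 * (m : ℝ)) - qnum q (m : ℝ)) * q ^ (-(m : ℝ)) * qnum q (m : ℝ)

/-- `exp (∑_{m>0} c(-m) a_{-m})`, as a formal power series in the `a_{-m}` -/
def creation (c : ℤ → ℂ) : MvPowerSeries ℕ+ ℂ :=
  fun k => k.prod fun m j => c (-(m : ℤ)) ^ j / (j ! : ℂ)

/-- `exp (∑_{m>0} c(m) a_m)`: the exponential of the constant-coefficient derivation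
`∑ c(m) heis(m) ∂/∂(X m)`, that is, the translation `X m ↦ X m + c(m) heis(m)`. -/
def annihilation (q : ℝ) (c : ℤ → ℂ) : MvPolynomial ℕ+ ℂ →ₐ[ℂ] MvPolynomial ℕ+ ℂ :=
  MvPolynomial.aeval fun m : ℕ+ =>
    MvPolynomial.X m + MvPolynomial.C (c (m : ℤ) * (heis q m : ℂ))

/-- the normally ordered exponential `:exp (∑_{m≠0} c(m) a_m): f` -/
def normExp (q : ℝ) (c : ℤ → ℂ) (f : MvPolynomial ℕ+ ℂ) : MvPowerSeries ℕ+ ℂ :=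
  creation c * (annihilation q c f : MvPowerSeries ℕ+ ℂ)

/-- coefficients with respect to the `a_m` of `∑ c(m) α_m`, where `α_m = a_m` and
`α_{-m} = ([rm]_q / [(r-1)m]_q) q^m a_{-m}` for `m > 0` -/
def alphaCoef (q r : ℝ) (c : ℤ → ℂ) : ℤ → ℂ := fun m =>
  if 0 < m then c m
  else c m * ((qnum q (r * m) / qnum q ((r - 1) * m) * q ^ |(m : ℝ)| : ℝ) : ℂ)

/-- coefficients with respect to the `a_m` of `∑ c(m) β_m`, where
`β_m = ([(r-1)m]_q / [rm]_q) α_m` -/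
def betaCoef (q r : ℝ) (c : ℤ → ℂ) : ℤ → ℂ :=
  alphaCoef q r fun m => c m * ((qnum q ((r - 1) * m) / qnum q (r * m) : ℝ) : ℂ)

/-- basis vectors: a monomial in the `a_{-m}`, and the exponents `(n, μ)` of `e^{n α̂} e^{μ Q}` -/
abbrev State : Type := (ℕ+ →₀ ℕ) × (ℤ × ℤ)

/-- eigenvalue of `h` on zero-mode vectors -/
def hval (x : ℤ × ℤ) : ℂ := 2 * (x.1 : ℂ) + 1

/-- eigenvalue of `P` on zero-mode vectors -/
def Pval (s : ℂ) (x : ℤ × ℤ) : ℂ := s + (x.2 : ℂ)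

/-- eigenvalue of `P + h/2` on zero-mode vectors -/
def Sval (s : ℂ) (x : ℤ × ℤ) : ℂ := Pval s x + hval x / 2

/-- operators on the zero-mode space -/
abbrev ZeroOp : Type := Module.End ℂ ((ℤ × ℤ) →₀ ℂ)

/-- `e^{k α̂}` -/
def eAlpha (k : ℤ) : ZeroOp := Finsupp.lmapDomain ℂ ℂ fun x : ℤ × ℤ => (x.1 + k, x.2)

/-- `e^{k Q}`; the sign comes from `[Q, α̂] = π i`, i.e. `e^Q e^α̂ = - e^α̂ e^Q` -/
def eQ (k : ℤ) : ZeroOp :=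
  Finsupp.linearCombination ℂ fun x : ℤ × ℤ =>
    Finsupp.single (x.1, x.2 + k) ((-1 : ℂ) ^ (x.1 * k))

/-- the function `g(h, P)` of the zero modes `h` and `P` -/
def zdiag (s : ℂ) (g : ℂ → ℂ → ℂ) : ZeroOp :=
  Finsupp.linearCombination ℂ fun x : ℤ × ℤ => Finsupp.single x (g (hval x) (Pval s x))

/-- Operators from the Fock module to its completion, given by their matrix coefficients: `A w v` is
the coefficient of the basis vector `w` in `A v`. -/
abbrev Op : Type := State → State → ℂ

/-- `:exp (∑ c(m) a_m): ⊗ Z` -/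
def vertexOp (q : ℝ) (c : ℤ → ℂ) (Z : ZeroOp) : Op := fun w v =>
  MvPowerSeries.coeff w.1 (normExp q c (MvPolynomial.monomial v.1 1)) *
    Z (Finsupp.single v.2 1) w.2

/-- `ε(q) = (q^{1/2} + q^{-1/2})^{-1/2}` -/
def epsq (q : ℝ) : ℝ := (q ^ (1 / 2 : ℝ) + q ^ (-(1 / 2) : ℝ)) ^ (-(1 / 2) : ℝ)

/-- `E(z) = ε(q) :exp(-∑ α_m z^{-m} / [m]_q): e^α̂ z^{h/2+1/2} e^{-Q} z^{-(P-1/2)/(r-1)}` -/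
def curE (q r : ℝ) (s : ℂ) (u : ℂ) : Op :=
  (epsq q : ℂ) • vertexOp q
    (alphaCoef q r fun m => -(zpw q u (-(m : ℂ)) / (qnum q m : ℂ)))
    (eAlpha 1 * zdiag s (fun h _ => zpw q u (h / 2 + 1 / 2)) * eQ (-1) *
      zdiag s (fun _ P => zpw q u (-(P - 1 / 2) / ((r : ℂ) - 1))))

/-- `F(z) = ε(q) :exp(∑ β_m z^{-m} / [m]_q): e^{-α̂} z^{-h/2+1/2} z^{(P-1/2)/r + h/(2r)}` -/
def curF (q r : ℝ) (s : ℂ) (u : ℂ) : Op :=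
  (epsq q : ℂ) • vertexOp q
    (betaCoef q r fun m => zpw q u (-(m : ℂ)) / (qnum q m : ℂ))
    (eAlpha (-1) * zdiag s (fun h _ => zpw q u (-h / 2 + 1 / 2)) *
      zdiag s (fun h P => zpw q u ((P - 1 / 2) / (r : ℂ) + h / (2 * (r : ℂ)))))

/-- `K_-(z) = K(q^{r+1} z)^{-1}`, where
`K(z) = :exp(-∑ [m]_q / ([rm]_q ([2m]_q - [m]_q)) α_m z^{-m}): e^{-Q} z^B`,
`B = (1/r - 1/(r-1)) (P - 1/2) + h/(2r)`.  The scalar in front comes from inverting a normally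
ordered exponential: `(:e^A:)⁻¹ = e^{[A₊, A₋]} :e^{-A}:`. -/
def curKm (q r : ℝ) (s : ℂ) (u : ℂ) : Op :=
  let ζ : ℂ := u + ((r : ℂ) + 1) / 2
  ((Real.exp (-∑' m : ℕ+, qnum q (m : ℝ) ^ 3 /
      ((m : ℝ) * qnum q (r * (m : ℝ)) * qnum q ((r - 1) * (m : ℝ)) *
        (qnum q (2 * (m : ℝ)) - qnum q (m : ℝ)))) : ℝ) : ℂ) • vertexOp q
    (alphaCoef q r fun m =>
      ((qnum q m / (qnum q (r * m) * (qnum q (2 * m) - qnum q m)) : ℝ) : ℂ) * zpw q ζ (-(m : ℂ)))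
    (zdiag s (fun h P => zpw q ζ
        (-((1 / (r : ℂ) - 1 / ((r : ℂ) - 1)) * (P - 1 / 2) + h / (2 * (r : ℂ))))) * eQ 1)

/-- `Φ_-(z) = :exp(-∑ β_m z^{-m} / ([2m]_q - [m]_q)): e^α̂ z^{h/2+1/2} z^{-P/r - h/(2r) - 1/r}` -/
def PhiMinus (q r : ℝ) (s : ℂ) (u : ℂ) : Op :=
  vertexOp q
    (betaCoef q r fun m => -(zpw q u (-(m : ℂ)) / ((qnum q (2 * m) - qnum q m : ℝ) : ℂ)))
    (eAlpha 1 * zdiag s (fun h _ => zpw q u (h / 2 + 1 / 2)) *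
      zdiag s (fun h P => zpw q u (-P / (r : ℂ) - h / (2 * (r : ℂ)) - 1 / (r : ℂ))))

/-- `Ψ*_-(z) = :exp(∑ α_m z^{-m} / ([2m]_q - [m]_q)): e^{-α̂} z^{-h/2+1/2} e^Q z^{P/(r-1) + 1/(r-1)}` -/
def PsiMinus (q r : ℝ) (s : ℂ) (u : ℂ) : Op :=
  vertexOp q
    (alphaCoef q r fun m => zpw q u (-(m : ℂ)) / ((qnum q (2 * m) - qnum q m : ℝ) : ℂ))
    (eAlpha (-1) * zdiag s (fun h _ => zpw q u (-h / 2 + 1 / 2)) * eQ 1 *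
      zdiag s (fun _ P => zpw q u (P / ((r : ℂ) - 1) + 1 / ((r : ℂ) - 1))))

/-! ### Products and their continuation -/

/-- `A(u₁) B(u₂) = g(u₁,u₂) B(u₂) A(u₁)`: for all matrix coefficients, the product on the left
converges for `|z₂| ≪ |z₁|`, the product on the right converges for `|z₁| ≪ |z₂|`, both continue
meromorphically in `u₂ ∈ ℂ`, and the continuations satisfy the identity of meromorphic functions. -/
def ExchangeRel (q : ℝ) (A B : ℂ → Op) (g : ℂ → ℂ → ℂ) : Prop :=
  ∀ w v : State, ∃ M N : ℂ → ℂ → ℂ,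
    (∀ u₁, MeromorphicOn (M u₁) Set.univ) ∧ (∀ u₁, MeromorphicOn (N u₁) Set.univ) ∧
    (∃ ε > (0 : ℝ), ∀ u₁ u₂, ‖zOf q u₂‖ < ε * ‖zOf q u₁‖ →
      HasSum (fun n : State => A u₁ w n * B u₂ n v) (M u₁ u₂)) ∧
    (∃ ε > (0 : ℝ), ∀ u₁ u₂, ‖zOf q u₁‖ < ε * ‖zOf q u₂‖ →
      HasSum (fun n : State => B u₂ w n * A u₁ n v) (N u₁ u₂)) ∧
    ∀ u₁, M u₁ =ᶠ[Filter.codiscrete ℂ] fun u₂ => g u₁ u₂ * N u₁ u₂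

/-- `M` is the analytic continuation to `Ω` of the matrix coefficient `(w, v)` of `A(u₁) B(u₂)`. -/
def IsCont₂ (q : ℝ) (A B : ℂ → Op) (Ω : Set (ℂ × ℂ)) (w v : State) (M : ℂ → ℂ → ℂ) : Prop :=
  DifferentiableOn ℂ (fun x : ℂ × ℂ => M x.1 x.2) Ω ∧
  ∃ ε > (0 : ℝ), ∀ u₁ u₂, ‖zOf q u₂‖ < ε * ‖zOf q u₁‖ →
    HasSum (fun n : State => A u₁ w n * B u₂ n v) (M u₁ u₂)

/-- `M` is the analytic continuation to `Ω` of the matrix coefficient `(w, v)` of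
`A(u₁) B(u₂) C(u₃)`. -/
def IsCont₃ (q : ℝ) (A B C : ℂ → Op) (Ω : Set (ℂ × ℂ × ℂ)) (w v : State)
    (M : ℂ → ℂ → ℂ → ℂ) : Prop :=
  DifferentiableOn ℂ (fun x : ℂ × ℂ × ℂ => M x.1 x.2.1 x.2.2) Ω ∧
  ∃ ε > (0 : ℝ), ∀ u₁ u₂ u₃, ‖zOf q u₂‖ < ε * ‖zOf q u₁‖ → ‖zOf q u₃‖ < ε * ‖zOf q u₂‖ →
    HasSum (fun n : State × State => A u₁ w n.1 * B u₂ n.1 n.2 * C u₃ n.2 v) (M u₁ u₂ u₃)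

/-- `z₂/z₁` avoids the set `S` -/
def Off (q : ℝ) (S : Set ℂ) (u₁ u₂ : ℂ) : Prop := zOf q (u₂ - u₁) ∉ S

/-- domain in two variables -/
def Dom₂ (q : ℝ) (S : Set ℂ) : Set (ℂ × ℂ) := {x | Off q S x.1 x.2}

/-- domain in three variables -/
def Dom₃ (q : ℝ) (S₁₂ S₁₃ S₂₃ : Set ℂ) : Set (ℂ × ℂ × ℂ) :=
  {x | Off q S₁₂ x.1 x.2.1 ∧ Off q S₁₃ x.1 x.2.2 ∧ Off q S₂₃ x.2.1 x.2.2}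

/-- values of `z₂/z₁` at which `Φ_-(z₁)F(z₂)` or `F(z₁)Φ_-(z₂)` may be singular -/
def polPhiF (q r : ℝ) : Set ℂ :=
  {x | ∃ k : ℕ, x = ((q⁻¹ * (nome q r ^ k)⁻¹ : ℝ) : ℂ)}

/-- values of `z₂/z₁` at which `F(z₁)F(z₂)` may be singular -/
def polFF (q r : ℝ) : Set ℂ :=
  {x | ∃ k : ℕ, x = ((q⁻¹ * (nome q r ^ k)⁻¹ : ℝ) : ℂ) ∨
    x = ((q ^ 2 * (nome q r ^ (k + 1))⁻¹ : ℝ) : ℂ)}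

/-- values of `z₂/z₁` at which `Ψ*_-(z₁)E(z₂)` or `E(z₁)Ψ*_-(z₂)` may be singular -/
def polPsiE (q r : ℝ) : Set ℂ :=
  {x | ∃ k : ℕ, x = ((q * (nome q (r - 1) ^ k)⁻¹ : ℝ) : ℂ)}

/-- values of `z₂/z₁` at which `E(z₁)E(z₂)` may be singular -/
def polEE (q r : ℝ) : Set ℂ :=
  {x | ∃ k : ℕ, x = ((q * (nome q (r - 1) ^ k)⁻¹ : ℝ) : ℂ) ∨
    x = (((q ^ 2)⁻¹ * (nome q (r - 1) ^ (k + 1))⁻¹ : ℝ) : ℂ)}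

/-! ### Contours -/

/-- `∮ dz/(2πi z) f` over the circle `|z| = q^(2x)`, counterclockwise, `f` being written as a
function of `u`; here `u = x + t π i / log q`, `0 ≤ t ≤ 1`. -/
def circ (q x : ℝ) (f : ℂ → ℂ) : ℂ :=
  ∫ t in (0 : ℝ)..1, f ((x : ℂ) + (t : ℂ) * ((Real.pi : ℂ) * Complex.I / (Real.log q : ℂ)))

/-- A closed `C¹` curve in the punctured `z`-plane with winding number one about `0`, given by its
lift to the `u`-plane. -/
structure Loop (q : ℝ) where
  /-- the lift -/
  path : ℝ → ℂ
  smooth : ContDiff ℝ 1 path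
  closes : ∀ t : ℝ, path (t + 1) = path t + (Real.pi : ℂ) * Complex.I / (Real.log q : ℂ)

/-- the point `z(t)` of the loop -/
def Loop.pt {q : ℝ} (γ : Loop q) (t : ℝ) : ℂ := zOf q (γ.path t)

/-- `∮ dz/(2πi z) f`, where `f` also receives the curve parameter -/
def Loop.integralAux {q : ℝ} (γ : Loop q) (f : ℝ → ℂ → ℂ) : ℂ :=
  (Real.log q : ℂ) / ((Real.pi : ℂ) * Complex.I) *
    ∫ t in (0 : ℝ)..1, f t (γ.path t) * deriv γ.path t

/-- `∮ dz/(2πi z) f`, with `f` written as a function of `u` -/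
def Loop.integral {q : ℝ} (γ : Loop q) (f : ℂ → ℂ) : ℂ := γ.integralAux fun _ => f

/-- `∮ dz'/(2πi z') ∮ dz''/(2πi z'') f`, where the contour of `z''` may depend on `z'` -/
def Loop.integral₂ {q : ℝ} (γ : Loop q) (η : ℝ → Loop q) (f : ℂ → ℂ → ℂ) : ℂ :=
  γ.integralAux fun t u' => (η t).integral (f u')

/-- winding number `(1/2πi) ∮ dz/(z - a)` -/
def Loop.wind {q : ℝ} (γ : Loop q) (a : ℂ) : ℂ :=
  γ.integral fun u => zOf q u / (zOf q u - a)

/-- `a` lies inside the loop -/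
def Loop.Encl {q : ℝ} (γ : Loop q) (a : ℂ) : Prop := (∀ t, γ.pt t ≠ a) ∧ γ.wind a = 1

/-- `a` lies outside the loop -/
def Loop.Excl {q : ℝ} (γ : Loop q) (a : ℂ) : Prop := (∀ t, γ.pt t ≠ a) ∧ γ.wind a = 0

/-- The contour abbreviated `|a| < |z| < |b|`: it encircles `a p^k` but not `b p^{-k}`, `k ≥ 0`
(and does not meet the other points of `a p^ℤ` and `b p^ℤ`). -/
def Loop.Btw {q : ℝ} (γ : Loop q) (p : ℝ) (a b : ℂ) : Prop :=
  (∀ k : ℕ, γ.Encl (a * (p : ℂ) ^ k) ∧ γ.Excl (b * ((p : ℂ) ^ k)⁻¹)) ∧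
  ∀ (k : ℤ) (t : ℝ), γ.pt t ≠ a * (p : ℂ) ^ k ∧ γ.pt t ≠ b * (p : ℂ) ^ k

/-! ### Half currents (level one) -/

/-- kernel of `F⁺_{0,-}(v)` in terms of `y = v - u'` and `S = P + h/2` -/
def kF0 (q r : ℝ) (y S : ℂ) : ℂ :=
  brP q r (y + S - 1 / 2) * br q r 1 / (br q r y * brP q r (S - 1 / 2))

/-- kernel of `F⁺_{+,-}(v)` in terms of `y' = v - u'`, `y'' = v - u''` and `S = P + h/2` -/
def kF2 (q r : ℝ) (y' y'' S : ℂ) : ℂ :=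
  brP q r (S - 1) * br q r 1 ^ 2 /
      (brP q r (S - 3 / 2) * brP q r (S - 2) * br q r (2 * S - 2)) *
    (br q r (y' + 2 * S - 3) * br q r (y'' + 1) * brP q r (y'' - y' + S - 1)) /
    (br q r y' * br q r y'' * br q r (y'' - y' + 1 / 2))

/-- kernel of `E⁺_{-,0}(v)` in terms of `y = v - u'` and `P` (`c = 1`) -/
def kE0 (q r : ℝ) (y P : ℂ) : ℂ :=
  brP q (r - 1) (y - P + 1) * br q (r - 1) 1 /
    (br q (r - 1) (y + 1 / 2) * brP q (r - 1) (P - 1 / 2))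

/-- kernel of `E⁺_{-,+}(v)` in terms of `y = v - u'`, `d = u' - u''` and `P` (`c = 1`) -/
def kE2 (q r : ℝ) (y d P : ℂ) : ℂ :=
  br q (r - 1) 1 ^ 2 / (brP q (r - 1) (P - 1 / 2) * br q (r - 1) (2 * P - 2)) *
    (br q (r - 1) (y - 2 * P + 5 / 2) * brP q (r - 1) (d - P)) /
    (br q (r - 1) (y + 1 / 2) * br q (r - 1) (d - 1 / 2))

/-- the half current `F⁺_{0,-}(v)`, contour `|z'| = q^(2x)`; functions of `P`, `h` stand on the
right of the currents -/
def halfF0 (q r : ℝ) (s a : ℂ) (x : ℝ) (v : ℂ) : Op := fun w n =>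
  a * circ q x fun u' => curF q r s u' w n * kF0 q r (v - u') (Sval s n.2)

/-- the half current `F⁺_{+,-}(v)` with `a_{+-} = a_{0-}²`, contours `|z'| = q^(2x')`,
`|z''| = q^(2x'')` -/
def halfF2 (q r : ℝ) (s a : ℂ) (x' x'' : ℝ) (v : ℂ) : Op := fun w n =>
  a ^ 2 * circ q x' fun u' => circ q x'' fun u'' =>
    (∑' m : State, curF q r s u' w m * curF q r s u'' m n) *
      kF2 q r (v - u') (v - u'') (Sval s n.2)

/-- the half current `E⁺_{-,0}(v)`, contour `|z'| = q^(2x)` -/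
def halfE0 (q r : ℝ) (s a : ℂ) (x : ℝ) (v : ℂ) : Op := fun w n =>
  a * circ q x fun u' => curE q r s u' w n * kE0 q r (v - u') (Pval s n.2)

/-- the half current `E⁺_{-,+}(v)` with `a*_{-+} = (a*_{-0})²`, contours `|z'| = q^(2x)` and
`z''/z' ∈ η`; `EE` are the continued matrix coefficients of `E(z')E(z'')` -/
def halfE2 (q r : ℝ) (s a : ℂ) (EE : State → State → ℂ → ℂ → ℂ) (x : ℝ) (η : Loop q) (v : ℂ) :
    Op := fun w n =>
  a ^ 2 * circ q x fun u' => η.integral fun y =>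
    EE w n u' (u' + y) * kE2 q r (v - u') (-y) (Pval s n.2)

/-- the dynamical parameter is generic: no denominator depending on `P`, `h` vanishes -/
def Generic (q r : ℝ) (s : ℂ) : Prop :=
  ∀ k : ℤ, br q r (2 * s + k) ≠ 0 ∧ br q (r - 1) (2 * s + k) ≠ 0 ∧
    brP q r (s + k / 2) ≠ 0 ∧ brP q (r - 1) (s + k / 2) ≠ 0

end EllA22

end

open scoped BigOperators Nat

noncomputable section

namespace EllA22


/-! ### Exponential series in several variables -/

/-! All the operators have one shape, recorded in `Fam`: a normally ordered exponential of the
bosons with coefficients `γ(m) z^{-m}`, tensored with a zero-mode shift weighted by `κ(x) z^{e(x)}`.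
A product of two of them is a scalar times their normally ordered product. The scalar, called the
contraction, is `exp (∑ γ(m) [a_m, a_{-m}] γ'(-m) (z₂/z₁)^m)`. It depends only on `z₂/z₁`, converges
in a disc, and sums to an explicit quotient of infinite products. The normally ordered product is
entire in all variables, and reversing its two factors only costs a factor `σ (z₁/z₂)^a` from the
zero modes. So contraction times normally ordered product (`Fam.prod₂`, `Fam.prod₃`) is the
meromorphic continuation, and an exchange relation is a scalar identity between two contractions
(`Fam.exchangeRel`).

The Fock space part rests on `hasSum_fock_mul_fock`. Annihilation exponentials are translations of
polynomials, creation exponentials are power series, and moving one past the other produces the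
exponential of the pairing. Sums over intermediate states are controlled by the same matrix
coefficients with real nonnegative data (`vmaj`), which gives absolute convergence of triple
products and the interchange of state sums with contour integrals.

Three kinds of scalar identity occur. `Φ_-` with `E` and `Ψ*_-` with `F` contract to `1 - z₂/z₁`,
and the zero modes turn this into `1 - z₁/z₂`. `Φ_-` with `F` and `Ψ*_-` with `E` contract to
`ctrA`; its product with `Θ_p(Qx)` is invariant under `x ↦ 1/x` (`ctrA_mul_theta`), so the exchange
factor is a quotient of brackets (`br_mul_ctrA`). With `K_-` the contraction is a quotient `ctrK` of
double products or its inverse, and `ρ⁺` is a quotient of two values of `ctrK` up to a monomial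
(`rhoPlus_eq`). The link to the data is the expansion of ratios of `q`-numbers in the nome:
`qnum_div_typeI`, `qnum_div_typeII`, `qnum_sq_div`.

For the lower type-I components, the given circles make the kernels regular and lie where `F Φ_-`
converges, so the composition is the integral of the continued product. The argument `u - r - 1/2`
is brought to `u` by `[u - r] = -[u]` and `[u - r]_+ = [u]_+`, and `S` becomes `S + 1` because `Φ_-`
raises `h` by 2. Moving `Φ_-` to the left is then the exchange identity under the integral.

For type II, convergence asks for `|z'| < q|z|`, while regularity of the kernel at `v = u - 1 - r*`
asks for `|z'| > q⁻¹|z|`, so no circle serves both. Hence the compositions are computed at an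
independent argument `u₀`, and the formulas at `u₀ = u - 1 - r*` are identities of integrals over
deformed curves, valid pointwise along any curve avoiding the zeros of the brackets. -/

/-- the monomial `x ^ l / l!` -/
def divPow {K : Type*} [Field K] (x : ℕ+ → K) (l : ℕ+ →₀ ℕ) : K :=
  l.prod fun m j => x m ^ j / (j ! : K)

lemma divPow_eq_prod (x : ℕ+ → ℂ) (l : ℕ+ →₀ ℕ) {s : Finset ℕ+} (hs : l.support ⊆ s) :
    divPow x l = ∏ m ∈ s, x m ^ l m / ((l m)! : ℂ) :=
  Finsupp.prod_of_support_subset _ hs _ (by simp)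

lemma norm_divPow (x : ℕ+ → ℂ) (l : ℕ+ →₀ ℕ) :
    ‖divPow x l‖ = l.prod fun m j => ‖x m‖ ^ j / (j ! : ℝ) := by
  simp [divPow, Finsupp.prod, norm_prod]

/-- multi-indices supported in `{1, …, N}` of degree less than `N` -/
def degBox (N : ℕ) : Finset (ℕ+ →₀ ℕ) :=
  (Finset.range N).biUnion fun n =>
    Finset.finsuppAntidiag ((Finset.range N).image Nat.succPNat) n

/-- The boxes exhaust the multi-indices, and over each of them the exponential sum can be evaluated
in closed form; this is why they are used instead of arbitrary finite sets. -/
lemma tendsto_degBox : Filter.Tendsto degBox Filter.atTop Filter.atTop := by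
  have hm : Monotone degBox := by
    intro a b hab l hl
    simp only [degBox, Finset.mem_biUnion, Finset.mem_range, Finset.mem_finsuppAntidiag] at hl ⊢
    obtain ⟨n, hn, h1, h2⟩ := hl
    have hsub : (Finset.range a).image Nat.succPNat ⊆ (Finset.range b).image Nat.succPNat :=
      Finset.image_subset_image (Finset.range_mono hab)
    refine ⟨n, by omega, ?_, h2.trans hsub⟩
    rw [← h1]
    refine (Finset.sum_subset hsub fun x _ hx => ?_).symm
    by_contra h
    exact hx (h2 (Finsupp.mem_support_iff.2 h))
  refine Filter.tendsto_atTop_finset_of_monotone hm fun l => ?_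
  have hbd : ∃ B : ℕ, ∀ m ∈ l.support, (m : ℕ) ≤ B := by
    refine ⟨∑ m ∈ l.support, (m : ℕ), fun m hm => ?_⟩
    exact Finset.single_le_sum (f := fun m : ℕ+ => (m : ℕ)) (fun _ _ => Nat.zero_le _) hm
  obtain ⟨B, hB⟩ := hbd
  have hsub : l.support ⊆ (Finset.range (B + l.degree + 1)).image Nat.succPNat := by
    intro m hm
    refine Finset.mem_image.2 ⟨m.natPred, Finset.mem_range.2 ?_, PNat.succPNat_natPred m⟩
    have := hB m hm
    have h2 := PNat.natPred_add_one m
    omega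
  refine ⟨B + l.degree + 1, ?_⟩
  simp only [degBox, Finset.mem_biUnion, Finset.mem_range, Finset.mem_finsuppAntidiag]
  refine ⟨l.degree, by omega, ?_, hsub⟩
  rw [Finsupp.degree]
  refine (Finset.sum_subset hsub fun x _ hx => ?_).symm
  simpa using hx

/-- This is the multinomial theorem divided by `n !`, which turns multinomial coefficients into
products of inverse factorials. -/
lemma sum_finsuppAntidiag_divPow (x : ℕ+ → ℂ) (s : Finset ℕ+) (n : ℕ) :
    ∑ l ∈ Finset.finsuppAntidiag s n, divPow x l = (∑ m ∈ s, x m) ^ n / (n ! : ℂ) := by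
  rw [Finset.sum_pow_eq_sum_piAntidiag, Finset.sum_div]
  refine Finset.sum_bij' (fun l _ => (l : ℕ+ → ℕ))
    (fun f hf => Finsupp.onFinset s f fun a ha => by
      simp only [Finset.mem_piAntidiag] at hf; exact hf.2 a ha) ?_ ?_ ?_ ?_ ?_
  · intro l hl
    simp only [Finset.mem_finsuppAntidiag, Finset.mem_piAntidiag] at hl ⊢
    exact ⟨hl.1, fun i hi => hl.2 (Finsupp.mem_support_iff.2 hi)⟩
  · intro f hf
    simp only [Finset.mem_finsuppAntidiag, Finset.mem_piAntidiag] at hf ⊢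
    exact ⟨hf.1, Finsupp.support_onFinset_subset⟩
  · intro l hl; ext; rfl
  · intro f hf; rfl
  · intro l hl
    simp only [Finset.mem_finsuppAntidiag] at hl
    rw [divPow_eq_prod x l hl.2, Finset.prod_div_distrib]
    have h := Nat.multinomial_spec s (l : ℕ+ → ℕ)
    rw [hl.1] at h
    have h' : (∏ i ∈ s, ((l i)! : ℂ)) * (Nat.multinomial s (l : ℕ+ → ℕ) : ℂ) = (n ! : ℂ) := by
      rw [← h]; push_cast; rfl
    have h1 : (∏ i ∈ s, ((l i)! : ℂ)) ≠ 0 :=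
      Finset.prod_ne_zero_iff.2 fun i _ => by exact_mod_cast Nat.factorial_ne_zero _
    have h2 : (n ! : ℂ) ≠ 0 := by exact_mod_cast Nat.factorial_ne_zero _
    field_simp
    rw [← h']; ring

lemma sum_degBox_divPow (x : ℕ+ → ℂ) (N : ℕ) :
    ∑ l ∈ degBox N, divPow x l =
      ∑ n ∈ Finset.range N, (∑ m ∈ (Finset.range N).image Nat.succPNat, x m) ^ n / (n ! : ℂ) := by
  rw [degBox, Finset.sum_biUnion]
  · exact Finset.sum_congr rfl fun n _ => sum_finsuppAntidiag_divPow x _ n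
  · intro a _ b _ hab
    refine Finset.disjoint_left.2 fun l h1 h2 => hab ?_
    simp only [Finset.mem_finsuppAntidiag] at h1 h2
    rw [← h1.1, ← h2.1]

lemma divPow_ofReal_norm (x : ℕ+ → ℂ) (l : ℕ+ →₀ ℕ) :
    divPow (fun m => (‖x m‖ : ℂ)) l = (‖divPow x l‖ : ℂ) := by
  rw [norm_divPow]; simp [divPow, Finsupp.prod]

/-- Any finite set sits in a box, where the sum of norms is a truncated exponential series and so at
most `exp (∑ ‖x m‖)`. -/
lemma summable_norm_divPow {x : ℕ+ → ℂ} (hx : Summable fun m => ‖x m‖) :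
    Summable fun l => ‖divPow x l‖ := by
  refine summable_of_sum_le (c := Real.exp (∑' m, ‖x m‖)) (fun l => norm_nonneg _) fun u => ?_
  obtain ⟨N, hN⟩ := (tendsto_degBox.eventually (Filter.eventually_ge_atTop u)).exists
  refine (Finset.sum_le_sum_of_subset_of_nonneg hN fun _ _ _ => norm_nonneg _).trans ?_
  have h := sum_degBox_divPow (fun m => (‖x m‖ : ℂ)) N
  simp only [divPow_ofReal_norm] at h
  have h' : ∑ l ∈ degBox N, ‖divPow x l‖ = ∑ n ∈ Finset.range N,
      (∑ m ∈ (Finset.range N).image Nat.succPNat, ‖x m‖) ^ n / (n ! : ℝ) := by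
    exact_mod_cast h
  rw [h']
  refine (Real.sum_le_exp_of_nonneg (Finset.sum_nonneg fun _ _ => norm_nonneg _) N).trans ?_
  exact Real.exp_le_exp.2 (hx.sum_le_tsum _ fun _ _ => norm_nonneg _)

/-- Summability being known, the value can be computed along the boxes alone. -/
lemma hasSum_divPow {x : ℕ+ → ℂ} (hx : Summable fun m => ‖x m‖) :
    HasSum (divPow x) (Complex.exp (∑' m, x m)) := by
  refine hasSum_of_subseq_of_summable (summable_norm_divPow hx) tendsto_degBox ?_
  simp only [sum_degBox_divPow]
  have himg : Filter.Tendsto (fun N : ℕ => (Finset.range N).image Nat.succPNat)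
      Filter.atTop Filter.atTop := by
    refine Filter.tendsto_atTop_finset_of_monotone
      (fun a b hab => Finset.image_subset_image (Finset.range_mono hab)) fun m => ?_
    exact ⟨m, Finset.mem_image.2 ⟨m.natPred, Finset.mem_range.2 (by
      have := PNat.natPred_add_one m; omega), PNat.succPNat_natPred m⟩⟩
  have hS : Filter.Tendsto (fun N : ℕ => ∑ m ∈ (Finset.range N).image Nat.succPNat, x m)
      Filter.atTop (nhds (∑' m, x m)) := (hx.of_norm.hasSum).comp himg
  have hB : ∀ N : ℕ, ‖∑ m ∈ (Finset.range N).image Nat.succPNat, x m‖ ≤ ∑' m, ‖x m‖ := fun N =>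
    (norm_sum_le _ _).trans (hx.sum_le_tsum _ fun _ _ => norm_nonneg _)
  -- The number of variables and the degree cutoff grow together. Extending the truncated series by
  -- zero makes the limit a dominated convergence over the degree.
  have key : Filter.Tendsto (fun N : ℕ => ∑' n : ℕ, if n < N then
      (∑ m ∈ (Finset.range N).image Nat.succPNat, x m) ^ n / (n ! : ℂ) else 0)
      Filter.atTop (nhds (∑' n : ℕ, (∑' m, x m) ^ n / (n ! : ℂ))) := by
    refine tendsto_tsum_of_dominated_convergence
      (bound := fun n => (∑' m, ‖x m‖) ^ n / (n ! : ℝ)) (Real.summable_pow_div_factorial _) ?_ ?_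
    · intro n
      refine ((hS.pow n).div_const _).congr' ?_
      filter_upwards [Filter.eventually_gt_atTop n] with N hN
      simp [hN]
    · refine Filter.Eventually.of_forall fun N n => ?_
      split_ifs
      · rw [norm_div, norm_pow, Complex.norm_natCast]
        gcongr
        exact hB N
      · rw [norm_zero]
        exact div_nonneg (pow_nonneg (tsum_nonneg fun _ => norm_nonneg _) _) (Nat.cast_nonneg _)
  have hexp : Complex.exp (∑' m, x m) = ∑' n : ℕ, (∑' m, x m) ^ n / (n ! : ℂ) := by
    rw [Complex.exp_eq_exp_ℂ, NormedSpace.exp_eq_tsum_div]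
  rw [hexp]
  refine key.congr fun N => ?_
  rw [tsum_eq_sum (s := Finset.range N)]
  · exact Finset.sum_congr rfl fun n hn => by simp [Finset.mem_range.1 hn]
  · intro n hn
    simp only [Finset.mem_range] at hn
    simp [hn]


/-! ### Matrix coefficients of normally ordered exponentials -/

/-- the translation `X m ↦ X m + y m` -/
def transl (y : ℕ+ → ℂ) : MvPolynomial ℕ+ ℂ →ₐ[ℂ] MvPolynomial ℕ+ ℂ :=
  MvPolynomial.aeval fun m : ℕ+ => MvPolynomial.X m + MvPolynomial.C (y m)

/-- the coefficient of `X ^ p` in `(X + y) ^ l` -/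
def translCoef {K : Type*} [Field K] (y : ℕ+ → K) (p l : ℕ+ →₀ ℕ) : K :=
  if p.support ⊆ l.support then ∏ m ∈ l.support, (((l m).choose (p m) : K) * y m ^ (l m - p m))
  else 0

lemma coeff_prod_X_add_C (y : ℕ+ → ℂ) (l : ℕ+ → ℕ) (s : Finset ℕ+) (p : ℕ+ →₀ ℕ) :
    MvPolynomial.coeff p (∏ m ∈ s, (MvPolynomial.X m + MvPolynomial.C (y m)) ^ l m) =
      if p.support ⊆ s then ∏ m ∈ s, (((l m).choose (p m) : ℂ) * y m ^ (l m - p m)) else 0 := by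
  induction s using Finset.induction_on generalizing p with
  | empty =>
    simp only [Finset.prod_empty, MvPolynomial.coeff_one, Finset.subset_empty,
      Finsupp.support_eq_empty, eq_comm]
  | insert a s ha ih =>
    rw [Finset.prod_insert ha, add_pow, Finset.sum_mul, MvPolynomial.coeff_sum]
    have hterm : ∀ k, MvPolynomial.coeff p (MvPolynomial.X a ^ k *
        MvPolynomial.C (y a) ^ (l a - k) * ((l a).choose k : MvPolynomial ℕ+ ℂ) *
          ∏ m ∈ s, (MvPolynomial.X m + MvPolynomial.C (y m)) ^ l m) =
        y a ^ (l a - k) * ((l a).choose k : ℂ) *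
          if k ≤ p a then MvPolynomial.coeff (p - Finsupp.single a k)
            (∏ m ∈ s, (MvPolynomial.X m + MvPolynomial.C (y m)) ^ l m) else 0 := by
      intro k
      have : MvPolynomial.X a ^ k * MvPolynomial.C (y a) ^ (l a - k) *
          ((l a).choose k : MvPolynomial ℕ+ ℂ) *
          ∏ m ∈ s, (MvPolynomial.X m + MvPolynomial.C (y m)) ^ l m =
        MvPolynomial.monomial (Finsupp.single a k) (y a ^ (l a - k) * ((l a).choose k : ℂ)) *
          ∏ m ∈ s, (MvPolynomial.X m + MvPolynomial.C (y m)) ^ l m := by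
        rw [MvPolynomial.monomial_eq, Finsupp.prod_single_index (by simp)]
        simp only [map_mul, map_pow, map_natCast]; ring
      rw [this, MvPolynomial.coeff_monomial_mul']
      simp only [Finsupp.single_le_iff]
      split_ifs <;> simp
    simp only [hterm, ih]
    -- In the binomial expansion of the new factor only the power `k = p a` contributes: otherwise
    -- `a` stays in the support of the remaining exponent, but `a ∉ s`.
    have hsupp : ∀ k, k ≤ p a → ((p - Finsupp.single a k).support ⊆ s ↔
        k = p a ∧ p.support ⊆ insert a s) := by
      intro k hk
      constructor
      · intro h
        have h1 : k = p a := by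
          by_contra hne
          refine ha (h (Finsupp.mem_support_iff.2 ?_))
          simp only [Finsupp.coe_tsub, Pi.sub_apply, Finsupp.single_eq_same]; omega
        refine ⟨h1, fun m hm => ?_⟩
        by_cases hma : m = a
        · simp [hma]
        · refine Finset.mem_insert_of_mem (h (Finsupp.mem_support_iff.2 ?_))
          simpa [Finsupp.single_apply, Ne.symm hma] using hm
      · rintro ⟨rfl, h⟩ m hm
        have hma : m ≠ a := by rintro rfl; simp at hm
        have : m ∈ p.support := by simpa [Finsupp.single_apply, Ne.symm hma] using hm
        exact (Finset.mem_insert.1 (h this)).resolve_left hma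
    rw [Finset.sum_eq_single (p a)]
    · by_cases hp : p.support ⊆ insert a s
      · rw [if_pos le_rfl, if_pos ((hsupp _ le_rfl).2 ⟨rfl, hp⟩), if_pos hp, Finset.prod_insert ha,
          mul_comm (y a ^ _)]
        congr 1
        refine Finset.prod_congr rfl fun m hm => ?_
        have hma : m ≠ a := by rintro rfl; exact ha hm
        simp [Ne.symm hma]
      · rw [if_pos le_rfl, if_neg fun h => hp ((hsupp _ le_rfl).1 h).2, if_neg hp, mul_zero]
    · intro k _ hk
      by_cases hk' : k ≤ p a
      · rw [if_pos hk', if_neg fun h => hk ((hsupp _ hk').1 h).1, mul_zero]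
      · rw [if_neg hk', mul_zero]
    · intro h
      rw [Nat.choose_eq_zero_of_lt (by simpa using h)]
      simp

lemma coeff_transl_monomial (y : ℕ+ → ℂ) (p l : ℕ+ →₀ ℕ) :
    MvPolynomial.coeff p (transl y (MvPolynomial.monomial l 1)) = translCoef y p l := by
  rw [transl, MvPolynomial.aeval_monomial, map_one, one_mul, Finsupp.prod, coeff_prod_X_add_C,
    translCoef]

lemma translCoef_eq_zero (y : ℕ+ → ℂ) {p l : ℕ+ →₀ ℕ} (h : ¬ p ≤ l) : translCoef y p l = 0 := by
  rw [translCoef]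
  split_ifs with hs
  · obtain ⟨m, hm⟩ := not_forall.1 h
    have hml : m ∈ l.support := hs (Finsupp.mem_support_iff.2 (by omega))
    exact Finset.prod_eq_zero hml (by rw [Nat.choose_eq_zero_of_lt (by omega)]; simp)
  · rfl

/-- The binomial coefficient `(p + l choose p)` divided by `(p + l)!` splits as `1 / (p! l!)`,
variable by variable. -/
lemma translCoef_add_mul_divPow (y e : ℕ+ → ℂ) (p l : ℕ+ →₀ ℕ) :
    translCoef y p (p + l) * divPow e (p + l) =
      divPow e p * divPow (fun m => y m * e m) l := by
  have hp : p.support ⊆ (p + l).support := fun m hm => by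
    simp only [Finsupp.mem_support_iff, Finsupp.coe_add, Pi.add_apply] at hm ⊢; omega
  have hl : l.support ⊆ (p + l).support := fun m hm => by
    simp only [Finsupp.mem_support_iff, Finsupp.coe_add, Pi.add_apply] at hm ⊢; omega
  rw [translCoef, if_pos hp, divPow_eq_prod e (p + l) le_rfl, divPow_eq_prod e p hp,
    divPow_eq_prod _ l hl, ← Finset.prod_mul_distrib, ← Finset.prod_mul_distrib]
  refine Finset.prod_congr rfl fun m _ => ?_
  have hc : ((p m + l m).choose (p m) : ℂ) * ((p m)! : ℂ) * ((l m)! : ℂ) = ((p m + l m)! : ℂ) := by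
    have := Nat.choose_mul_factorial_mul_factorial (Nat.le_add_right (p m) (l m))
    rw [Nat.add_sub_cancel_left] at this
    exact_mod_cast this
  have h1 : ((p m)! : ℂ) ≠ 0 := by exact_mod_cast Nat.factorial_ne_zero _
  have h2 : ((l m)! : ℂ) ≠ 0 := by exact_mod_cast Nat.factorial_ne_zero _
  have h3 : ((p m + l m)! : ℂ) ≠ 0 := by exact_mod_cast Nat.factorial_ne_zero _
  simp only [Finsupp.coe_add, Pi.add_apply, Nat.add_sub_cancel_left]
  field_simp
  rw [← hc, pow_add, mul_pow]; ring

/-- The basic commutation of annihilation with creation: translating `exp (∑ e m X m)` by `y`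
multiplies it by `exp (∑ y m e m)`. Only `l ≥ p` contributes, so the sum runs over `l - p`. -/
lemma hasSum_translCoef_mul_divPow {y e : ℕ+ → ℂ} (h : Summable fun m => ‖y m * e m‖)
    (p : ℕ+ →₀ ℕ) :
    HasSum (fun l => translCoef y p l * divPow e l)
      (Complex.exp (∑' m, y m * e m) * divPow e p) := by
  have hinj : Function.Injective fun l : ℕ+ →₀ ℕ => p + l := add_right_injective p
  rw [← hinj.hasSum_iff]
  · simp only [Function.comp_def, translCoef_add_mul_divPow]
    rw [mul_comm]
    exact (hasSum_divPow h).mul_left _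
  · intro l hl
    rw [translCoef_eq_zero, zero_mul]
    intro hle
    exact hl ⟨l - p, by simp [add_tsub_cancel_of_le hle]⟩

/-- A translation is multiplicative on monomials. -/
lemma translCoef_add (y : ℕ+ → ℂ) (p j l : ℕ+ →₀ ℕ) :
    translCoef y p (j + l) =
      ∑ x ∈ Finset.HasAntidiagonal.antidiagonal p, translCoef y x.1 j * translCoef y x.2 l := by
  simp only [← coeff_transl_monomial]
  rw [← MvPolynomial.coeff_mul, ← map_mul, MvPolynomial.monomial_mul, one_mul]

/-- Translations compose by adding their vectors; the sum may run over any finite set containing the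
monomials of the inner image. -/
lemma sum_translCoef_mul (y y' : ℕ+ → ℂ) (p v : ℕ+ →₀ ℕ) {s : Finset (ℕ+ →₀ ℕ)}
    (hs : (transl y' (MvPolynomial.monomial v 1)).support ⊆ s) :
    ∑ j ∈ s, translCoef y p j * translCoef y' j v = translCoef (y + y') p v := by
  have hcomp : transl y (transl y' (MvPolynomial.monomial v 1)) =
      transl (y + y') (MvPolynomial.monomial v 1) := by
    rw [← AlgHom.comp_apply]
    congr 1
    refine MvPolynomial.algHom_ext fun m => ?_
    simp [transl, add_assoc]
  rw [← coeff_transl_monomial (y + y'), ← hcomp]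
  conv_rhs => rw [(transl y' (MvPolynomial.monomial v 1)).as_sum]
  rw [map_sum, MvPolynomial.coeff_sum]
  have : ∀ j, MvPolynomial.coeff p (transl y (MvPolynomial.monomial j
      (MvPolynomial.coeff j (transl y' (MvPolynomial.monomial v 1))))) =
      translCoef y p j * translCoef y' j v := by
    intro j
    rw [coeff_transl_monomial, ← mul_one (translCoef y' j v), ← MvPolynomial.C_mul_monomial,
      ← MvPolynomial.algebraMap_eq, map_mul, AlgHom.commutes, MvPolynomial.algebraMap_eq,
      MvPolynomial.coeff_C_mul, coeff_transl_monomial]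
    ring
  simp only [this]
  refine (Finset.sum_subset hs fun j _ hj => ?_).symm
  rw [← coeff_transl_monomial y', MvPolynomial.notMem_support_iff.1 hj, mul_zero]

/-- Multiplicativity of the exponential series. Evaluating the translated monomial `(X + e')^p` at
`X = e` gives `(e + e')^p`, and expanding the translation first gives the sum. -/
lemma sum_divPow_mul_divPow (e e' : ℕ+ → ℂ) (p : ℕ+ →₀ ℕ) :
    ∑ x ∈ Finset.HasAntidiagonal.antidiagonal p, divPow e x.1 * divPow e' x.2 = divPow (e + e') p := by
  have hsplit : ∀ (x : ℕ+ → ℂ) (l : ℕ+ →₀ ℕ),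
      divPow x l = (l.prod fun m j => x m ^ j) * divPow (fun _ => 1) l := by
    intro x l
    simp only [divPow, Finsupp.prod, ← Finset.prod_mul_distrib]
    exact Finset.prod_congr rfl fun m _ => by ring
  have h1 : MvPolynomial.eval e (transl e' (MvPolynomial.monomial p 1)) =
      p.prod fun m j => (e + e') m ^ j := by
    rw [transl, MvPolynomial.aeval_monomial]
    simp [Finsupp.prod]
  rw [hsplit (e + e') p, ← h1, MvPolynomial.eval_eq, Finset.sum_mul]
  have h2 : ∀ x ∈ Finset.HasAntidiagonal.antidiagonal p, divPow e x.1 * divPow e' x.2 =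
      translCoef e' x.1 p * (∏ i ∈ x.1.support, e i ^ x.1 i) * divPow (fun _ => 1) p := by
    intro x hx
    have := translCoef_add_mul_divPow e' (fun _ => 1) x.1 x.2
    rw [Finset.HasAntidiagonal.mem_antidiagonal.1 hx] at this
    simp only [mul_one] at this
    rw [mul_right_comm, this, hsplit e x.1, Finsupp.prod]; ring
  have hinj : Set.InjOn Prod.fst
      (SetLike.coe (Finset.HasAntidiagonal.antidiagonal p)) := by
    intro x hx x' hx' h
    have h1 := Finset.HasAntidiagonal.mem_antidiagonal.1 hx
    have h2 := Finset.HasAntidiagonal.mem_antidiagonal.1 hx'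
    refine Prod.ext h (add_left_cancel (a := x.1) ?_)
    rw [h1, h, h2]
  rw [Finset.sum_congr rfl h2, ← Finset.sum_image (f := fun j => translCoef e' j p *
    (∏ i ∈ j.support, e i ^ j i) * divPow (fun _ => 1) p) hinj]
  simp only [coeff_transl_monomial]
  refine (Finset.sum_subset (fun j hj => ?_) fun j _ hj => ?_).symm
  · rw [MvPolynomial.mem_support_iff, coeff_transl_monomial] at hj
    have hle : j ≤ p := by
      by_contra h
      exact hj (translCoef_eq_zero _ h)
    exact Finset.mem_image.2 ⟨(j, p - j), Finset.HasAntidiagonal.mem_antidiagonal.2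
      (add_tsub_cancel_of_le hle), rfl⟩
  · rw [← coeff_transl_monomial, MvPolynomial.notMem_support_iff.1 hj]
    simp

/-- matrix coefficient of `exp (∑ e m X m) exp (∑ y m ∂_m)` between monomials -/
def fock {K : Type*} [Field K] (e y : ℕ+ → K) (w v : ℕ+ →₀ ℕ) : K :=
  ∑ x ∈ Finset.HasAntidiagonal.antidiagonal w, divPow e x.1 * translCoef y x.2 v

/-- `fock` is a coefficient of a product of power series, so this is associativity together with
multiplicativity of the exponential. -/
lemma sum_divPow_mul_fock (e e' y : ℕ+ → ℂ) (w v : ℕ+ →₀ ℕ) :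
    ∑ x ∈ Finset.HasAntidiagonal.antidiagonal w, divPow e x.1 * fock e' y x.2 v =
      fock (e + e') y w v := by
  have h : ∀ (e y : ℕ+ → ℂ) (w : ℕ+ →₀ ℕ), fock e y w v =
      MvPowerSeries.coeff w ((show MvPowerSeries ℕ+ ℂ from divPow e) *
        (show MvPowerSeries ℕ+ ℂ from fun l => translCoef y l v)) := fun e y w => by
    rw [MvPowerSeries.coeff_mul]; rfl
  have hmul : (show MvPowerSeries ℕ+ ℂ from divPow (e + e')) =
      (show MvPowerSeries ℕ+ ℂ from divPow e) * (show MvPowerSeries ℕ+ ℂ from divPow e') := by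
    ext l
    rw [MvPowerSeries.coeff_mul]
    exact (sum_divPow_mul_divPow e e' l).symm
  rw [h (e + e'), hmul, mul_assoc, MvPowerSeries.coeff_mul]
  exact Finset.sum_congr rfl fun x _ => by rw [h]; rfl

/-- the composition of two normally ordered exponentials -/
theorem hasSum_fock_mul_fock {e y e' y' : ℕ+ → ℂ} (h : Summable fun m => ‖y m * e' m‖)
    (w v : ℕ+ →₀ ℕ) :
    HasSum (fun n => fock e y w n * fock e' y' n v)
      (Complex.exp (∑' m, y m * e' m) * fock (e + e') (y + y') w v) := by
  set s := (transl y' (MvPolynomial.monomial v 1)).support with hs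
  -- The translated monomial of `v` has finitely many terms `j`. Only the creation part above each
  -- `j` is infinite, so the sum over `n` becomes finitely many sums over `n ≥ j`.
  have hfock : ∀ n, fock e' y' n v =
      ∑ j ∈ s, if j ≤ n then divPow e' (n - j) * translCoef y' j v else 0 := by
    intro n
    have hinj : Set.InjOn Prod.snd
        (SetLike.coe (Finset.HasAntidiagonal.antidiagonal n)) := by
      intro x hx x' hx' h
      have h1 := Finset.HasAntidiagonal.mem_antidiagonal.1 hx
      have h2 := Finset.HasAntidiagonal.mem_antidiagonal.1 hx'
      refine Prod.ext (add_right_cancel (b := x.2) ?_) h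
      rw [h1, h, h2]
    have h1 : ∀ x ∈ Finset.HasAntidiagonal.antidiagonal n,
        divPow e' x.1 * translCoef y' x.2 v = divPow e' (n - x.2) * translCoef y' x.2 v := by
      intro x hx
      rw [← Finset.HasAntidiagonal.mem_antidiagonal.1 hx, add_tsub_cancel_right]
    rw [fock, Finset.sum_congr rfl h1, ← Finset.sum_image (f := fun j =>
      divPow e' (n - j) * translCoef y' j v) hinj, ← Finset.sum_filter]
    refine (Finset.sum_subset (fun j hj => ?_) fun j hj hj' => ?_).symm
    · exact Finset.mem_image.2 ⟨(n - j, j), Finset.HasAntidiagonal.mem_antidiagonal.2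
        (tsub_add_cancel_of_le (Finset.mem_filter.1 hj).2), rfl⟩
    · obtain ⟨x, hx, rfl⟩ := Finset.mem_image.1 hj
      have hle : x.2 ≤ n := by
        rw [← Finset.HasAntidiagonal.mem_antidiagonal.1 hx]; exact le_add_self
      have hns : x.2 ∉ s := fun h => hj' (Finset.mem_filter.2 ⟨h, hle⟩)
      rw [← coeff_transl_monomial, MvPolynomial.notMem_support_iff.1 hns, mul_zero]
  -- With `n = j + l` the left translation splits over `j` and `l`. The `j` part stays finite and
  -- the `l` part is the commutation of annihilation with creation.
  have hone : ∀ p j : ℕ+ →₀ ℕ, HasSum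
      (fun n => translCoef y p n * if j ≤ n then divPow e' (n - j) * translCoef y' j v else 0)
      (∑ x ∈ Finset.HasAntidiagonal.antidiagonal p, translCoef y x.1 j *
        (Complex.exp (∑' m, y m * e' m) * divPow e' x.2) * translCoef y' j v) := by
    intro p j
    have hinj : Function.Injective fun l : ℕ+ →₀ ℕ => j + l := add_right_injective j
    rw [← hinj.hasSum_iff]
    · simp only [Function.comp_def, le_add_iff_nonneg_right, zero_le, if_true,
        add_tsub_cancel_left, translCoef_add, Finset.sum_mul]
      refine hasSum_sum fun x _ => ?_
      have := ((hasSum_translCoef_mul_divPow h x.2).mul_left (translCoef y x.1 j)).mul_right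
        (translCoef y' j v)
      have hf : (fun l => translCoef y x.1 j * translCoef y x.2 l *
          (divPow e' l * translCoef y' j v)) = fun l =>
          translCoef y x.1 j * (translCoef y x.2 l * divPow e' l) * translCoef y' j v := by
        funext l; ring
      rwa [hf]
    · intro n hn
      rw [if_neg, mul_zero]
      intro hle
      exact hn ⟨n - j, by simp [add_tsub_cancel_of_le hle]⟩
  have htwo : ∀ p : ℕ+ →₀ ℕ, HasSum (fun n => translCoef y p n * fock e' y' n v)
      (Complex.exp (∑' m, y m * e' m) * fock e' (y + y') p v) := by
    intro p
    have := hasSum_sum fun j (_ : j ∈ s) => hone p j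
    simp only [← Finset.mul_sum, ← hfock] at this
    have hval : ∑ j ∈ s, ∑ x ∈ Finset.HasAntidiagonal.antidiagonal p, translCoef y x.1 j *
        (Complex.exp (∑' m, y m * e' m) * divPow e' x.2) * translCoef y' j v =
        Complex.exp (∑' m, y m * e' m) * fock e' (y + y') p v := by
      rw [Finset.sum_comm, fock, Finset.mul_sum]
      refine Finset.sum_nbij' Prod.swap Prod.swap ?_ ?_ ?_ ?_ ?_
      · intro x hx
        rw [Finset.HasAntidiagonal.mem_antidiagonal] at hx ⊢
        rw [← hx, add_comm]; rfl
      · intro x hx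
        rw [Finset.HasAntidiagonal.mem_antidiagonal] at hx ⊢
        rw [← hx, add_comm]; rfl
      · intro x _; rfl
      · intro x _; rfl
      · intro x _
        simp only [Prod.fst_swap, Prod.snd_swap]
        -- Summing over `j` composes the two translations into the one by `y + y'`.
        rw [← sum_translCoef_mul y y' x.1 v hs.ge, Finset.mul_sum, Finset.mul_sum]
        exact Finset.sum_congr rfl fun j _ => by ring
    rwa [hval] at this
  have hthree := hasSum_sum fun x (_ : x ∈ Finset.HasAntidiagonal.antidiagonal w) =>
    (htwo x.2).mul_left (divPow e x.1)
  have hfun : (fun n => fock e y w n * fock e' y' n v) = fun n =>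
      ∑ x ∈ Finset.HasAntidiagonal.antidiagonal w,
        divPow e x.1 * (translCoef y x.2 n * fock e' y' n v) := by
    funext n
    rw [fock.eq_1 e y w n, Finset.sum_mul]
    exact Finset.sum_congr rfl fun x _ => by ring
  have hval : ∑ x ∈ Finset.HasAntidiagonal.antidiagonal w, divPow e x.1 *
      (Complex.exp (∑' m, y m * e' m) * fock e' (y + y') x.2 v) =
      Complex.exp (∑' m, y m * e' m) * fock (e + e') (y + y') w v := by
    rw [← sum_divPow_mul_fock, Finset.mul_sum]
    exact Finset.sum_congr rfl fun x _ => by ring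
  rwa [hfun, ← hval]

/-! Majorants and parameter dependence -/

lemma divPow_ofReal (x : ℕ+ → ℝ) (l : ℕ+ →₀ ℕ) :
    divPow (fun m => (x m : ℂ)) l = (divPow x l : ℝ) := by
  simp [divPow, Finsupp.prod]

lemma translCoef_ofReal (x : ℕ+ → ℝ) (p l : ℕ+ →₀ ℕ) :
    translCoef (fun m => (x m : ℂ)) p l = (translCoef x p l : ℝ) := by
  unfold translCoef
  split_ifs <;> simp

lemma fock_ofReal (e y : ℕ+ → ℝ) (w v : ℕ+ →₀ ℕ) :
    fock (fun m => (e m : ℂ)) (fun m => (y m : ℂ)) w v = (fock e y w v : ℝ) := by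
  simp [fock, divPow_ofReal, translCoef_ofReal]

lemma norm_divPow_le {x : ℕ+ → ℂ} {X : ℕ+ → ℝ} (h : ∀ m, ‖x m‖ ≤ X m) (l : ℕ+ →₀ ℕ) :
    ‖divPow x l‖ ≤ divPow X l := by
  rw [norm_divPow]
  exact Finset.prod_le_prod (fun m _ => by positivity) fun m _ => by
    dsimp only; gcongr; exact h m

lemma norm_translCoef_le {x : ℕ+ → ℂ} {X : ℕ+ → ℝ} (h : ∀ m, ‖x m‖ ≤ X m) (p l : ℕ+ →₀ ℕ) :
    ‖translCoef x p l‖ ≤ translCoef X p l := by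
  unfold translCoef
  split_ifs
  · rw [norm_prod]
    refine Finset.prod_le_prod (fun m _ => by positivity) fun m _ => ?_
    rw [norm_mul, norm_pow, Complex.norm_natCast]
    gcongr
    exact h m
  · simp

/-- A matrix coefficient is a polynomial in `e` and `y` with nonnegative coefficients, so the same
expression over `ℝ` in upper bounds of the data is a majorant. -/
lemma norm_fock_le {e y : ℕ+ → ℂ} {E Y : ℕ+ → ℝ} (he : ∀ m, ‖e m‖ ≤ E m)
    (hy : ∀ m, ‖y m‖ ≤ Y m) (w v : ℕ+ →₀ ℕ) : ‖fock e y w v‖ ≤ fock E Y w v := by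
  refine (norm_sum_le _ _).trans (Finset.sum_le_sum fun x _ => ?_)
  rw [norm_mul]
  exact mul_le_mul (norm_divPow_le he _) (norm_translCoef_le hy _ _) (norm_nonneg _)
    ((norm_nonneg _).trans (norm_divPow_le he _))

lemma hasSum_fock_mul_fock_real {E Y E' Y' : ℕ+ → ℝ} (h : Summable fun m => |Y m * E' m|)
    (w v : ℕ+ →₀ ℕ) :
    HasSum (fun n => fock E Y w n * fock E' Y' n v)
      (Real.exp (∑' m, Y m * E' m) * fock (E + E') (Y + Y') w v) := by
  have := hasSum_fock_mul_fock (e := fun m => (E m : ℂ)) (y := fun m => (Y m : ℂ))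
    (e' := fun m => (E' m : ℂ)) (y' := fun m => (Y' m : ℂ))
    (by simpa [← Complex.ofReal_mul, Complex.norm_real] using h) w v
  have h1 : ((fun m => (E m : ℂ)) + fun m => (E' m : ℂ)) = fun m => (((E + E') m : ℝ) : ℂ) := by
    ext; simp
  have h2 : ((fun m => (Y m : ℂ)) + fun m => (Y' m : ℂ)) = fun m => (((Y + Y') m : ℝ) : ℂ) := by
    ext; simp
  rw [h1, h2] at this
  simp only [fock_ofReal, ← Complex.ofReal_mul, ← Complex.ofReal_tsum, ← Complex.ofReal_exp]
    at this
  exact Complex.hasSum_ofReal.1 this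

lemma continuous_fock {T : Type*} [TopologicalSpace T] {e y : T → ℕ+ → ℂ}
    (he : ∀ m, Continuous fun t => e t m) (hy : ∀ m, Continuous fun t => y t m)
    (w v : ℕ+ →₀ ℕ) : Continuous fun t => fock (e t) (y t) w v := by
  unfold fock divPow translCoef Finsupp.prod
  refine continuous_finsetSum _ fun x _ => Continuous.mul ?_ ?_
  · exact continuous_finsetProd _ fun m _ => ((he m).pow _).div_const _
  · split_ifs
    · exact continuous_finsetProd _ fun m _ => continuous_const.mul ((hy m).pow _)
    · exact continuous_const

lemma differentiable_finsetProd {T ι : Type*} [NormedAddCommGroup T] [NormedSpace ℂ T]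
    {f : ι → T → ℂ} (hf : ∀ i, Differentiable ℂ (f i)) (s : Finset ι) :
    Differentiable ℂ fun t => ∏ i ∈ s, f i t := by
  classical
  induction s using Finset.induction_on with
  | empty => simp
  | insert a s ha ih => simp only [Finset.prod_insert ha]; exact (hf a).mul ih

lemma differentiable_fock {T : Type*} [NormedAddCommGroup T] [NormedSpace ℂ T]
    {e y : T → ℕ+ → ℂ} (he : ∀ m, Differentiable ℂ fun t => e t m)
    (hy : ∀ m, Differentiable ℂ fun t => y t m) (w v : ℕ+ →₀ ℕ) :
    Differentiable ℂ fun t => fock (e t) (y t) w v := by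
  unfold fock divPow translCoef Finsupp.prod
  refine Differentiable.fun_sum fun x _ => Differentiable.mul ?_ ?_
  · refine differentiable_finsetProd (fun m => ?_) _
    have := he m
    fun_prop
  · split_ifs
    · refine differentiable_finsetProd (fun m => ?_) _
      have := hy m
      fun_prop
    · exact differentiable_const _


/-! ### Vertex operators given by their data -/

lemma qnum_lt_qnum {q : ℝ} (hq0 : 0 < q) (hq1 : q < 1) {x y : ℝ} (h : x < y) :
    qnum q x < qnum q y := by
  have hd : q - q⁻¹ < 0 := by
    have : 1 < q⁻¹ := (one_lt_inv₀ hq0).2 hq1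
    linarith
  have h1 := Real.rpow_lt_rpow_of_exponent_gt hq0 hq1 h
  have h2 := Real.rpow_lt_rpow_of_exponent_gt hq0 hq1 (neg_lt_neg h)
  unfold qnum
  exact div_lt_div_of_neg_of_lt hd (by linarith)

lemma qnum_zero (q : ℝ) : qnum q 0 = 0 := by simp [qnum]

lemma qnum_pos {q : ℝ} (hq0 : 0 < q) (hq1 : q < 1) {x : ℝ} (h : 0 < x) : 0 < qnum q x := by
  simpa [qnum_zero] using qnum_lt_qnum hq0 hq1 h

/-- Positivity of the commutator keeps the majorants within the same class: bounding `c` by `C`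
bounds the annihilation data by `C m * heis q m`. -/
lemma heis_nonneg {q : ℝ} (hq0 : 0 < q) (hq1 : q < 1) (m : ℕ+) : 0 ≤ heis q m := by
  have hm : (0 : ℝ) < m := by exact_mod_cast m.pos
  have h1 : 0 < qnum q (2 * (m : ℝ)) - qnum q (m : ℝ) :=
    sub_pos.2 (qnum_lt_qnum hq0 hq1 (by linarith))
  have h2 := qnum_pos hq0 hq1 hm
  unfold heis
  positivity

/-- matrix coefficient of `:exp (∑ c(m) a_m):` between monomials -/
def vfock (q : ℝ) (c : ℤ → ℂ) : (ℕ+ →₀ ℕ) → (ℕ+ →₀ ℕ) → ℂ :=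
  fock (fun m => c (-(m : ℤ))) (fun m => c (m : ℤ) * (heis q m : ℂ))

lemma coeff_normExp (q : ℝ) (c : ℤ → ℂ) (w v : ℕ+ →₀ ℕ) :
    MvPowerSeries.coeff w (normExp q c (MvPolynomial.monomial v 1)) = vfock q c w v := by
  rw [normExp, MvPowerSeries.coeff_mul, vfock, fock]
  refine Finset.sum_congr rfl fun x _ => ?_
  rw [MvPolynomial.coeff_coe, ← coeff_transl_monomial]
  rfl

/-- the operator `:exp (∑ c(m) a_m): ⊗ Z`, where `Z` sends the zero-mode vector `x` to
`g x • (x + δ)` -/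
def vop (q : ℝ) (c : ℤ → ℂ) (δ : ℤ × ℤ) (g : ℤ × ℤ → ℂ) : Op := fun w v =>
  vfock q c w.1 v.1 * if w.2 = v.2 + δ then g v.2 else 0

lemma vertexOp_eq_vop (q : ℝ) (c : ℤ → ℂ) {Z : ZeroOp} {δ : ℤ × ℤ} {g : ℤ × ℤ → ℂ}
    (hZ : ∀ x, Z (Finsupp.single x 1) = Finsupp.single (x + δ) (g x)) :
    vertexOp q c Z = vop q c δ g := by
  funext w v
  rw [vertexOp, coeff_normExp, hZ, vop, Finsupp.single_apply]
  simp only [eq_comm]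

/-- the exponent of the scalar produced by normal ordering a product -/
def ctrSum (q : ℝ) (c d : ℤ → ℂ) : ℂ := ∑' m : ℕ+, c (m : ℤ) * (heis q m : ℂ) * d (-(m : ℤ))

/-- absolute convergence of `ctrSum` -/
def CtrSummable (q : ℝ) (c d : ℤ → ℂ) : Prop :=
  Summable fun m : ℕ+ => ‖c (m : ℤ) * (heis q m : ℂ) * d (-(m : ℤ))‖

lemma CtrSummable.add_left {q : ℝ} {c d e : ℤ → ℂ} (h1 : CtrSummable q c e)
    (h2 : CtrSummable q d e) : CtrSummable q (c + d) e := by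
  refine (Summable.add h1 h2).of_nonneg_of_le (fun _ => norm_nonneg _) fun m => ?_
  rw [Pi.add_apply, add_mul, add_mul]
  exact norm_add_le _ _

lemma ctrSum_add_left {q : ℝ} {c d e : ℤ → ℂ} (h1 : CtrSummable q c e)
    (h2 : CtrSummable q d e) : ctrSum q (c + d) e = ctrSum q c e + ctrSum q d e := by
  rw [ctrSum, ctrSum, ctrSum, ← h1.of_norm.tsum_add h2.of_norm]
  exact tsum_congr fun m => by rw [Pi.add_apply]; ring

lemma ctrSum_add_right {q : ℝ} {c d e : ℤ → ℂ} (h1 : CtrSummable q c d)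
    (h2 : CtrSummable q c e) : ctrSum q c (d + e) = ctrSum q c d + ctrSum q c e := by
  rw [ctrSum, ctrSum, ctrSum, ← h1.of_norm.tsum_add h2.of_norm]
  exact tsum_congr fun m => by rw [Pi.add_apply]; ring

lemma vfock_add (q : ℝ) (c d : ℤ → ℂ) :
    fock ((fun m : ℕ+ => c (-(m : ℤ))) + fun m : ℕ+ => d (-(m : ℤ)))
      ((fun m : ℕ+ => c (m : ℤ) * (heis q m : ℂ)) + fun m : ℕ+ => d (m : ℤ) * (heis q m : ℂ)) =
    vfock q (c + d) := by
  rw [vfock]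
  congr 1
  ext m
  simp only [Pi.add_apply]; ring

lemma hasSum_vfock {q : ℝ} {c d : ℤ → ℂ} (h : CtrSummable q c d) (w v : ℕ+ →₀ ℕ) :
    HasSum (fun n => vfock q c w n * vfock q d n v)
      (Complex.exp (ctrSum q c d) * vfock q (c + d) w v) := by
  rw [← vfock_add]
  exact hasSum_fock_mul_fock h w v

/-- Zero modes send basis vectors to multiples of basis vectors, so a sum over intermediate states
lives in a single charge sector and reduces to oscillator monomials. -/
lemma hasSum_state_iff {f : State → ℂ} {a : ℂ} (x : ℤ × ℤ) (hf : ∀ n : State, n.2 ≠ x → f n = 0) :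
    HasSum f a ↔ HasSum (fun l : ℕ+ →₀ ℕ => f (l, x)) a := by
  have hinj : Function.Injective fun l : ℕ+ →₀ ℕ => ((l, x) : State) :=
    fun l l' h => (Prod.ext_iff.1 h).1
  rw [← hinj.hasSum_iff]
  · rfl
  · intro n hn
    refine hf n fun h => hn ⟨n.1, ?_⟩
    rw [← h]

lemma vop_eq_zero {q : ℝ} {c : ℤ → ℂ} {δ : ℤ × ℤ} {g : ℤ × ℤ → ℂ} {w v : State}
    (h : w.2 ≠ v.2 + δ) : vop q c δ g w v = 0 := by
  rw [vop, if_neg h, mul_zero]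

lemma smul_vop (q : ℝ) (a : ℂ) (c : ℤ → ℂ) (δ : ℤ × ℤ) (g : ℤ × ℤ → ℂ) :
    a • vop q c δ g = vop q c δ fun x => a * g x := by
  funext w v
  simp only [Pi.smul_apply, vop, smul_eq_mul]
  split_ifs <;> ring

lemma hasSum_of_eq {ι : Type*} {f g : ι → ℂ} {a b : ℂ} (h : HasSum f a) (hf : ∀ n, f n = g n)
    (ha : a = b) : HasSum g b := by
  rwa [← funext hf, ← ha]

lemma hasSum_vop {q : ℝ} {c d : ℤ → ℂ} (h : CtrSummable q c d) (δ δ' : ℤ × ℤ)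
    (g g' : ℤ × ℤ → ℂ) (w v : State) :
    HasSum (fun n => vop q c δ g w n * vop q d δ' g' n v)
      (vop q (c + d) (δ' + δ)
        (fun x => Complex.exp (ctrSum q c d) * (g (x + δ') * g' x)) w v) := by
  rw [hasSum_state_iff (v.2 + δ') fun n hn => by rw [vop_eq_zero (w := n) hn, mul_zero]]
  have := (hasSum_vfock h w.1 v.1).mul_right
    ((if w.2 = v.2 + δ' + δ then g (v.2 + δ') else 0) * g' v.2)
  refine hasSum_of_eq this (fun l => ?_) ?_
  · simp only [vop, if_true]; ring
  · simp only [vop, ← add_assoc]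
    split_ifs <;> ring

/-- majorant of `vfock` -/
def vmaj (q : ℝ) (C : ℤ → ℝ) : (ℕ+ →₀ ℕ) → (ℕ+ →₀ ℕ) → ℝ :=
  fock (fun m => C (-(m : ℤ))) (fun m => C (m : ℤ) * heis q m)

lemma norm_vfock_le {q : ℝ} (hq0 : 0 < q) (hq1 : q < 1) {c : ℤ → ℂ} {C : ℤ → ℝ}
    (h : ∀ m, ‖c m‖ ≤ C m) (w v : ℕ+ →₀ ℕ) : ‖vfock q c w v‖ ≤ vmaj q C w v := by
  refine norm_fock_le (fun m => h _) (fun m => ?_) w v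
  rw [norm_mul, Complex.norm_real, Real.norm_of_nonneg (heis_nonneg hq0 hq1 m)]
  exact mul_le_mul_of_nonneg_right (h _) (heis_nonneg hq0 hq1 m)

lemma hasSum_vmaj {q : ℝ} (hq0 : 0 < q) (hq1 : q < 1) {C D : ℤ → ℝ} (hC : ∀ m, 0 ≤ C m)
    (hD : ∀ m, 0 ≤ D m) (h : Summable fun m : ℕ+ => C m * heis q m * D (-(m : ℤ)))
    (w v : ℕ+ →₀ ℕ) :
    HasSum (fun n => vmaj q C w n * vmaj q D n v)
      (Real.exp (∑' m : ℕ+, C m * heis q m * D (-(m : ℤ))) * vmaj q (C + D) w v) := by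
  have h' : Summable fun m : ℕ+ => |C m * heis q m * D (-(m : ℤ))| := by
    refine h.congr fun m => (abs_of_nonneg ?_).symm
    exact mul_nonneg (mul_nonneg (hC _) (heis_nonneg hq0 hq1 m)) (hD _)
  have := hasSum_fock_mul_fock_real (E := fun m => C (-(m : ℤ))) (E' := fun m => D (-(m : ℤ)))
    (Y := fun m => C m * heis q m) (Y' := fun m => D m * heis q m) h' w v
  have hadd : ((fun m : ℕ+ => C m * heis q m) + fun m : ℕ+ => D m * heis q m) =
      fun m : ℕ+ => (C + D) m * heis q m := by
    funext m; simp only [Pi.add_apply]; ring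
  rw [hadd] at this
  exact this

lemma vmaj_nonneg {q : ℝ} (hq0 : 0 < q) (hq1 : q < 1) {C : ℤ → ℝ} (hC : ∀ m, 0 ≤ C m)
    (w v : ℕ+ →₀ ℕ) : 0 ≤ vmaj q C w v :=
  (norm_nonneg _).trans (norm_vfock_le (c := 0) hq0 hq1 (by simpa using hC) w v)

lemma summable_norm_of_ctrSummable {q : ℝ} (hq0 : 0 < q) (hq1 : q < 1) {c d : ℤ → ℂ}
    (h : CtrSummable q c d) :
    Summable fun m : ℕ+ => ‖c m‖ * heis q m * ‖d (-(m : ℤ))‖ := by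
  refine Summable.congr h fun m => ?_
  rw [norm_mul, norm_mul, Complex.norm_real, Real.norm_of_nonneg (heis_nonneg hq0 hq1 m)]

/-- Summing over the state between the first two factors gives again a majorant, for `C + D`;
composing it with `E` settles the other sum. -/
lemma summable_vmaj₃ {q : ℝ} (hq0 : 0 < q) (hq1 : q < 1) {C D E : ℤ → ℝ} (hC : ∀ m, 0 ≤ C m)
    (hD : ∀ m, 0 ≤ D m) (hE : ∀ m, 0 ≤ E m)
    (hCD : Summable fun m : ℕ+ => C m * heis q m * D (-(m : ℤ)))
    (hCE : Summable fun m : ℕ+ => C m * heis q m * E (-(m : ℤ)))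
    (hDE : Summable fun m : ℕ+ => D m * heis q m * E (-(m : ℤ))) (w v : ℕ+ →₀ ℕ) :
    Summable fun n : (ℕ+ →₀ ℕ) × (ℕ+ →₀ ℕ) =>
      vmaj q C w n.2 * vmaj q D n.2 n.1 * vmaj q E n.1 v := by
  have h1 : ∀ l : ℕ+ →₀ ℕ, HasSum (fun n => vmaj q C w n * vmaj q D n l * vmaj q E l v)
      (Real.exp (∑' m : ℕ+, C m * heis q m * D (-(m : ℤ))) * vmaj q (C + D) w l *
        vmaj q E l v) := fun l => (hasSum_vmaj hq0 hq1 hC hD hCD w l).mul_right _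
  have hCDE : Summable fun m : ℕ+ => (C + D) m * heis q m * E (-(m : ℤ)) := by
    refine (hCE.add hDE).congr fun m => ?_
    simp only [Pi.add_apply]; ring
  have h2 := hasSum_vmaj hq0 hq1 (C := C + D) (fun m => add_nonneg (hC m) (hD m)) hE hCDE w v
  rw [summable_prod_of_nonneg]
  · refine ⟨fun l => (h1 l).summable, ?_⟩
    refine (h2.summable.mul_left
      (Real.exp (∑' m : ℕ+, C m * heis q m * D (-(m : ℤ))))).congr fun l => ?_
    rw [(h1 l).tsum_eq]; ring
  · intro n
    exact mul_nonneg (mul_nonneg (vmaj_nonneg hq0 hq1 hC _ _)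
      (vmaj_nonneg hq0 hq1 hD _ _)) (vmaj_nonneg hq0 hq1 hE _ _)

/-- Absolute convergence from the majorants justifies summing in two stages: merge `c` with `d`,
then the result with `e`. The three pairwise contractions add up in the exponent. -/
lemma hasSum_vfock₃ {q : ℝ} (hq0 : 0 < q) (hq1 : q < 1) {c d e : ℤ → ℂ} (hcd : CtrSummable q c d)
    (hce : CtrSummable q c e) (hde : CtrSummable q d e) (w v : ℕ+ →₀ ℕ) :
    HasSum (fun n : (ℕ+ →₀ ℕ) × (ℕ+ →₀ ℕ) =>
        vfock q c w n.1 * vfock q d n.1 n.2 * vfock q e n.2 v)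
      (Complex.exp (ctrSum q c d + ctrSum q c e + ctrSum q d e) * vfock q (c + d + e) w v) := by
  -- The two indices are swapped here so that fiberwise summation treats the state between `c` and
  -- `d` first.
  have hs : Summable fun n : (ℕ+ →₀ ℕ) × (ℕ+ →₀ ℕ) =>
      vfock q c w n.2 * vfock q d n.2 n.1 * vfock q e n.1 v := by
    refine (summable_vmaj₃ hq0 hq1 (C := fun m => ‖c m‖) (D := fun m => ‖d m‖)
      (E := fun m => ‖e m‖) (fun _ => norm_nonneg _) (fun _ => norm_nonneg _)
      (fun _ => norm_nonneg _) (summable_norm_of_ctrSummable hq0 hq1 hcd)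
      (summable_norm_of_ctrSummable hq0 hq1 hce)
      (summable_norm_of_ctrSummable hq0 hq1 hde) w v).of_norm_bounded fun n => ?_
    rw [norm_mul, norm_mul]
    have h1 := norm_vfock_le hq0 hq1 (c := c) (fun _ => le_rfl) w n.2
    have h2 := norm_vfock_le hq0 hq1 (c := d) (fun _ => le_rfl) n.2 n.1
    have h3 := norm_vfock_le hq0 hq1 (c := e) (fun _ => le_rfl) n.1 v
    exact mul_le_mul (mul_le_mul h1 h2 (norm_nonneg _) ((norm_nonneg _).trans h1)) h3
      (norm_nonneg _) (mul_nonneg ((norm_nonneg _).trans h1) ((norm_nonneg _).trans h2))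
  have h1 : ∀ l : ℕ+ →₀ ℕ, HasSum (fun n => vfock q c w n * vfock q d n l * vfock q e l v)
      (Complex.exp (ctrSum q c d) * vfock q (c + d) w l * vfock q e l v) := fun l =>
    (hasSum_vfock hcd w l).mul_right _
  have h2 := (hasSum_vfock (hce.add_left hde) w v).mul_left (Complex.exp (ctrSum q c d))
  have h3 := hs.hasSum.prod_fiberwise h1
  have h4 : (∑' n : (ℕ+ →₀ ℕ) × (ℕ+ →₀ ℕ),
      vfock q c w n.2 * vfock q d n.2 n.1 * vfock q e n.1 v) =
      Complex.exp (ctrSum q c d + ctrSum q c e + ctrSum q d e) * vfock q (c + d + e) w v := by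
    rw [add_assoc, Complex.exp_add, mul_assoc, ← ctrSum_add_left hce hde]
    exact h3.unique (hasSum_of_eq h2 (fun l => by ring) rfl)
  rw [← h4]
  have h5 := (Equiv.prodComm (ℕ+ →₀ ℕ) (ℕ+ →₀ ℕ)).hasSum_iff.2 hs.hasSum
  exact hasSum_of_eq h5 (fun n => rfl) rfl

lemma hasSum_vop₃ {q : ℝ} (hq0 : 0 < q) (hq1 : q < 1) {c d e : ℤ → ℂ} (hcd : CtrSummable q c d)
    (hce : CtrSummable q c e) (hde : CtrSummable q d e) (δ δ' δ'' : ℤ × ℤ)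
    (g g' g'' : ℤ × ℤ → ℂ) (w v : State) :
    HasSum (fun n : State × State =>
        vop q c δ g w n.1 * vop q d δ' g' n.1 n.2 * vop q e δ'' g'' n.2 v)
      (vop q (c + d + e) (δ'' + δ' + δ) (fun x => Complex.exp (ctrSum q c d + ctrSum q c e +
        ctrSum q d e) * (g (x + δ'' + δ') * g' (x + δ'') * g'' x)) w v) := by
  have hinj : Function.Injective fun l : (ℕ+ →₀ ℕ) × (ℕ+ →₀ ℕ) =>
      (((l.1, v.2 + δ'' + δ'), (l.2, v.2 + δ'')) : State × State) := by
    intro l l' h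
    simp only [Prod.mk.injEq, and_true] at h
    exact Prod.ext h.1 h.2
  rw [← hinj.hasSum_iff]
  · have := (hasSum_vfock₃ hq0 hq1 hcd hce hde w.1 v.1).mul_right
      ((if w.2 = v.2 + δ'' + δ' + δ then g (v.2 + δ'' + δ') else 0) * g' (v.2 + δ'') * g'' v.2)
    refine hasSum_of_eq this (fun l => ?_) ?_
    · simp only [vop, if_true, Function.comp_apply]; ring
    · simp only [vop, ← add_assoc]
      split_ifs <;> ring
  · intro n hn
    by_cases h2 : n.2.2 = v.2 + δ''
    · by_cases h1 : n.1.2 = v.2 + δ'' + δ'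
      · refine absurd ⟨(n.1.1, n.2.1), ?_⟩ hn
        rw [← h1, ← h2]
      · rw [vop_eq_zero (w := n.1) (v := n.2) (by rwa [h2]), mul_zero, zero_mul]
    · rw [vop_eq_zero (w := n.2) h2, mul_zero]

/-! ### Sums and contour integrals -/

/-- Dominated convergence twice, with one summable numerical bound on the whole square. -/
lemma hasSum_integral_integral {ι : Type*} [Countable ι] {f : ι → ℝ → ℝ → ℂ} {S : ℝ → ℝ → ℂ}
    {b : ι → ℝ} (hf : ∀ n, Continuous fun x : ℝ × ℝ => f n x.1 x.2)
    (hb : ∀ n, ∀ s ∈ Set.Icc (0 : ℝ) 1, ∀ t ∈ Set.Icc (0 : ℝ) 1, ‖f n s t‖ ≤ b n)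
    (hsum : Summable b)
    (hS : ∀ s ∈ Set.Icc (0 : ℝ) 1, ∀ t ∈ Set.Icc (0 : ℝ) 1, HasSum (fun n => f n s t) (S s t)) :
    HasSum (fun n => ∫ s in (0 : ℝ)..1, ∫ t in (0 : ℝ)..1, f n s t)
      (∫ s in (0 : ℝ)..1, ∫ t in (0 : ℝ)..1, S s t) := by
  have hI : ∀ {t : ℝ}, t ∈ Set.uIoc (0 : ℝ) 1 → t ∈ Set.Icc (0 : ℝ) 1 := fun {t} ht => by
    rw [Set.uIoc_of_le zero_le_one] at ht; exact ⟨ht.1.le, ht.2⟩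
  have hin : ∀ s ∈ Set.Icc (0 : ℝ) 1, HasSum (fun n => ∫ t in (0 : ℝ)..1, f n s t)
      (∫ t in (0 : ℝ)..1, S s t) := by
    intro s hs
    refine intervalIntegral.hasSum_integral_of_dominated_convergence (fun n _ => b n) ?_ ?_ ?_ ?_ ?_
    · intro n
      exact ((hf n).comp (by fun_prop : Continuous fun t : ℝ => (s, t))).aestronglyMeasurable
    · exact fun n => Filter.Eventually.of_forall fun t ht => hb n s hs t (hI ht)
    · exact Filter.Eventually.of_forall fun t _ => hsum
    · exact intervalIntegrable_const
    · exact Filter.Eventually.of_forall fun t ht => hS s hs t (hI ht)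
  refine intervalIntegral.hasSum_integral_of_dominated_convergence (fun n _ => b n) ?_ ?_ ?_ ?_ ?_
  · intro n
    exact (intervalIntegral.continuous_parametric_intervalIntegral_of_continuous'
      (f := f n) (hf n) 0 1).aestronglyMeasurable
  · refine fun n => Filter.Eventually.of_forall fun s hs => ?_
    have := intervalIntegral.norm_integral_le_of_norm_le_const (a := 0) (b := 1) (f := f n s)
      (C := b n) fun t ht => hb n s (hI hs) t (hI ht)
    simpa using this
  · exact Filter.Eventually.of_forall fun t _ => hsum
  · exact intervalIntegrable_const
  · exact Filter.Eventually.of_forall fun s hs => hin s (hI hs)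

lemma continuous_vfock {T : Type*} [TopologicalSpace T] {q : ℝ} {c : T → ℤ → ℂ}
    (hc : ∀ m, Continuous fun t => c t m) (w v : ℕ+ →₀ ℕ) :
    Continuous fun t => vfock q (c t) w v :=
  continuous_fock (fun _ => hc _) (fun _ => (hc _).mul continuous_const) w v

lemma continuous_vop {T : Type*} [TopologicalSpace T] {q : ℝ} {c : T → ℤ → ℂ}
    {g : T → ℤ × ℤ → ℂ} (δ : ℤ × ℤ) (hc : ∀ m, Continuous fun t => c t m)
    (hg : ∀ x, Continuous fun t => g t x) (w v : State) :
    Continuous fun t => vop q (c t) δ (g t) w v := by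
  unfold vop
  refine Continuous.mul (continuous_vfock hc _ _) ?_
  split_ifs
  · exact hg _
  · exact continuous_const

lemma exists_bound_unit_square {f : ℝ × ℝ → ℂ} (hf : Continuous f) :
    ∃ B, 0 ≤ B ∧ ∀ s ∈ Set.Icc (0 : ℝ) 1, ∀ t ∈ Set.Icc (0 : ℝ) 1, ‖f (s, t)‖ ≤ B := by
  obtain ⟨B, hB⟩ := ((isCompact_Icc (a := (0 : ℝ)) (b := 1)).prod
    (isCompact_Icc (a := (0 : ℝ)) (b := 1))).exists_bound_of_continuousOn hf.continuousOn
  exact ⟨B, (norm_nonneg _).trans (hB (0, 0) (by simp)), fun s hs t ht => hB (s, t) ⟨hs, ht⟩⟩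

lemma norm_vop_le {q : ℝ} (hq0 : 0 < q) (hq1 : q < 1) {c : ℤ → ℂ} {C : ℤ → ℝ}
    (h : ∀ m, ‖c m‖ ≤ C m) (δ : ℤ × ℤ) {g : ℤ × ℤ → ℂ} (w v : State) {B : ℝ} (hB : ‖g v.2‖ ≤ B) :
    ‖vop q c δ g w v‖ ≤ vmaj q C w.1 v.1 * B := by
  have h1 := norm_vfock_le hq0 hq1 h w.1 v.1
  rw [vop, norm_mul]
  refine mul_le_mul h1 ?_ (norm_nonneg _) ((norm_nonneg _).trans h1)
  split_ifs
  · exact hB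
  · rw [norm_zero]; exact (norm_nonneg _).trans hB

/-- A bound `C` for the oscillator coefficients, uniform along the contour, makes products of
majorants a summable dominating sequence for the sum over states. -/
lemma hasSum_integral_vop_mul {q : ℝ} (hq0 : 0 < q) (hq1 : q < 1) {c : ℝ → ℝ → ℤ → ℂ}
    {d : ℤ → ℂ} {g : ℝ → ℝ → ℤ × ℤ → ℂ} (ψ : ℤ × ℤ → ℂ) (δ δ' : ℤ × ℤ) {C : ℤ → ℝ}
    (hc : ∀ m, Continuous fun x : ℝ × ℝ => c x.1 x.2 m)
    (hg : ∀ z, Continuous fun x : ℝ × ℝ => g x.1 x.2 z)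
    (hC : ∀ s ∈ Set.Icc (0 : ℝ) 1, ∀ t ∈ Set.Icc (0 : ℝ) 1, ∀ m, ‖c s t m‖ ≤ C m)
    (hsum : Summable fun m : ℕ+ => C m * heis q m * ‖d (-(m : ℤ))‖) (w v : State) :
    HasSum (fun n => (∫ s in (0 : ℝ)..1, ∫ t in (0 : ℝ)..1, vop q (c s t) δ (g s t) w n) *
        vop q d δ' ψ n v)
      (∫ s in (0 : ℝ)..1, ∫ t in (0 : ℝ)..1, vop q (c s t + d) (δ' + δ)
        (fun x => Complex.exp (ctrSum q (c s t) d) * (g s t (x + δ') * ψ x)) w v) := by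
  have hC0 : ∀ m, 0 ≤ C m := fun m =>
    (norm_nonneg _).trans (hC 0 (by simp) 0 (by simp) m)
  obtain ⟨B, hB0, hB⟩ := exists_bound_unit_square (hg (v.2 + δ'))
  rw [hasSum_state_iff (v.2 + δ') fun n hn => by rw [vop_eq_zero (w := n) hn, mul_zero]]
  simp only [← intervalIntegral.integral_mul_const]
  refine hasSum_integral_integral (b := fun l => vmaj q C w.1 l * B *
    (vmaj q (fun m => ‖d m‖) l v.1 * ‖ψ v.2‖)) ?_ ?_ ?_ ?_
  · intro l
    exact (continuous_vop δ hc hg w _).mul continuous_const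
  · intro l s hs t ht
    rw [norm_mul]
    refine mul_le_mul (norm_vop_le hq0 hq1 (hC s hs t ht) δ _ _ (hB s hs t ht))
      (norm_vop_le hq0 hq1 (fun _ => le_rfl) δ' _ _ le_rfl) (norm_nonneg _) ?_
    exact mul_nonneg (vmaj_nonneg hq0 hq1 hC0 _ _) hB0
  · have := (hasSum_vmaj hq0 hq1 hC0 (D := fun m => ‖d m‖) (fun _ => norm_nonneg _)
      hsum w.1 v.1).summable.mul_right (B * ‖ψ v.2‖)
    exact this.congr fun l => by ring
  · intro s hs t ht
    have hcd : CtrSummable q (c s t) d := by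
      refine hsum.of_nonneg_of_le (fun _ => norm_nonneg _) fun m => ?_
      rw [norm_mul, norm_mul, Complex.norm_real, Real.norm_of_nonneg (heis_nonneg hq0 hq1 m)]
      have := hC s hs t ht m
      have := heis_nonneg hq0 hq1 m
      gcongr
    exact (hasSum_state_iff (v.2 + δ') fun n hn => by
      rw [vop_eq_zero (w := n) hn, mul_zero]).1 (hasSum_vop hcd δ δ' (g s t) ψ w v)

lemma hasSum_mul_integral_vop {q : ℝ} (hq0 : 0 < q) (hq1 : q < 1) {c : ℝ → ℝ → ℤ → ℂ}
    {d : ℤ → ℂ} {g : ℝ → ℝ → ℤ × ℤ → ℂ} (ψ : ℤ × ℤ → ℂ) (δ δ' : ℤ × ℤ) {C : ℤ → ℝ}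
    (hc : ∀ m, Continuous fun x : ℝ × ℝ => c x.1 x.2 m)
    (hg : ∀ z, Continuous fun x : ℝ × ℝ => g x.1 x.2 z)
    (hC : ∀ s ∈ Set.Icc (0 : ℝ) 1, ∀ t ∈ Set.Icc (0 : ℝ) 1, ∀ m, ‖c s t m‖ ≤ C m)
    (hsum : Summable fun m : ℕ+ => ‖d m‖ * heis q m * C (-(m : ℤ))) (w v : State) :
    HasSum (fun n => vop q d δ' ψ w n *
        ∫ s in (0 : ℝ)..1, ∫ t in (0 : ℝ)..1, vop q (c s t) δ (g s t) n v)
      (∫ s in (0 : ℝ)..1, ∫ t in (0 : ℝ)..1, vop q (d + c s t) (δ + δ')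
        (fun x => Complex.exp (ctrSum q d (c s t)) * (ψ (x + δ) * g s t x)) w v) := by
  have hC0 : ∀ m, 0 ≤ C m := fun m =>
    (norm_nonneg _).trans (hC 0 (by simp) 0 (by simp) m)
  obtain ⟨B, hB0, hB⟩ := exists_bound_unit_square (hg v.2)
  have hz : ∀ n : State, n.2 ≠ v.2 + δ → (vop q d δ' ψ w n *
      ∫ s in (0 : ℝ)..1, ∫ t in (0 : ℝ)..1, vop q (c s t) δ (g s t) n v) = 0 := fun n hn => by
    simp [vop_eq_zero (w := n) hn]
  rw [hasSum_state_iff (v.2 + δ) hz]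
  simp only [← intervalIntegral.integral_const_mul]
  refine hasSum_integral_integral (b := fun l => vmaj q (fun m => ‖d m‖) w.1 l *
    ‖ψ (v.2 + δ)‖ * (vmaj q C l v.1 * B)) ?_ ?_ ?_ ?_
  · intro l
    exact continuous_const.mul (continuous_vop δ hc hg _ v)
  · intro l s hs t ht
    rw [norm_mul]
    refine mul_le_mul (norm_vop_le hq0 hq1 (fun _ => le_rfl) δ' _ _ le_rfl)
      (norm_vop_le hq0 hq1 (hC s hs t ht) δ _ _ (hB s hs t ht)) (norm_nonneg _) ?_
    exact mul_nonneg (vmaj_nonneg hq0 hq1 (fun _ => norm_nonneg _) _ _) (norm_nonneg _)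
  · have := (hasSum_vmaj hq0 hq1 (C := fun m => ‖d m‖) (fun _ => norm_nonneg _) hC0
      hsum w.1 v.1).summable.mul_right (‖ψ (v.2 + δ)‖ * B)
    exact this.congr fun l => by ring
  · intro s hs t ht
    have hcd : CtrSummable q d (c s t) := by
      refine hsum.of_nonneg_of_le (fun _ => norm_nonneg _) fun m => ?_
      rw [norm_mul, norm_mul, Complex.norm_real, Real.norm_of_nonneg (heis_nonneg hq0 hq1 m)]
      have := hC s hs t ht (-(m : ℤ))
      have := heis_nonneg hq0 hq1 m
      gcongr
    exact (hasSum_state_iff (v.2 + δ) fun n hn => by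
      rw [vop_eq_zero (w := n) hn, mul_zero]).1 (hasSum_vop hcd δ' δ ψ (g s t) w v)


/-! ### Powers of the spectral variable -/

lemma ofReal_ne_zero_of_pos {q : ℝ} (hq0 : 0 < q) : (q : ℂ) ≠ 0 := by
  exact_mod_cast hq0.ne'

lemma zpw_add {q : ℝ} (hq0 : 0 < q) (u a b : ℂ) : zpw q u (a + b) = zpw q u a * zpw q u b := by
  rw [zpw, mul_add, Complex.cpow_add _ _ (ofReal_ne_zero_of_pos hq0)]; rfl

lemma zpw_add_arg {q : ℝ} (hq0 : 0 < q) (u v a : ℂ) :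
    zpw q (u + v) a = zpw q u a * zpw q v a := by
  rw [zpw, mul_add, add_mul, Complex.cpow_add _ _ (ofReal_ne_zero_of_pos hq0)]; rfl

lemma zpw_neg_arg (q : ℝ) (u a : ℂ) : zpw q (-u) a = zpw q u (-a) := by
  simp [zpw]

lemma zpw_intCast (q : ℝ) (u : ℂ) (n : ℤ) : zpw q u (n : ℂ) = zOf q u ^ n := by
  rw [zpw, zOf, Complex.cpow_mul_int]

lemma zOf_ne_zero {q : ℝ} (hq0 : 0 < q) (u : ℂ) : zOf q u ≠ 0 := by
  rw [zOf, Ne, Complex.cpow_eq_zero_iff]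
  exact fun h => ofReal_ne_zero_of_pos hq0 h.1

lemma norm_zOf_pos {q : ℝ} (hq0 : 0 < q) (u : ℂ) : 0 < ‖zOf q u‖ :=
  norm_pos_iff.2 (zOf_ne_zero hq0 u)

lemma zOf_add {q : ℝ} (hq0 : 0 < q) (u v : ℂ) : zOf q (u + v) = zOf q u * zOf q v := by
  rw [zOf, mul_add, Complex.cpow_add _ _ (ofReal_ne_zero_of_pos hq0)]; rfl

lemma zOf_sub {q : ℝ} (hq0 : 0 < q) (u v : ℂ) : zOf q (u - v) = zOf q u / zOf q v := by
  rw [zOf, mul_sub, Complex.cpow_sub _ _ (ofReal_ne_zero_of_pos hq0)]; rfl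

lemma differentiable_const_cpow {q : ℝ} (hq0 : 0 < q) :
    Differentiable ℂ fun u : ℂ => (q : ℂ) ^ u := by
  simp only [Complex.cpow_def_of_ne_zero (ofReal_ne_zero_of_pos hq0)]
  fun_prop

lemma differentiable_zpw {q : ℝ} (hq0 : 0 < q) (a : ℂ) :
    Differentiable ℂ fun u => zpw q u a :=
  (differentiable_const_cpow hq0).comp (by fun_prop : Differentiable ℂ fun u : ℂ => 2 * u * a)

lemma differentiable_zOf {q : ℝ} (hq0 : 0 < q) : Differentiable ℂ fun u => zOf q u :=
  (differentiable_const_cpow hq0).comp (by fun_prop : Differentiable ℂ fun u : ℂ => 2 * u)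

lemma continuous_zOf {q : ℝ} (hq0 : 0 < q) : Continuous fun u => zOf q u :=
  (differentiable_zOf hq0).continuous

/-! ### One-parameter families of vertex operators -/

/-- the family `:exp (∑ γ(m) z^{-m} a_m): ⊗ (x ↦ κ(x) z^{e(x)} (x + δ))` -/
structure Fam where
  /-- oscillator coefficients -/
  γ : ℤ → ℂ
  /-- shift of the zero modes -/
  δ : ℤ × ℤ
  /-- constant factor -/
  κ : ℤ × ℤ → ℂ
  /-- exponent of `z` -/
  e : ℤ × ℤ → ℂ

namespace Fam

/-- the oscillator coefficients at `z` -/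
def coef (q : ℝ) (X : Fam) (u : ℂ) : ℤ → ℂ := fun m => X.γ m * zpw q u (-(m : ℂ))

/-- the zero-mode factor at `z` -/
def zm (q : ℝ) (X : Fam) (u : ℂ) : ℤ × ℤ → ℂ := fun x => X.κ x * zpw q u (X.e x)

/-- the operator at `z` -/
def op (q : ℝ) (X : Fam) (u : ℂ) : Op := vop q (X.coef q u) X.δ (X.zm q u)

/-- the family `u ↦ X(u + a)` -/
def shift (q : ℝ) (X : Fam) (a : ℂ) : Fam where
  γ := fun m => X.γ m * zpw q a (-(m : ℂ))
  δ := X.δ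
  κ := fun x => X.κ x * zpw q a (X.e x)
  e := X.e

lemma op_shift {q : ℝ} (hq0 : 0 < q) (X : Fam) (a u : ℂ) :
    (X.shift q a).op q u = X.op q (u + a) := by
  unfold op
  congr 1
  · funext m
    simp only [coef, shift, zpw_add_arg hq0]; ring
  · funext x
    simp only [zm, shift, zpw_add_arg hq0]; ring

/-- for `‖x‖ < ρ` the normal ordering of `X(u₁) Y(u₂)` converges at `x = z₂/z₁`, with factor
`G x` -/
structure HasCtr (q : ℝ) (X Y : Fam) (ρ : ℝ) (G : ℂ → ℂ) : Prop where
  pos : 0 < ρ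
  summable : ∀ x : ℂ, ‖x‖ < ρ →
    Summable fun m : ℕ+ => ‖X.γ m * (heis q m : ℂ) * Y.γ (-(m : ℤ)) * x ^ (m : ℕ)‖
  exp_eq : ∀ x : ℂ, ‖x‖ < ρ →
    Complex.exp (∑' m : ℕ+, X.γ m * (heis q m : ℂ) * Y.γ (-(m : ℤ)) * x ^ (m : ℕ)) = G x

/-- Mode `m` of the first factor pairs only with mode `-m` of the second, giving `z₁^{-m} z₂^m`;
hence contractions are functions of `z₂/z₁`. -/
lemma coef_mul_coef {q : ℝ} (hq0 : 0 < q) (X Y : Fam) (u₁ u₂ : ℂ) (m : ℕ+) :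
    X.coef q u₁ m * (heis q m : ℂ) * Y.coef q u₂ (-(m : ℤ)) =
      X.γ m * (heis q m : ℂ) * Y.γ (-(m : ℤ)) * zOf q (u₂ - u₁) ^ (m : ℕ) := by
  have h : zpw q u₁ (-((m : ℤ) : ℂ)) * zpw q u₂ (-((-(m : ℤ) : ℤ) : ℂ)) =
      zOf q (u₂ - u₁) ^ (m : ℕ) := by
    rw [← zpow_natCast (zOf q (u₂ - u₁)), ← zpw_intCast, sub_eq_add_neg, zpw_add_arg hq0,
      zpw_neg_arg, mul_comm]
    simp
  rw [← h]
  simp only [coef]; ring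

lemma HasCtr.ctrSummable {q : ℝ} (hq0 : 0 < q) {X Y : Fam} {ρ : ℝ} {G : ℂ → ℂ}
    (h : HasCtr q X Y ρ G) {u₁ u₂ : ℂ} (hu : ‖zOf q (u₂ - u₁)‖ < ρ) :
    CtrSummable q (X.coef q u₁) (Y.coef q u₂) := by
  refine (h.summable _ hu).congr fun m => ?_
  rw [coef_mul_coef hq0]

lemma HasCtr.exp_ctrSum {q : ℝ} (hq0 : 0 < q) {X Y : Fam} {ρ : ℝ} {G : ℂ → ℂ}
    (h : HasCtr q X Y ρ G) {u₁ u₂ : ℂ} (hu : ‖zOf q (u₂ - u₁)‖ < ρ) :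
    Complex.exp (ctrSum q (X.coef q u₁) (Y.coef q u₂)) = G (zOf q (u₂ - u₁)) := by
  rw [← h.exp_eq _ hu, ctrSum]
  simp only [coef_mul_coef hq0]

end Fam


namespace Fam

/-! ### Normally ordered products and exchange relations -/

/-- `g :X(u₁) Y(u₂):` -/
def nop₂ (q : ℝ) (X Y : Fam) (g : ℂ) (u₁ u₂ : ℂ) : Op :=
  vop q (X.coef q u₁ + Y.coef q u₂) (Y.δ + X.δ)
    fun x => g * (X.zm q u₁ (x + Y.δ) * Y.zm q u₂ x)

/-- `g :X(u₁) Y(u₂) Z(u₃):` -/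
def nop₃ (q : ℝ) (X Y Z : Fam) (g : ℂ) (u₁ u₂ u₃ : ℂ) : Op :=
  vop q (X.coef q u₁ + Y.coef q u₂ + Z.coef q u₃) (Z.δ + Y.δ + X.δ)
    fun x => g * (X.zm q u₁ (x + Z.δ + Y.δ) * Y.zm q u₂ (x + Z.δ) * Z.zm q u₃ x)

/-- the continuation of `X(u₁) Y(u₂)` with contraction `G` -/
def prod₂ (q : ℝ) (X Y : Fam) (G : ℂ → ℂ) (w v : State) (u₁ u₂ : ℂ) : ℂ :=
  nop₂ q X Y (G (zOf q (u₂ - u₁))) u₁ u₂ w v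

/-- the continuation of `X(u₁) Y(u₂) Z(u₃)` with contractions `G`, `G'`, `G''` of the pairs
`XY`, `XZ`, `YZ` -/
def prod₃ (q : ℝ) (X Y Z : Fam) (G G' G'' : ℂ → ℂ) (w v : State) (u₁ u₂ u₃ : ℂ) : ℂ :=
  nop₃ q X Y Z (G (zOf q (u₂ - u₁)) * G' (zOf q (u₃ - u₁)) * G'' (zOf q (u₃ - u₂))) u₁ u₂ u₃ w v

lemma nop₂_eq_mul (q : ℝ) (X Y : Fam) (g u₁ u₂ : ℂ) (w v : State) :
    nop₂ q X Y g u₁ u₂ w v = g * nop₂ q X Y 1 u₁ u₂ w v := by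
  simp only [nop₂, vop]
  split_ifs <;> ring

lemma nop₃_eq_mul (q : ℝ) (X Y Z : Fam) (g u₁ u₂ u₃ : ℂ) (w v : State) :
    nop₃ q X Y Z g u₁ u₂ u₃ w v = g * nop₃ q X Y Z 1 u₁ u₂ u₃ w v := by
  simp only [nop₃, vop]
  split_ifs <;> ring

lemma hasSum_prod₂ {q : ℝ} (hq0 : 0 < q) {X Y : Fam} {ρ : ℝ} {G : ℂ → ℂ}
    (h : HasCtr q X Y ρ G) {u₁ u₂ : ℂ} (hu : ‖zOf q (u₂ - u₁)‖ < ρ) (w v : State) :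
    HasSum (fun n => X.op q u₁ w n * Y.op q u₂ n v) (prod₂ q X Y G w v u₁ u₂) := by
  have := hasSum_vop (h.ctrSummable hq0 hu) X.δ Y.δ (X.zm q u₁) (Y.zm q u₂) w v
  rw [h.exp_ctrSum hq0 hu] at this
  exact this

lemma hasSum_prod₃ {q : ℝ} (hq0 : 0 < q) (hq1 : q < 1) {X Y Z : Fam} {ρ ρ' ρ'' : ℝ}
    {G G' G'' : ℂ → ℂ} (h : HasCtr q X Y ρ G) (h' : HasCtr q X Z ρ' G')
    (h'' : HasCtr q Y Z ρ'' G'') {u₁ u₂ u₃ : ℂ} (hu : ‖zOf q (u₂ - u₁)‖ < ρ)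
    (hu' : ‖zOf q (u₃ - u₁)‖ < ρ') (hu'' : ‖zOf q (u₃ - u₂)‖ < ρ'') (w v : State) :
    HasSum (fun n : State × State => X.op q u₁ w n.1 * Y.op q u₂ n.1 n.2 * Z.op q u₃ n.2 v)
      (prod₃ q X Y Z G G' G'' w v u₁ u₂ u₃) := by
  have := hasSum_vop₃ hq0 hq1 (h.ctrSummable hq0 hu) (h'.ctrSummable hq0 hu')
    (h''.ctrSummable hq0 hu'') X.δ Y.δ Z.δ (X.zm q u₁) (Y.zm q u₂) (Z.zm q u₃) w v
  rw [Complex.exp_add, Complex.exp_add, h.exp_ctrSum hq0 hu, h'.exp_ctrSum hq0 hu',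
    h''.exp_ctrSum hq0 hu''] at this
  exact this

lemma differentiable_coef {q : ℝ} (hq0 : 0 < q) (X : Fam) (m : ℤ) :
    Differentiable ℂ fun u => X.coef q u m :=
  (differentiable_zpw hq0 _).const_mul _

lemma differentiable_zm {q : ℝ} (hq0 : 0 < q) (X : Fam) (x : ℤ × ℤ) :
    Differentiable ℂ fun u => X.zm q u x :=
  (differentiable_zpw hq0 _).const_mul _

lemma differentiable_vop {T : Type*} [NormedAddCommGroup T] [NormedSpace ℂ T] {q : ℝ}
    {c : T → ℤ → ℂ} {g : T → ℤ × ℤ → ℂ} (δ : ℤ × ℤ) (hc : ∀ m, Differentiable ℂ fun t => c t m)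
    (hg : ∀ x, Differentiable ℂ fun t => g t x) (w v : State) :
    Differentiable ℂ fun t => vop q (c t) δ (g t) w v := by
  unfold vop vfock
  refine Differentiable.mul (differentiable_fock (fun m => hc _)
    (fun m => (hc _).mul_const _) _ _) ?_
  split_ifs
  · exact hg _
  · exact differentiable_const _

lemma differentiable_nop₂ {T : Type*} [NormedAddCommGroup T] [NormedSpace ℂ T] {q : ℝ}
    (hq0 : 0 < q) (X Y : Fam) {p₁ p₂ : T → ℂ} (h₁ : Differentiable ℂ p₁)
    (h₂ : Differentiable ℂ p₂) (w v : State) :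
    Differentiable ℂ fun t => nop₂ q X Y 1 (p₁ t) (p₂ t) w v := by
  refine differentiable_vop _ (fun m => ?_) (fun x => ?_) w v
  · exact ((differentiable_coef hq0 X m).comp h₁).add ((differentiable_coef hq0 Y m).comp h₂)
  · exact (((differentiable_zm hq0 X _).comp h₁).mul
      ((differentiable_zm hq0 Y _).comp h₂)).const_mul _

lemma differentiable_nop₃ {T : Type*} [NormedAddCommGroup T] [NormedSpace ℂ T] {q : ℝ}
    (hq0 : 0 < q) (X Y Z : Fam) {p₁ p₂ p₃ : T → ℂ} (h₁ : Differentiable ℂ p₁)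
    (h₂ : Differentiable ℂ p₂) (h₃ : Differentiable ℂ p₃) (w v : State) :
    Differentiable ℂ fun t => nop₃ q X Y Z 1 (p₁ t) (p₂ t) (p₃ t) w v := by
  refine differentiable_vop _ (fun m => ?_) (fun x => ?_) w v
  · exact (((differentiable_coef hq0 X m).comp h₁).add
      ((differentiable_coef hq0 Y m).comp h₂)).add ((differentiable_coef hq0 Z m).comp h₃)
  · exact ((((differentiable_zm hq0 X _).comp h₁).mul
      ((differentiable_zm hq0 Y _).comp h₂)).mul ((differentiable_zm hq0 Z _).comp h₃)).const_mul _

lemma norm_zOf_sub_lt {q : ℝ} (hq0 : 0 < q) {ε : ℝ} {u₁ u₂ : ℂ}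
    (h : ‖zOf q u₂‖ < ε * ‖zOf q u₁‖) : ‖zOf q (u₂ - u₁)‖ < ε := by
  rw [zOf_sub hq0, norm_div, div_lt_iff₀ (norm_zOf_pos hq0 u₁)]
  exact h

lemma isCont₂_prod₂ {q : ℝ} (hq0 : 0 < q) {X Y : Fam} {ρ : ℝ} {G : ℂ → ℂ}
    (h : HasCtr q X Y ρ G) {S : Set ℂ} (hG : ∀ x ∉ S, DifferentiableAt ℂ G x) (w v : State) :
    IsCont₂ q (X.op q) (Y.op q) (Dom₂ q S) w v (prod₂ q X Y G w v) := by
  refine ⟨?_, ρ, h.pos, fun u₁ u₂ hu => hasSum_prod₂ hq0 h (norm_zOf_sub_lt hq0 hu) w v⟩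
  intro x hx
  refine DifferentiableAt.differentiableWithinAt ?_
  unfold prod₂
  simp only [nop₂_eq_mul q X Y (G _)]
  refine DifferentiableAt.mul ?_
    (differentiable_nop₂ hq0 X Y differentiable_fst differentiable_snd w v x)
  have hz : DifferentiableAt ℂ (fun x : ℂ × ℂ => zOf q (x.2 - x.1)) x :=
    ((differentiable_zOf hq0).comp (differentiable_snd.sub differentiable_fst)) x
  exact DifferentiableAt.comp x (hG _ hx) hz

lemma isCont₃_prod₃ {q : ℝ} (hq0 : 0 < q) (hq1 : q < 1) {X Y Z : Fam} {ρ ρ' ρ'' : ℝ}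
    {G G' G'' : ℂ → ℂ} (h : HasCtr q X Y ρ G) (h' : HasCtr q X Z ρ' G')
    (h'' : HasCtr q Y Z ρ'' G'') {S S' S'' : Set ℂ} (hG : ∀ x ∉ S, DifferentiableAt ℂ G x)
    (hG' : ∀ x ∉ S', DifferentiableAt ℂ G' x) (hG'' : ∀ x ∉ S'', DifferentiableAt ℂ G'' x)
    (w v : State) :
    IsCont₃ q (X.op q) (Y.op q) (Z.op q) (Dom₃ q S S' S'') w v
      (prod₃ q X Y Z G G' G'' w v) := by
  constructor
  · rintro x ⟨hx, hx', hx''⟩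
    refine DifferentiableAt.differentiableWithinAt ?_
    unfold prod₃
    simp only [nop₃_eq_mul q X Y Z (G _ * G' _ * G'' _)]
    have h₁ : Differentiable ℂ fun x : ℂ × ℂ × ℂ => x.1 := by fun_prop
    have h₂ : Differentiable ℂ fun x : ℂ × ℂ × ℂ => x.2.1 := by fun_prop
    have h₃ : Differentiable ℂ fun x : ℂ × ℂ × ℂ => x.2.2 := by fun_prop
    refine DifferentiableAt.mul (DifferentiableAt.mul (DifferentiableAt.mul ?_ ?_) ?_)
      (differentiable_nop₃ hq0 X Y Z h₁ h₂ h₃ w v x)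
    · exact DifferentiableAt.comp (g := G) (f := fun x : ℂ × ℂ × ℂ => zOf q (x.2.1 - x.1)) x
        (hG _ hx) (((differentiable_zOf hq0).comp (h₂.sub h₁)) x)
    · exact DifferentiableAt.comp (g := G') (f := fun x : ℂ × ℂ × ℂ => zOf q (x.2.2 - x.1)) x
        (hG' _ hx') (((differentiable_zOf hq0).comp (h₃.sub h₁)) x)
    · exact DifferentiableAt.comp (g := G'') (f := fun x : ℂ × ℂ × ℂ => zOf q (x.2.2 - x.2.1)) x
        (hG'' _ hx'') (((differentiable_zOf hq0).comp (h₃.sub h₂)) x)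
  -- The `1` in the minimum lets `|z₃| < ε|z₂|` and `|z₂| < ε|z₁|` control `|z₃| / |z₁|` as well.
  · refine ⟨min 1 (min ρ (min ρ' ρ'')), by simp [h.pos, h'.pos, h''.pos],
      fun u₁ u₂ u₃ h1 h2 => ?_⟩
    have hp₁ := norm_zOf_pos hq0 u₁
    have hp₂ := norm_zOf_pos hq0 u₂
    have hε : min 1 (min ρ (min ρ' ρ'')) ≤ 1 := min_le_left _ _
    have h3 : ‖zOf q u₃‖ < min 1 (min ρ (min ρ' ρ'')) * ‖zOf q u₁‖ := by
      have : ‖zOf q u₃‖ < ‖zOf q u₂‖ := h2.trans_le (mul_le_of_le_one_left hp₂.le hε)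
      exact this.trans h1
    refine hasSum_prod₃ hq0 hq1 h h' h'' ((norm_zOf_sub_lt hq0 h1).trans_le ?_)
      ((norm_zOf_sub_lt hq0 h3).trans_le ?_) ((norm_zOf_sub_lt hq0 h2).trans_le ?_) w v
    · exact (min_le_right _ _).trans (min_le_left _ _)
    · exact (min_le_right _ _).trans ((min_le_right _ _).trans (min_le_left _ _))
    · exact (min_le_right _ _).trans ((min_le_right _ _).trans (min_le_right _ _))

/-- the zero-mode parts of `X(u₁) Y(u₂)` and `Y(u₂) X(u₁)` differ by `σ (z₁/z₂)^a` -/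
structure Local (X Y : Fam) (σ a : ℂ) : Prop where
  sign : ∀ x, X.κ (x + Y.δ) * Y.κ x = σ * (Y.κ (x + X.δ) * X.κ x)
  left : ∀ x, X.e (x + Y.δ) = X.e x + a
  right : ∀ x, Y.e (x + X.δ) = Y.e x + a

lemma Local.zm_mul_zm {q : ℝ} (hq0 : 0 < q) {X Y : Fam} {σ a : ℂ} (h : Local X Y σ a)
    (u₁ u₂ : ℂ) (x : ℤ × ℤ) : X.zm q u₁ (x + Y.δ) * Y.zm q u₂ x =
      σ * zpw q (u₁ - u₂) a * (Y.zm q u₂ (x + X.δ) * X.zm q u₁ x) := by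
  have h1 := h.sign x
  have h2 : zpw q (u₁ - u₂) a * zpw q u₂ a = zpw q u₁ a := by
    rw [← zpw_add_arg hq0, sub_add_cancel]
  simp only [zm, h.left, h.right, zpw_add hq0]
  rw [← h2]
  linear_combination (zpw q u₁ (X.e x) * (zpw q (u₁ - u₂) a * zpw q u₂ a) * zpw q u₂ (Y.e x)) * h1

lemma Local.nop₂_comm {q : ℝ} (hq0 : 0 < q) {X Y : Fam} {σ a : ℂ} (h : Local X Y σ a)
    (g u₁ u₂ : ℂ) :
    nop₂ q X Y g u₁ u₂ = nop₂ q Y X (g * (σ * zpw q (u₁ - u₂) a)) u₂ u₁ := by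
  unfold nop₂
  simp only [h.zm_mul_zm hq0]
  rw [add_comm (X.coef q u₁), add_comm Y.δ]
  congr 1
  funext x
  ring

lemma Local.nop₃_rotate {q : ℝ} (hq0 : 0 < q) {X Y Z : Fam} {σ a σ' a' : ℂ} (h : Local X Y σ a)
    (h' : Local X Z σ' a') (g u₁ u₂ u₃ : ℂ) :
    nop₃ q X Y Z g u₁ u₂ u₃ =
      nop₃ q Y Z X (g * (σ * zpw q (u₁ - u₂) a) * (σ' * zpw q (u₁ - u₃) a')) u₂ u₃ u₁ := by
  unfold nop₃
  have h1 : X.coef q u₁ + Y.coef q u₂ + Z.coef q u₃ = Y.coef q u₂ + Z.coef q u₃ + X.coef q u₁ := by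
    abel
  have h2 : Z.δ + Y.δ + X.δ = X.δ + Z.δ + Y.δ := by abel
  rw [h1, h2]
  congr 1
  funext x
  rw [h.zm_mul_zm hq0]
  have h3 := h'.zm_mul_zm hq0 u₁ u₃ x
  rw [add_right_comm x Z.δ X.δ]
  linear_combination (g * σ * zpw q (u₁ - u₂) a * Y.zm q u₂ (x + X.δ + Z.δ)) * h3

/-- Both orderings continue to a contraction times the same entire normally ordered product, apart
from the zero-mode factor, so only the scalar identity `hg` between contractions is left. It is
needed off a discrete set only. -/
lemma exchangeRel {q : ℝ} (hq0 : 0 < q) {X Y : Fam} {ρ ρ' : ℝ} {G G' : ℂ → ℂ}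
    (h : HasCtr q X Y ρ G) (h' : HasCtr q Y X ρ' G') (hG : ∀ x, MeromorphicAt G x)
    (hG' : ∀ x, MeromorphicAt G' x) {σ a : ℂ} (hloc : Local X Y σ a) {g : ℂ → ℂ → ℂ}
    (hg : ∀ u₁, ∀ᶠ u₂ in Filter.codiscrete ℂ, G (zOf q (u₂ - u₁)) * (σ * zpw q (u₁ - u₂) a) =
      g u₁ u₂ * G' (zOf q (u₁ - u₂))) :
    ExchangeRel q (X.op q) (Y.op q) g := by
  intro w v
  have han : ∀ f : ℂ → ℂ, Differentiable ℂ f → ∀ x, AnalyticAt ℂ f x := fun f hf x =>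
    hf.analyticAt x
  refine ⟨prod₂ q X Y G w v, fun u₁ u₂ => prod₂ q Y X G' w v u₂ u₁, ?_, ?_, ?_, ?_, ?_⟩
  · intro u₁ u₂ _
    unfold prod₂
    simp only [nop₂_eq_mul q X Y (G _)]
    refine MeromorphicAt.mul ?_ (AnalyticAt.meromorphicAt (han _
      (differentiable_nop₂ hq0 X Y (differentiable_const u₁) differentiable_id w v) u₂))
    exact (hG _).comp_analyticAt (han _ ((differentiable_zOf hq0).comp
      (differentiable_id.sub_const u₁)) u₂)
  · intro u₁ u₂ _
    unfold prod₂
    simp only [nop₂_eq_mul q Y X (G' _)]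
    refine MeromorphicAt.mul ?_ (AnalyticAt.meromorphicAt (han _
      (differentiable_nop₂ hq0 Y X differentiable_id (differentiable_const u₁) w v) u₂))
    exact (hG' _).comp_analyticAt (han _ ((differentiable_zOf hq0).comp
      (differentiable_id.const_sub u₁)) u₂)
  · exact ⟨ρ, h.pos, fun u₁ u₂ hu => hasSum_prod₂ hq0 h (norm_zOf_sub_lt hq0 hu) w v⟩
  · exact ⟨ρ', h'.pos, fun u₁ u₂ hu => hasSum_prod₂ hq0 h' (norm_zOf_sub_lt hq0 hu) w v⟩
  · intro u₁
    filter_upwards [hg u₁] with u₂ hu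
    rw [prod₂, hloc.nop₂_comm hq0, hu, nop₂_eq_mul, prod₂, nop₂_eq_mul q Y X (G' _), mul_assoc]

end Fam


namespace Fam

/-! ### Contour integrals of products -/

/-- bound for the oscillator coefficients on the annulus `A ≤ ‖z‖ ≤ B` -/
def coefBd (X : Fam) (A B : ℝ) : ℤ → ℝ := fun m => ‖X.γ m‖ * (A ^ (-m) + B ^ (-m))

/-- Positive modes are largest on the inner circle and negative modes on the outer one; adding the
two powers covers both cases. -/
lemma norm_coef_le {q : ℝ} (X : Fam) {A B : ℝ} (hA : 0 < A) {u : ℂ}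
    (h1 : A ≤ ‖zOf q u‖) (h2 : ‖zOf q u‖ ≤ B) (m : ℤ) : ‖X.coef q u m‖ ≤ X.coefBd A B m := by
  have hz : zpw q u (-(m : ℂ)) = zOf q u ^ (-m) := by rw [← zpw_intCast]; simp
  rw [coef, norm_mul, hz, norm_zpow, coefBd]
  refine mul_le_mul_of_nonneg_left ?_ (norm_nonneg _)
  have hu : 0 < ‖zOf q u‖ := hA.trans_le h1
  have hB : 0 < B := hu.trans_le h2
  rcases le_total 0 m with hm | hm
  · have h3 : ‖zOf q u‖ ^ (-m) ≤ A ^ (-m) := by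
      rw [zpow_neg, zpow_neg]
      exact inv_anti₀ (zpow_pos hA _) (zpow_le_zpow_left₀ hm hA.le h1)
    have := zpow_pos hB (-m)
    linarith
  · have h3 : ‖zOf q u‖ ^ (-m) ≤ B ^ (-m) := zpow_le_zpow_left₀ (by omega) hu.le h2
    have := zpow_pos hA (-m)
    linarith

/-- The bound is a sum over the two radii, and for each radius the series is the contraction series
at a point of modulus less than `ρ`. -/
lemma summable_coefBd_mul_coef {q : ℝ} (hq0 : 0 < q) (hq1 : q < 1) {X Y : Fam} {ρ : ℝ}
    {G : ℂ → ℂ} (h : HasCtr q X Y ρ G) {A B : ℝ} (hA : 0 < A) (hAB : A ≤ B) {u : ℂ}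
    (hu : ‖zOf q u‖ < ρ * A) :
    Summable fun m : ℕ+ => X.coefBd A B m * heis q m * ‖Y.coef q u (-(m : ℤ))‖ := by
  have hz := norm_zOf_pos hq0 u
  have hB : 0 < B := hA.trans_le hAB
  have hx : ∀ D : ℝ, A ≤ D → Summable fun m : ℕ+ => ‖X.γ m * (heis q m : ℂ) * Y.γ (-(m : ℤ)) *
      ((‖zOf q u‖ / D : ℝ) : ℂ) ^ (m : ℕ)‖ := by
    intro D hD
    have hD0 : 0 < D := hA.trans_le hD
    refine h.summable _ ?_
    rw [Complex.norm_real, Real.norm_of_nonneg (by positivity), div_lt_iff₀ hD0]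
    exact hu.trans_le (mul_le_mul_of_nonneg_left hD h.pos.le)
  refine ((hx A le_rfl).add (hx B hAB)).congr fun m => ?_
  have hzm : zpw q u (-((-(m : ℤ) : ℤ) : ℂ)) = zOf q u ^ ((m : ℕ) : ℤ) := by
    rw [← zpw_intCast]; simp
  simp only [norm_mul, norm_pow, Complex.norm_real, Real.norm_of_nonneg (heis_nonneg hq0 hq1 m),
    coef, coefBd, hzm, norm_div, norm_norm, Real.norm_of_nonneg hA.le,
    Real.norm_of_nonneg hB.le, div_pow, zpow_neg, zpow_natCast]
  field_simp

lemma summable_coef_mul_coefBd {q : ℝ} (hq0 : 0 < q) (hq1 : q < 1) {X Y : Fam} {ρ : ℝ}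
    {G : ℂ → ℂ} (h : HasCtr q X Y ρ G) {A B : ℝ} (hA : 0 < A) (hAB : A ≤ B) {u : ℂ}
    (hu : B < ρ * ‖zOf q u‖) :
    Summable fun m : ℕ+ => ‖X.coef q u m‖ * heis q m * Y.coefBd A B (-(m : ℤ)) := by
  have hz := norm_zOf_pos hq0 u
  have hB : 0 < B := hA.trans_le hAB
  have hx : ∀ D : ℝ, 0 < D → D ≤ B → Summable fun m : ℕ+ =>
      ‖X.γ m * (heis q m : ℂ) * Y.γ (-(m : ℤ)) * ((D / ‖zOf q u‖ : ℝ) : ℂ) ^ (m : ℕ)‖ := by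
    intro D hD0 hD
    refine h.summable _ ?_
    rw [Complex.norm_real, Real.norm_of_nonneg (by positivity), div_lt_iff₀ hz]
    exact hD.trans_lt hu
  refine ((hx A hA hAB).add (hx B hB le_rfl)).congr fun m => ?_
  have hzm : zpw q u (-((m : ℤ) : ℂ)) = zOf q u ^ (-((m : ℕ) : ℤ)) := by
    rw [← zpw_intCast]; simp
  simp only [norm_mul, norm_pow, Complex.norm_real, Real.norm_of_nonneg (heis_nonneg hq0 hq1 m),
    coef, coefBd, hzm, norm_inv, norm_div, norm_norm, Real.norm_of_nonneg hA.le,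
    Real.norm_of_nonneg hB.le, div_pow, zpow_neg, zpow_natCast, neg_neg]
  field_simp

/-- The extreme radii are attained by compactness, so strict inequalities known pointwise on the
contour pass to `A` and `B`. -/
lemma exists_annulus {q : ℝ} (hq0 : 0 < q) {p : ℝ → ℝ → ℂ}
    (hp : Continuous fun x : ℝ × ℝ => p x.1 x.2) :
    ∃ A B : ℝ, 0 < A ∧ A ≤ B ∧
      (∀ s ∈ Set.Icc (0 : ℝ) 1, ∀ t ∈ Set.Icc (0 : ℝ) 1,
        A ≤ ‖zOf q (p s t)‖ ∧ ‖zOf q (p s t)‖ ≤ B) ∧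
      (∃ s ∈ Set.Icc (0 : ℝ) 1, ∃ t ∈ Set.Icc (0 : ℝ) 1, A = ‖zOf q (p s t)‖) ∧
      ∃ s ∈ Set.Icc (0 : ℝ) 1, ∃ t ∈ Set.Icc (0 : ℝ) 1, B = ‖zOf q (p s t)‖ := by
  have hK : IsCompact (Set.Icc (0 : ℝ) 1 ×ˢ Set.Icc (0 : ℝ) 1) := isCompact_Icc.prod isCompact_Icc
  have hne : (Set.Icc (0 : ℝ) 1 ×ˢ Set.Icc (0 : ℝ) 1).Nonempty := ⟨(0, 0), by simp⟩
  have hc : Continuous fun x : ℝ × ℝ => ‖zOf q (p x.1 x.2)‖ :=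
    ((continuous_zOf hq0).comp hp).norm
  obtain ⟨a, ha, ha'⟩ := hK.exists_isMinOn hne hc.continuousOn
  obtain ⟨b, hb, hb'⟩ := hK.exists_isMaxOn hne hc.continuousOn
  refine ⟨‖zOf q (p a.1 a.2)‖, ‖zOf q (p b.1 b.2)‖, norm_zOf_pos hq0 _, ha' hb, ?_,
    ⟨a.1, ha.1, a.2, ha.2, rfl⟩, ⟨b.1, hb.1, b.2, hb.2, rfl⟩⟩
  exact fun s hs t ht => ⟨ha' (a := (s, t)) ⟨hs, ht⟩, hb' (a := (s, t)) ⟨hs, ht⟩⟩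

lemma vop_mul_apply (q : ℝ) (c : ℤ → ℂ) (δ : ℤ × ℤ) (g k : ℤ × ℤ → ℂ) (w v : State) :
    vop q c δ g w v * k v.2 = vop q c δ (fun x => g x * k x) w v := by
  simp only [vop]
  split_ifs <;> ring

lemma prod₂_mul_apply (q : ℝ) (X Y : Fam) (G : ℂ → ℂ) (k : ℤ × ℤ → ℂ) (w v : State) (u₁ u₂ : ℂ) :
    prod₂ q X Y G w v u₁ u₂ * k v.2 = vop q (X.coef q u₁ + Y.coef q u₂) (Y.δ + X.δ)
      (fun x => G (zOf q (u₂ - u₁)) * (X.zm q u₁ (x + Y.δ) * Y.zm q u₂ x) * k x) w v :=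
  vop_mul_apply _ _ _ _ _ _ _

lemma continuous_coef {T : Type*} [TopologicalSpace T] {q : ℝ} (hq0 : 0 < q) (X : Fam)
    {p : T → ℂ} (hp : Continuous p) (m : ℤ) : Continuous fun t => X.coef q (p t) m :=
  (differentiable_coef hq0 X m).continuous.comp hp

lemma continuous_zm {T : Type*} [TopologicalSpace T] {q : ℝ} (hq0 : 0 < q) (X : Fam)
    {p : T → ℂ} (hp : Continuous p) (x : ℤ × ℤ) : Continuous fun t => X.zm q (p t) x :=
  (differentiable_zm hq0 X x).continuous.comp hp

/-- `∮ X(u') k(u') · Y(u)` -/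
lemma hasSum_integral_op_mul {q : ℝ} (hq0 : 0 < q) (hq1 : q < 1) {X Y : Fam} {ρ : ℝ}
    {G : ℂ → ℂ} (h : HasCtr q X Y ρ G) {p : ℝ → ℂ} (hp : Continuous p) {k : ℝ → ℤ × ℤ → ℂ}
    (hk : ∀ x, Continuous fun t => k t x) {u : ℂ}
    (hu : ∀ t ∈ Set.Icc (0 : ℝ) 1, ‖zOf q u‖ < ρ * ‖zOf q (p t)‖) (w v : State) :
    HasSum (fun n => (∫ t in (0 : ℝ)..1, X.op q (p t) w n * k t n.2) * Y.op q u n v)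
      (∫ t in (0 : ℝ)..1, prod₂ q X Y G w v (p t) u * k t (v.2 + Y.δ)) := by
  have hp' : Continuous fun x : ℝ × ℝ => (fun s _ : ℝ => p s) x.1 x.2 := hp.comp continuous_fst
  obtain ⟨A, B, hA, hAB, hAB', ⟨s₀, hs₀, t₀, ht₀, hA'⟩, _⟩ := exists_annulus (p := fun s _ => p s) hq0 hp'
  -- The double-integral statement serves for a single contour by letting the integrand ignore the
  -- second parameter.
  have := hasSum_integral_vop_mul hq0 hq1 (c := fun s _ => X.coef q (p s)) (d := Y.coef q u)
    (g := fun s _ x => X.zm q (p s) x * k s x) (Y.zm q u) X.δ Y.δ (C := X.coefBd A B)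
    (fun m => continuous_coef hq0 X hp' m)
    (fun z => (continuous_zm hq0 X hp' z).mul ((hk z).comp continuous_fst))
    (fun s hs t ht m => norm_coef_le X hA (hAB' s hs t ht).1 (hAB' s hs t ht).2 m)
    (summable_coefBd_mul_coef hq0 hq1 h hA hAB (hA' ▸ hu s₀ hs₀)) w v
  simp only [intervalIntegral.integral_const, sub_zero, one_smul] at this
  refine hasSum_of_eq this (fun n => ?_) ?_
  · simp only [op, vop_mul_apply]
  · refine intervalIntegral.integral_congr fun t ht => ?_
    rw [Set.uIcc_of_le zero_le_one] at ht
    simp only [h.exp_ctrSum hq0 (norm_zOf_sub_lt hq0 (hu t ht))]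
    rw [prod₂_mul_apply q X Y G (fun x => k t (x + Y.δ))]
    congr 1
    funext x
    ring

/-- `Y(u) · ∮ X(u') k(u')` -/
lemma hasSum_op_mul_integral {q : ℝ} (hq0 : 0 < q) (hq1 : q < 1) {X Y : Fam} {ρ : ℝ}
    {G : ℂ → ℂ} (h : HasCtr q Y X ρ G) {p : ℝ → ℂ} (hp : Continuous p) {k : ℝ → ℤ × ℤ → ℂ}
    (hk : ∀ x, Continuous fun t => k t x) {u : ℂ}
    (hu : ∀ t ∈ Set.Icc (0 : ℝ) 1, ‖zOf q (p t)‖ < ρ * ‖zOf q u‖) (w v : State) :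
    HasSum (fun n => Y.op q u w n * ∫ t in (0 : ℝ)..1, X.op q (p t) n v * k t v.2)
      (∫ t in (0 : ℝ)..1, prod₂ q Y X G w v u (p t) * k t v.2) := by
  have hp' : Continuous fun x : ℝ × ℝ => (fun s _ : ℝ => p s) x.1 x.2 := hp.comp continuous_fst
  obtain ⟨A, B, hA, hAB, hAB', _, ⟨s₀, hs₀, t₀, ht₀, hB'⟩⟩ := exists_annulus (p := fun s _ => p s) hq0 hp'
  have := hasSum_mul_integral_vop hq0 hq1 (c := fun s _ => X.coef q (p s)) (d := Y.coef q u)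
    (g := fun s _ x => X.zm q (p s) x * k s x) (Y.zm q u) X.δ Y.δ (C := X.coefBd A B)
    (fun m => continuous_coef hq0 X hp' m)
    (fun z => (continuous_zm hq0 X hp' z).mul ((hk z).comp continuous_fst))
    (fun s hs t ht m => norm_coef_le X hA (hAB' s hs t ht).1 (hAB' s hs t ht).2 m)
    (summable_coef_mul_coefBd hq0 hq1 h hA hAB (hB' ▸ hu s₀ hs₀)) w v
  simp only [intervalIntegral.integral_const, sub_zero, one_smul] at this
  refine hasSum_of_eq this (fun n => ?_) ?_
  · simp only [op, vop_mul_apply]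
  · refine intervalIntegral.integral_congr fun t ht => ?_
    rw [Set.uIcc_of_le zero_le_one] at ht
    simp only [h.exp_ctrSum hq0 (norm_zOf_sub_lt hq0 (hu t ht))]
    rw [prod₂_mul_apply q Y X G (k t)]
    congr 1
    funext x
    ring

/-- `∮∮ X(u') X'(u'') k(u', u'') · Y(u)` -/
lemma hasSum_integral_prod₂_mul {q : ℝ} (hq0 : 0 < q) (hq1 : q < 1) {X X' Y : Fam} {ρ ρ' : ℝ}
    {G G' G'' : ℂ → ℂ} (h' : HasCtr q X Y ρ G') (h'' : HasCtr q X' Y ρ' G'') {p p' : ℝ → ℝ → ℂ}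
    (hp : Continuous fun x : ℝ × ℝ => p x.1 x.2) (hp' : Continuous fun x : ℝ × ℝ => p' x.1 x.2)
    (hG : Continuous fun x : ℝ × ℝ => G (zOf q (p' x.1 x.2 - p x.1 x.2)))
    {k : ℝ → ℝ → ℤ × ℤ → ℂ} (hk : ∀ z, Continuous fun x : ℝ × ℝ => k x.1 x.2 z) {u : ℂ}
    (hu : ∀ s ∈ Set.Icc (0 : ℝ) 1, ∀ t ∈ Set.Icc (0 : ℝ) 1, ‖zOf q u‖ < ρ * ‖zOf q (p s t)‖)
    (hu' : ∀ s ∈ Set.Icc (0 : ℝ) 1, ∀ t ∈ Set.Icc (0 : ℝ) 1, ‖zOf q u‖ < ρ' * ‖zOf q (p' s t)‖)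
    (w v : State) :
    HasSum (fun n => (∫ s in (0 : ℝ)..1, ∫ t in (0 : ℝ)..1,
        prod₂ q X X' G w n (p s t) (p' s t) * k s t n.2) * Y.op q u n v)
      (∫ s in (0 : ℝ)..1, ∫ t in (0 : ℝ)..1,
        prod₃ q X X' Y G G' G'' w v (p s t) (p' s t) u * k s t (v.2 + Y.δ)) := by
  obtain ⟨A, B, hA, hAB, hAB', ⟨s₀, hs₀, t₀, ht₀, hA'⟩, _⟩ := exists_annulus hq0 hp
  obtain ⟨E, D, hE, hED, hED', ⟨s₁, hs₁, t₁, ht₁, hE'⟩, _⟩ := exists_annulus hq0 hp'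
  have hsum : Summable fun m : ℕ+ => (fun m => X.coefBd A B m + X'.coefBd E D m) m * heis q m *
      ‖Y.coef q u (-(m : ℤ))‖ :=
    ((summable_coefBd_mul_coef hq0 hq1 h' hA hAB (hA' ▸ hu s₀ hs₀ t₀ ht₀)).add
      (summable_coefBd_mul_coef hq0 hq1 h'' hE hED (hE' ▸ hu' s₁ hs₁ t₁ ht₁))).congr
        fun m => by ring
  -- The continued product of `X` and `X'` is itself one vertex operator with added coefficients,
  -- its contraction being absorbed in the zero-mode weight. No convergence of the product over
  -- states is used.
  have := hasSum_integral_vop_mul hq0 hq1 (c := fun s t => X.coef q (p s t) + X'.coef q (p' s t))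
    (d := Y.coef q u) (g := fun s t x => G (zOf q (p' s t - p s t)) *
      (X.zm q (p s t) (x + X'.δ) * X'.zm q (p' s t) x) * k s t x) (Y.zm q u) (X'.δ + X.δ) Y.δ
    (C := fun m => X.coefBd A B m + X'.coefBd E D m)
    (fun m => (continuous_coef hq0 X hp m).add (continuous_coef hq0 X' hp' m))
    (fun z => (hG.mul ((continuous_zm hq0 X hp _).mul (continuous_zm hq0 X' hp' z))).mul (hk z))
    (fun s hs t ht m => (norm_add_le _ _).trans (add_le_add
      (norm_coef_le X hA (hAB' s hs t ht).1 (hAB' s hs t ht).2 m)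
      (norm_coef_le X' hE (hED' s hs t ht).1 (hED' s hs t ht).2 m))) hsum w v
  refine hasSum_of_eq this (fun n => ?_) ?_
  · simp only [op, prod₂_mul_apply]
  · refine intervalIntegral.integral_congr fun s hs => ?_
    refine intervalIntegral.integral_congr fun t ht => ?_
    rw [Set.uIcc_of_le zero_le_one] at hs ht
    have hs₁ := norm_zOf_sub_lt hq0 (hu s hs t ht)
    have hs₂ := norm_zOf_sub_lt hq0 (hu' s hs t ht)
    simp only [ctrSum_add_left (h'.ctrSummable hq0 hs₁) (h''.ctrSummable hq0 hs₂), Complex.exp_add,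
      h'.exp_ctrSum hq0 hs₁, h''.exp_ctrSum hq0 hs₂]
    rw [prod₃, nop₃, vop_mul_apply q _ _ _ fun x => k s t (x + Y.δ), ← add_assoc Y.δ]
    congr 1
    funext x
    ring

/-- `Y(u) · ∮∮ X(u') X'(u'') k(u', u'')` -/
lemma hasSum_mul_integral_prod₂ {q : ℝ} (hq0 : 0 < q) (hq1 : q < 1) {X X' Y : Fam} {ρ ρ' : ℝ}
    {G G' G'' : ℂ → ℂ} (h' : HasCtr q Y X ρ G') (h'' : HasCtr q Y X' ρ' G'') {p p' : ℝ → ℝ → ℂ}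
    (hp : Continuous fun x : ℝ × ℝ => p x.1 x.2) (hp' : Continuous fun x : ℝ × ℝ => p' x.1 x.2)
    (hG : Continuous fun x : ℝ × ℝ => G (zOf q (p' x.1 x.2 - p x.1 x.2)))
    {k : ℝ → ℝ → ℤ × ℤ → ℂ} (hk : ∀ z, Continuous fun x : ℝ × ℝ => k x.1 x.2 z) {u : ℂ}
    (hu : ∀ s ∈ Set.Icc (0 : ℝ) 1, ∀ t ∈ Set.Icc (0 : ℝ) 1, ‖zOf q (p s t)‖ < ρ * ‖zOf q u‖)
    (hu' : ∀ s ∈ Set.Icc (0 : ℝ) 1, ∀ t ∈ Set.Icc (0 : ℝ) 1, ‖zOf q (p' s t)‖ < ρ' * ‖zOf q u‖)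
    (w v : State) :
    HasSum (fun n => Y.op q u w n * ∫ s in (0 : ℝ)..1, ∫ t in (0 : ℝ)..1,
        prod₂ q X X' G n v (p s t) (p' s t) * k s t v.2)
      (∫ s in (0 : ℝ)..1, ∫ t in (0 : ℝ)..1,
        prod₃ q Y X X' G' G'' G w v u (p s t) (p' s t) * k s t v.2) := by
  obtain ⟨A, B, hA, hAB, hAB', _, ⟨s₀, hs₀, t₀, ht₀, hB'⟩⟩ := exists_annulus hq0 hp
  obtain ⟨E, D, hE, hED, hED', _, ⟨s₁, hs₁, t₁, ht₁, hD'⟩⟩ := exists_annulus hq0 hp'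
  have hsum : Summable fun m : ℕ+ => ‖Y.coef q u m‖ * heis q m *
      (fun m => X.coefBd A B m + X'.coefBd E D m) (-(m : ℤ)) :=
    ((summable_coef_mul_coefBd hq0 hq1 h' hA hAB (hB' ▸ hu s₀ hs₀ t₀ ht₀)).add
      (summable_coef_mul_coefBd hq0 hq1 h'' hE hED (hD' ▸ hu' s₁ hs₁ t₁ ht₁))).congr
        fun m => by ring
  have := hasSum_mul_integral_vop hq0 hq1 (c := fun s t => X.coef q (p s t) + X'.coef q (p' s t))
    (d := Y.coef q u) (g := fun s t x => G (zOf q (p' s t - p s t)) *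
      (X.zm q (p s t) (x + X'.δ) * X'.zm q (p' s t) x) * k s t x) (Y.zm q u) (X'.δ + X.δ) Y.δ
    (C := fun m => X.coefBd A B m + X'.coefBd E D m)
    (fun m => (continuous_coef hq0 X hp m).add (continuous_coef hq0 X' hp' m))
    (fun z => (hG.mul ((continuous_zm hq0 X hp _).mul (continuous_zm hq0 X' hp' z))).mul (hk z))
    (fun s hs t ht m => (norm_add_le _ _).trans (add_le_add
      (norm_coef_le X hA (hAB' s hs t ht).1 (hAB' s hs t ht).2 m)
      (norm_coef_le X' hE (hED' s hs t ht).1 (hED' s hs t ht).2 m))) hsum w v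
  refine hasSum_of_eq this (fun n => ?_) ?_
  · simp only [op, prod₂_mul_apply]
  · refine intervalIntegral.integral_congr fun s hs => ?_
    refine intervalIntegral.integral_congr fun t ht => ?_
    rw [Set.uIcc_of_le zero_le_one] at hs ht
    have hs₁ := norm_zOf_sub_lt hq0 (hu s hs t ht)
    have hs₂ := norm_zOf_sub_lt hq0 (hu' s hs t ht)
    simp only [ctrSum_add_right (h'.ctrSummable hq0 hs₁) (h''.ctrSummable hq0 hs₂),
      Complex.exp_add, h'.exp_ctrSum hq0 hs₁, h''.exp_ctrSum hq0 hs₂]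
    rw [prod₃, nop₃, vop_mul_apply q _ _ _ (k s t), ← add_assoc]
    congr 1
    funext x
    rw [← add_assoc]
    ring

end Fam


/-! ### Infinite products -/

section InfiniteProducts

variable {ι : Type*}

/-- The product converges locally uniformly, on the ball of radius `‖x‖ + 1` around the origin. -/
lemma differentiable_tprod_one_sub {a : ι → ℂ} (ha : Summable fun i => ‖a i‖) :
    Differentiable ℂ fun x : ℂ => ∏' i, (1 - x * a i) := by
  intro x
  have h := Summable.hasProdLocallyUniformlyOn_one_add (K := Metric.ball (0 : ℂ) (‖x‖ + 1))
    (f := fun i x => -(x * a i)) (u := fun i => (‖x‖ + 1) * ‖a i‖) Metric.isOpen_ball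
    (ha.mul_left _) (Filter.Eventually.of_forall fun i y hy => by
      rw [norm_neg, norm_mul]
      exact mul_le_mul_of_nonneg_right (by simpa using (Metric.mem_ball.1 hy).le) (norm_nonneg _))
    (fun i => by fun_prop)
  simp only [← sub_eq_add_neg] at h
  have hd := TendstoLocallyUniformlyOn.differentiableOn h
    (Filter.Eventually.of_forall fun s =>
      (differentiable_finsetProd (fun i => by fun_prop) s).differentiableOn) Metric.isOpen_ball
  exact hd.differentiableAt (Metric.isOpen_ball.mem_nhds (by simp))

lemma tprod_one_sub_ne_zero {a : ι → ℂ} (ha : Summable fun i => ‖a i‖) {x : ℂ}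
    (hx : ∀ i, x * a i ≠ 1) : ∏' i, (1 - x * a i) ≠ 0 := by
  simp only [sub_eq_add_neg]
  refine tprod_one_add_ne_zero_of_summable (fun i h => hx i ?_) ?_
  · rw [← sub_eq_add_neg, sub_eq_zero] at h
    exact h.symm
  · simpa only [norm_neg, norm_mul] using ha.mul_left ‖x‖

/-- `∑ f m` converges absolutely and its exponential is `v` -/
def ExpSum (f : ℕ+ → ℂ) (v : ℂ) : Prop :=
  Summable (fun m => ‖f m‖) ∧ Complex.exp (∑' m, f m) = v

lemma ExpSum.add {f g : ℕ+ → ℂ} {v w : ℂ} (hf : ExpSum f v) (hg : ExpSum g w) :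
    ExpSum (fun m => f m + g m) (v * w) := by
  refine ⟨(hf.1.add hg.1).of_nonneg_of_le (fun _ => norm_nonneg _) fun m => norm_add_le _ _, ?_⟩
  rw [hf.1.of_norm.tsum_add hg.1.of_norm, Complex.exp_add, hf.2, hg.2]

lemma ExpSum.neg {f : ℕ+ → ℂ} {v : ℂ} (hf : ExpSum f v) : ExpSum (fun m => -f m) v⁻¹ := by
  refine ⟨by simpa using hf.1, ?_⟩
  rw [tsum_neg, Complex.exp_neg, hf.2]

lemma ExpSum.congr {f g : ℕ+ → ℂ} {v w : ℂ} (hf : ExpSum f v) (h : ∀ m, f m = g m)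
    (hv : v = w) : ExpSum g w := by
  rwa [← funext h, ← hv]

lemma hasSum_pnat_neg_log {z : ℂ} (hz : ‖z‖ < 1) :
    HasSum (fun m : ℕ+ => z ^ (m : ℕ) / ((m : ℕ) : ℂ)) (-Complex.log (1 - z)) := by
  have h := Complex.hasSum_taylorSeries_neg_log' hz
  refine hasSum_of_eq (Equiv.pnatEquivNat.hasSum_iff.2 h) (fun m => ?_) rfl
  have hm : ((m.natPred : ℕ) : ℂ) + 1 = ((m : ℕ) : ℂ) := by
    exact_mod_cast congrArg (Nat.cast : ℕ → ℂ) (PNat.natPred_add_one m)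
  simp only [Function.comp_apply, Equiv.pnatEquivNat_apply, hm, PNat.natPred_add_one]

/-- Expand each `log (1 - x a_i)` and exchange the sums over `i` and `m`; the double family is
dominated by `‖a i‖ ‖x‖^m`, since `‖a i‖ ≤ 1`. -/
lemma expSum_tprod {a : ι → ℂ} (ha : Summable fun i => ‖a i‖) (ha1 : ∀ i, ‖a i‖ ≤ 1) {x : ℂ}
    (hx : ‖x‖ < 1) :
    ExpSum (fun m => -(x ^ (m : ℕ) / ((m : ℕ) : ℂ) * ∑' i, a i ^ (m : ℕ)))
      (∏' i, (1 - x * a i)) := by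
  have hxa : ∀ i, ‖x * a i‖ < 1 := fun i => by
    rw [norm_mul]
    exact (mul_le_of_le_one_right (norm_nonneg _) (ha1 i)).trans_lt hx
  have hle : ∀ (i : ι) (m : ℕ+), ‖(x * a i) ^ (m : ℕ) / ((m : ℕ) : ℂ)‖ ≤ ‖a i‖ * ‖x‖ ^ (m : ℕ) := by
    intro i m
    have hm : (1 : ℝ) ≤ (m : ℕ) := by exact_mod_cast m.pos
    rw [norm_div, norm_pow, norm_mul, mul_pow, Complex.norm_natCast]
    refine (div_le_self (by positivity) hm).trans ?_
    rw [mul_comm]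
    have := pow_le_of_le_one (norm_nonneg (a i)) (ha1 i) m.pos.ne'
    gcongr
  have hgeo : Summable fun m : ℕ+ => ‖x‖ ^ (m : ℕ) :=
    (summable_geometric_of_lt_one (norm_nonneg x) hx).comp_injective PNat.coe_injective
  have hF : Summable fun n : ι × ℕ+ => ‖(x * a n.1) ^ (n.2 : ℕ) / ((n.2 : ℕ) : ℂ)‖ :=
    (ha.mul_of_nonneg hgeo (fun _ => norm_nonneg _) (fun _ => by positivity)).of_nonneg_of_le
      (fun _ => norm_nonneg _) fun n => hle n.1 n.2
  have hterm : ∀ m : ℕ+, ∑' i, (x * a i) ^ (m : ℕ) / ((m : ℕ) : ℂ) =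
      x ^ (m : ℕ) / ((m : ℕ) : ℂ) * ∑' i, a i ^ (m : ℕ) := by
    intro m
    rw [← tsum_mul_left]
    exact tsum_congr fun i => by rw [mul_pow]; ring
  constructor
  · simp only [norm_neg, ← hterm]
    refine Summable.of_nonneg_of_le (fun _ => norm_nonneg _) (fun m => ?_)
      (hgeo.mul_left (∑' i, ‖a i‖))
    refine tsum_of_norm_bounded ?_ fun i => hle i m
    exact ha.hasSum.mul_right _
  · have hlog : ∀ i, ∑' m : ℕ+, (x * a i) ^ (m : ℕ) / ((m : ℕ) : ℂ) =
        -Complex.log (1 - x * a i) := fun i => (hasSum_pnat_neg_log (hxa i)).tsum_eq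
    have hslog : Summable fun i => Complex.log (1 - x * a i) := by
      have := Complex.summable_log_one_add_of_summable (f := fun i => -(x * a i))
        (ha.of_norm.mul_left x).neg
      simpa only [← sub_eq_add_neg] using this
    rw [← Complex.cexp_tsum_eq_tprod _ hslog]
    · congr 1
      rw [tsum_neg, ← tsum_congr hterm, Summable.tsum_comm (f := fun i (m : ℕ+) =>
        (x * a i) ^ (m : ℕ) / ((m : ℕ) : ℂ)) hF.of_norm, tsum_congr hlog, tsum_neg, neg_neg]
    · intro i h
      have := hxa i
      rw [← sub_eq_zero.1 h] at this
      simp at this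

end InfiniteProducts

/-! ### Pochhammer products -/

lemma summable_norm_pow {t : ℂ} (ht : ‖t‖ < 1) : Summable fun n : ℕ => ‖t ^ n‖ := by
  simpa using summable_geometric_of_lt_one (norm_nonneg t) ht

lemma summable_norm_pow_mul_pow {t₁ t₂ : ℂ} (h₁ : ‖t₁‖ < 1) (h₂ : ‖t₂‖ < 1) :
    Summable fun n : ℕ × ℕ => ‖t₁ ^ n.1 * t₂ ^ n.2‖ := by
  simp only [norm_mul]
  exact (summable_norm_pow h₁).mul_of_nonneg (summable_norm_pow h₂) (fun _ => norm_nonneg _)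
    (fun _ => norm_nonneg _)

lemma poch₂_eq (z t₁ t₂ : ℂ) :
    poch₂ z t₁ t₂ = ∏' n : ℕ × ℕ, (1 - z * (t₁ ^ n.1 * t₂ ^ n.2)) := by
  simp only [poch₂, mul_assoc]

lemma differentiable_poch {t : ℂ} (ht : ‖t‖ < 1) : Differentiable ℂ fun z => poch z t :=
  differentiable_tprod_one_sub (summable_norm_pow ht)

lemma differentiable_poch₂ {t₁ t₂ : ℂ} (h₁ : ‖t₁‖ < 1) (h₂ : ‖t₂‖ < 1) :
    Differentiable ℂ fun z => poch₂ z t₁ t₂ := by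
  simp only [poch₂_eq]
  exact differentiable_tprod_one_sub (summable_norm_pow_mul_pow h₁ h₂)

lemma poch_ne_zero {t : ℂ} (ht : ‖t‖ < 1) {z : ℂ} (hz : ∀ n : ℕ, z * t ^ n ≠ 1) :
    poch z t ≠ 0 :=
  tprod_one_sub_ne_zero (summable_norm_pow ht) hz

lemma poch_ne_zero_of_norm_lt {t : ℂ} (ht : ‖t‖ < 1) {z : ℂ} (hz : ‖z‖ < 1) : poch z t ≠ 0 := by
  refine poch_ne_zero ht fun n h => ?_
  have h1 : ‖z * t ^ n‖ < 1 := by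
    rw [norm_mul, norm_pow]
    exact (mul_le_of_le_one_right (norm_nonneg _) (pow_le_one₀ (norm_nonneg _) ht.le)).trans_lt hz
  simp [h] at h1

lemma poch₂_ne_zero_of_norm_lt {t₁ t₂ : ℂ} (h₁ : ‖t₁‖ < 1) (h₂ : ‖t₂‖ < 1) {z : ℂ}
    (hz : ‖z‖ < 1) : poch₂ z t₁ t₂ ≠ 0 := by
  rw [poch₂_eq]
  refine tprod_one_sub_ne_zero (summable_norm_pow_mul_pow h₁ h₂) fun n h => ?_
  have h1 : ‖z * (t₁ ^ n.1 * t₂ ^ n.2)‖ < 1 := by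
    rw [norm_mul, norm_mul, norm_pow, norm_pow]
    exact (mul_le_of_le_one_right (norm_nonneg _) (mul_le_one₀ (pow_le_one₀ (norm_nonneg _) h₁.le)
      (by positivity) (pow_le_one₀ (norm_nonneg _) h₂.le))).trans_lt hz
  simp [h] at h1

lemma poch_eq_mul {t : ℂ} (ht : ‖t‖ < 1) (z : ℂ) : poch z t = (1 - z) * poch (z * t) t := by
  have hs : ∀ n : ℕ, 1 - z * t * t ^ n = 1 - z * t ^ (n + 1) := fun n => by
    rw [pow_succ']; ring
  have hm : Multipliable fun n : ℕ => 1 - z * t ^ (n + 1) := by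
    simp only [sub_eq_add_neg]
    refine multipliable_one_add_of_summable ?_
    simpa only [norm_neg, norm_mul] using
      ((summable_nat_add_iff 1).2 (summable_norm_pow ht)).mul_left ‖z‖
  have h := tprod_eq_zero_mul' (f := fun n : ℕ => 1 - z * t ^ n) hm
  simp only [pow_zero, mul_one] at h
  exact h.trans (congrArg _ (tprod_congr hs).symm)

lemma expSum_poch {z t : ℂ} (hz : ‖z‖ < 1) (ht : ‖t‖ < 1) :
    ExpSum (fun m => -(z ^ (m : ℕ) / ((m : ℕ) * (1 - t ^ (m : ℕ))))) (poch z t) := by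
  refine (expSum_tprod (summable_norm_pow ht) (fun n => ?_) hz).congr (fun m => ?_) rfl
  · rw [norm_pow]; exact pow_le_one₀ (norm_nonneg _) ht.le
  · have htm : ‖t ^ (m : ℕ)‖ < 1 := by
      rw [norm_pow]; exact pow_lt_one₀ (norm_nonneg _) ht m.pos.ne'
    have : ∑' n : ℕ, (t ^ n) ^ (m : ℕ) = (1 - t ^ (m : ℕ))⁻¹ := by
      rw [← tsum_geometric_of_norm_lt_one htm]
      exact tsum_congr fun n => by rw [← pow_mul, ← pow_mul, mul_comm]
    rw [this, div_mul_eq_div_div, div_eq_mul_inv _ (1 - t ^ (m : ℕ))]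

lemma expSum_poch₂ {z t₁ t₂ : ℂ} (hz : ‖z‖ < 1) (h₁ : ‖t₁‖ < 1) (h₂ : ‖t₂‖ < 1) :
    ExpSum (fun m => -(z ^ (m : ℕ) / ((m : ℕ) * ((1 - t₁ ^ (m : ℕ)) * (1 - t₂ ^ (m : ℕ))))))
      (poch₂ z t₁ t₂) := by
  rw [poch₂_eq]
  refine (expSum_tprod (summable_norm_pow_mul_pow h₁ h₂) (fun n => ?_) hz).congr (fun m => ?_) rfl
  · rw [norm_mul, norm_pow, norm_pow]
    exact mul_le_one₀ (pow_le_one₀ (norm_nonneg _) h₁.le) (by positivity)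
      (pow_le_one₀ (norm_nonneg _) h₂.le)
  · have htm₁ : ‖t₁ ^ (m : ℕ)‖ < 1 := by
      rw [norm_pow]; exact pow_lt_one₀ (norm_nonneg _) h₁ m.pos.ne'
    have htm₂ : ‖t₂ ^ (m : ℕ)‖ < 1 := by
      rw [norm_pow]; exact pow_lt_one₀ (norm_nonneg _) h₂ m.pos.ne'
    have : ∑' n : ℕ × ℕ, (t₁ ^ n.1 * t₂ ^ n.2) ^ (m : ℕ) =
        (1 - t₁ ^ (m : ℕ))⁻¹ * (1 - t₂ ^ (m : ℕ))⁻¹ := by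
      rw [← tsum_geometric_of_norm_lt_one htm₁, ← tsum_geometric_of_norm_lt_one htm₂,
        tsum_mul_tsum_of_summable_norm (summable_norm_pow htm₁) (summable_norm_pow htm₂)]
      exact tsum_congr fun n => by
        rw [mul_pow, ← pow_mul, ← pow_mul, ← pow_mul, ← pow_mul, mul_comm n.1, mul_comm n.2]
    rw [this, div_mul_eq_div_div, div_eq_mul_inv _ ((1 - t₁ ^ (m : ℕ)) * (1 - t₂ ^ (m : ℕ))),
      mul_inv]

lemma expSum_one_sub {z : ℂ} (hz : ‖z‖ < 1) :
    ExpSum (fun m => -(z ^ (m : ℕ) / ((m : ℕ) : ℂ))) (1 - z) := by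
  have := expSum_tprod (ι := Unit) (a := fun _ => 1) (Summable.of_finite) (by simp) hz
  exact this.congr (fun m => by simp) (by simp)

/-- By the identity theorem, one nonvanishing value makes the zero set of an entire function
discrete. -/
lemma eventually_codiscrete_ne_zero {f : ℂ → ℂ} (hf : Differentiable ℂ f) {x : ℂ} (hx : f x ≠ 0) :
    ∀ᶠ y in Filter.codiscrete ℂ, f y ≠ 0 :=
  AnalyticOnNhd.preimage_zero_mem_codiscrete (f := f) (fun y _ => hf.analyticAt y) hx


/-! ### Theta functions -/

/-- Multiplying by `p` only moves one factor between the two products: `1 - z` is lost and `1 - z⁻¹`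
is gained. -/
lemma theta_mul_nome {p : ℂ} (hp : ‖p‖ < 1) (hp0 : p ≠ 0) {z : ℂ} (hz : z ≠ 0) :
    Theta p (p * z) = -z⁻¹ * Theta p z := by
  have h1 : p * (p * z)⁻¹ = z⁻¹ := by field_simp
  have h2 := poch_eq_mul hp z
  have h3 := poch_eq_mul hp z⁻¹
  rw [Theta, Theta, h1, h2, h3, mul_comm z⁻¹ p, mul_comm z p]
  field_simp
  ring

lemma theta_inv {p : ℂ} (hp : ‖p‖ < 1) {z : ℂ} (hz : z ≠ 0) :
    Theta p z⁻¹ = -z⁻¹ * Theta p z := by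
  have h2 := poch_eq_mul hp z
  have h3 := poch_eq_mul hp z⁻¹
  rw [Theta, Theta, inv_inv, h2, h3, mul_comm z⁻¹ p, mul_comm z p]
  field_simp
  ring

lemma theta_ne_zero {p : ℂ} (hp : ‖p‖ < 1) (hp0 : p ≠ 0) {z : ℂ} (hz : z ≠ 0)
    (h : ∀ k : ℤ, z ≠ p ^ k) : Theta p z ≠ 0 := by
  refine mul_ne_zero (mul_ne_zero (poch_ne_zero hp fun n hn => ?_)
    (poch_ne_zero hp fun n hn => ?_)) (poch_ne_zero_of_norm_lt hp hp)
  · refine h (-(n : ℤ)) ?_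
    rw [zpow_neg, zpow_natCast]
    exact eq_inv_of_mul_eq_one_left hn
  · refine h ((n : ℤ) + 1) ?_
    have : z = p * p ^ n := by
      field_simp at hn
      exact hn.symm
    rw [zpow_add_one₀ hp0, zpow_natCast, this, mul_comm]

lemma poch_ne_zero_of_theta {p z : ℂ} (h : Theta p z ≠ 0) : poch z p ≠ 0 :=
  left_ne_zero_of_mul (left_ne_zero_of_mul h)

lemma nome_pos {q : ℝ} (hq0 : 0 < q) (R : ℝ) : 0 < nome q R := Real.rpow_pos_of_pos hq0 _

lemma nome_lt_one {q R : ℝ} (hq0 : 0 < q) (hq1 : q < 1) (hR : 0 < R) : nome q R < 1 :=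
  Real.rpow_lt_one hq0.le hq1 (by linarith)

lemma norm_nome {q : ℝ} (hq0 : 0 < q) (R : ℝ) : ‖(nome q R : ℂ)‖ = nome q R := by
  rw [Complex.norm_real, Real.norm_of_nonneg (nome_pos hq0 R).le]

lemma norm_nome_lt_one {q R : ℝ} (hq0 : 0 < q) (hq1 : q < 1) (hR : 0 < R) :
    ‖(nome q R : ℂ)‖ < 1 := by
  rw [norm_nome hq0]; exact nome_lt_one hq0 hq1 hR

lemma nome_ne_zero {q : ℝ} (hq0 : 0 < q) (R : ℝ) : (nome q R : ℂ) ≠ 0 :=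
  ofReal_ne_zero_of_pos (nome_pos hq0 R)

lemma zOf_ofReal {q : ℝ} (hq0 : 0 < q) (R : ℝ) : zOf q R = (nome q R : ℂ) := by
  rw [zOf, nome, Complex.ofReal_cpow hq0.le]
  push_cast
  rfl

lemma zOf_half {q : ℝ} : zOf q (1 / 2) = q := by simp [zOf]

lemma zOf_neg (q : ℝ) (u : ℂ) : zOf q (-u) = (zOf q u)⁻¹ := by
  rw [zOf, mul_neg, Complex.cpow_neg]; rfl

lemma zOf_neg_half {q : ℝ} : zOf q (-(1 / 2)) = (q : ℂ)⁻¹ := by rw [zOf_neg, zOf_half]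

lemma theta_div_nome {q R : ℝ} (hq0 : 0 < q) (hq1 : q < 1) (hR : 0 < R) {z : ℂ} (hz : z ≠ 0) :
    Theta (nome q R) (z / nome q R) = -(z / nome q R) * Theta (nome q R) z := by
  have hp0 := nome_ne_zero hq0 R
  have := theta_mul_nome (norm_nome_lt_one hq0 hq1 hR) hp0 (div_ne_zero hz hp0)
  rw [mul_div_cancel₀ _ hp0] at this
  rw [this]
  field_simp

/-- The Gaussian prefactor is chosen to absorb the multiplier `z/p` of the theta function under `u ↦
u - R`; only a sign remains, and none for `[u]_+`, whose argument is `-z`. -/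
lemma cpow_quasi {q R : ℝ} (hq0 : 0 < q) (hR : 0 < R) (u : ℂ) :
    (q : ℂ) ^ ((u - R) ^ 2 / (R : ℂ) - (u - R)) * (zOf q u / nome q R) =
      (q : ℂ) ^ (u ^ 2 / (R : ℂ) - u) := by
  have hR' : (R : ℂ) ≠ 0 := ofReal_ne_zero_of_pos hR
  rw [← zOf_ofReal hq0, ← zOf_sub hq0, zOf, ← Complex.cpow_add _ _ (ofReal_ne_zero_of_pos hq0)]
  congr 1
  field_simp
  ring

lemma br_sub_nome {q R : ℝ} (hq0 : 0 < q) (hq1 : q < 1) (hR : 0 < R) (u : ℂ) :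
    br q R (u - R) = -br q R u := by
  rw [br, br, zOf_sub hq0, zOf_ofReal hq0, theta_div_nome hq0 hq1 hR (zOf_ne_zero hq0 u)]
  linear_combination (-Theta (nome q R) (zOf q u)) * cpow_quasi hq0 hR u

lemma brP_sub_nome {q R : ℝ} (hq0 : 0 < q) (hq1 : q < 1) (hR : 0 < R) (u : ℂ) :
    brP q R (u - R) = brP q R u := by
  rw [brP, brP, zOf_sub hq0, zOf_ofReal hq0, ← neg_div,
    theta_div_nome hq0 hq1 hR (neg_ne_zero.2 (zOf_ne_zero hq0 u))]
  linear_combination Theta (nome q R) (-zOf q u) * cpow_quasi hq0 hR u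

lemma differentiableAt_theta {p : ℂ} (hp : ‖p‖ < 1) {z : ℂ} (hz : z ≠ 0) :
    DifferentiableAt ℂ (Theta p) z := by
  unfold Theta
  have h1 : DifferentiableAt ℂ (fun z => poch (p * z⁻¹) p) z :=
    DifferentiableAt.comp z (differentiable_poch hp _)
      ((differentiableAt_id.inv hz).const_mul p)
  exact ((differentiable_poch hp z).mul h1).mul_const _

lemma differentiable_br {q R : ℝ} (hq0 : 0 < q) (hq1 : q < 1) (hR : 0 < R) :
    Differentiable ℂ (br q R) := by
  intro u
  refine DifferentiableAt.mul ?_ ?_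
  · exact ((differentiable_const_cpow hq0).comp
      (by fun_prop : Differentiable ℂ fun u : ℂ => u ^ 2 / (R : ℂ) - u)) u
  · exact DifferentiableAt.comp u (differentiableAt_theta (norm_nome_lt_one hq0 hq1 hR)
      (zOf_ne_zero hq0 u)) (differentiable_zOf hq0 u)

lemma differentiable_brP {q R : ℝ} (hq0 : 0 < q) (hq1 : q < 1) (hR : 0 < R) :
    Differentiable ℂ (brP q R) := by
  intro u
  refine DifferentiableAt.mul ?_ ?_
  · exact ((differentiable_const_cpow hq0).comp
      (by fun_prop : Differentiable ℂ fun u : ℂ => u ^ 2 / (R : ℂ) - u)) u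
  · exact DifferentiableAt.comp (f := fun u => -zOf q u) u
      (differentiableAt_theta (norm_nome_lt_one hq0 hq1 hR)
      (neg_ne_zero.2 (zOf_ne_zero hq0 u))) (differentiable_zOf hq0 u).neg

lemma br_ne_zero {q R : ℝ} (hq0 : 0 < q) (hq1 : q < 1) (hR : 0 < R) {u : ℂ}
    (h : ∀ k : ℤ, zOf q u ≠ (nome q R : ℂ) ^ k) : br q R u ≠ 0 := by
  refine mul_ne_zero ?_ (theta_ne_zero (norm_nome_lt_one hq0 hq1 hR) (nome_ne_zero hq0 R)
    (zOf_ne_zero hq0 u) h)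
  rw [Ne, Complex.cpow_eq_zero_iff]
  exact fun h => ofReal_ne_zero_of_pos hq0 h.1

/-- The zeros are the powers of the nome, and the open annulus `1 < |z| < p⁻¹` contains none. -/
lemma br_ne_zero_of_norm {q R : ℝ} (hq0 : 0 < q) (hq1 : q < 1) (hR : 0 < R) {u : ℂ}
    (h1 : 1 < ‖zOf q u‖) (h2 : nome q R * ‖zOf q u‖ < 1) : br q R u ≠ 0 := by
  have hp := nome_pos hq0 R
  have hp1 := nome_lt_one hq0 hq1 hR
  refine br_ne_zero hq0 hq1 hR fun k hk => ?_
  rw [hk, norm_zpow, norm_nome hq0] at h1 h2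
  rw [← zpow_one_add₀ hp.ne'] at h2
  rcases le_or_gt 0 k with hk | hk
  · exact absurd (zpow_le_one₀ hp hp1.le hk) (not_le.2 h1)
  · refine absurd (one_le_zpow_of_nonpos₀ hp hp1.le ?_) (not_le.2 h2)
    omega

lemma eventually_br_ne_zero {q R : ℝ} (hq0 : 0 < q) (hq1 : q < 1) (hR : 0 < R) (c : ℂ) :
    ∀ᶠ u in Filter.codiscrete ℂ, br q R (c - u) ≠ 0 := by
  have hd : Differentiable ℂ fun u => br q R (c - u) :=
    (differentiable_br hq0 hq1 hR).comp (by fun_prop)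
  -- The witness puts `|z|` at `p^{-1/2}`, strictly inside the zero-free annulus.
  refine eventually_codiscrete_ne_zero hd (x := c + ((R / 2 : ℝ) : ℂ)) ?_
  have hp := nome_pos hq0 (R / 2)
  have h1 : zOf q (c - (c + ((R / 2 : ℝ) : ℂ))) = ((nome q (R / 2))⁻¹ : ℝ) := by
    rw [sub_add_cancel_left, zOf_neg, zOf_ofReal hq0, Complex.ofReal_inv]
  have h2 : nome q R = nome q (R / 2) * nome q (R / 2) := by
    rw [nome, nome, ← Real.rpow_add hq0]; congr 1; ring
  have h3 := nome_lt_one hq0 hq1 (half_pos hR)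
  refine br_ne_zero_of_norm hq0 hq1 hR ?_ ?_
  · rw [h1, Complex.norm_real, Real.norm_of_nonneg (inv_pos.2 hp).le]
    exact (one_lt_inv₀ hp).2 h3
  · rw [h1, Complex.norm_real, Real.norm_of_nonneg (inv_pos.2 hp).le, h2,
      mul_inv_cancel_right₀ hp.ne']
    exact h3

/-! ### Contraction functions -/

/-- contraction of `Φ_-` with `F` (and of `Ψ*_-` with `E`) -/
def ctrA (Q p x : ℂ) : ℂ := poch (p * Q⁻¹ * x) p / poch (Q * x) p

/-- contraction of `F` with `F` (and of `E` with `E`) -/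
def ctrB (Q p x : ℂ) : ℂ :=
  (1 - x) * (poch (Q ^ 2 * x) p * poch (p * Q⁻¹ * x) p) /
    (poch (Q * x) p * poch (p * (Q ^ 2)⁻¹ * x) p)

/-- contraction of `K_-` with `Φ_-`; those of `Φ_-` with `K_-`, of `K_-` with `Ψ*_-` and of `Ψ*_-`
with `K_-` are expressed through it -/
def ctrK (q p x : ℂ) : ℂ :=
  (poch₂ (q ^ 2 * x) p (q ^ 6) * poch₂ (q ^ 3 * x) p (q ^ 6) ^ 2 * poch₂ (q ^ 4 * x) p (q ^ 6)) /
    (poch₂ x p (q ^ 6) * poch₂ (q * x) p (q ^ 6) * poch₂ (q ^ 5 * x) p (q ^ 6) *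
      poch₂ (q ^ 6 * x) p (q ^ 6))

/-- The factor `poch (Q * x) p` cancels, and both sides become `(pQ⁻¹x; p)(pQ⁻¹x⁻¹; p)(p; p)`,
symmetric under `x ↦ x⁻¹`. -/
lemma ctrA_mul_theta {Q p x : ℂ} (h1 : Theta p (Q * x) ≠ 0) (h2 : Theta p (Q * x⁻¹) ≠ 0) :
    ctrA Q p x * Theta p (Q * x) = ctrA Q p x⁻¹ * Theta p (Q * x⁻¹) := by
  have h1 := poch_ne_zero_of_theta h1
  have h2 := poch_ne_zero_of_theta h2
  have e1 : p * (Q * x)⁻¹ = p * Q⁻¹ * x⁻¹ := by rw [mul_inv]; ring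
  have e2 : p * (Q * x⁻¹)⁻¹ = p * Q⁻¹ * x := by rw [mul_inv, inv_inv]; ring
  rw [ctrA, ctrA, Theta, Theta, e1, e2, div_mul_eq_mul_div, div_mul_eq_mul_div,
    div_eq_div_iff h1 h2]
  ring

/-- the exchange relation of `Φ_-` and `F`, and of `Ψ*_-` and `E` -/
lemma br_mul_ctrA {q R : ℝ} (hq0 : 0 < q) (hq1 : q < 1) (hR : 0 < R) (s u : ℂ)
    (h1 : br q R (u - s) ≠ 0) (h2 : br q R (u + s) ≠ 0) :
    br q R (u - s) * (ctrA (zOf q s) (nome q R) (zOf q (-u)) * zpw q u (-1 + 2 * s / R)) =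
      -(br q R (u + s) * ctrA (zOf q s) (nome q R) (zOf q u)) := by
  have hR' : (R : ℂ) ≠ 0 := ofReal_ne_zero_of_pos hR
  have hz := zOf_ne_zero hq0 u
  have hQ := zOf_ne_zero hq0 s
  have hp := norm_nome_lt_one hq0 hq1 hR
  have e1 : zOf q (u - s) = (zOf q s * (zOf q u)⁻¹)⁻¹ := by
    rw [zOf_sub hq0, mul_inv, inv_inv]; field_simp
  have e2 : zOf q (u + s) = zOf q s * zOf q u := by rw [zOf_add hq0, mul_comm]
  have t1 := right_ne_zero_of_mul h1
  have t2 := right_ne_zero_of_mul h2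
  have hQx : zOf q s * (zOf q u)⁻¹ ≠ 0 := mul_ne_zero hQ (inv_ne_zero hz)
  rw [e1, theta_inv hp hQx] at t1
  rw [e2] at t2
  have key := ctrA_mul_theta (p := nome q R) (right_ne_zero_of_mul t1)
    (by rwa [inv_inv])
  rw [inv_inv] at key
  -- The zero-mode power `z^{-1 + 2s/R}` is exactly the quotient of the two Gaussian prefactors,
  -- once the factor from inverting the theta argument is included.
  have hexp : (q : ℂ) ^ ((u - s) ^ 2 / (R : ℂ) - (u - s)) * zpw q u (-1 + 2 * s / R) *
      (zOf q s * (zOf q u)⁻¹)⁻¹ = (q : ℂ) ^ ((u + s) ^ 2 / (R : ℂ) - (u + s)) := by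
    rw [← e1, zpw, zOf, ← Complex.cpow_add _ _ (ofReal_ne_zero_of_pos hq0),
      ← Complex.cpow_add _ _ (ofReal_ne_zero_of_pos hq0)]
    congr 1
    field_simp
    ring
  rw [br, br, e1, e2, theta_inv hp hQx, zOf_neg, ← hexp]
  linear_combination (-((q : ℂ) ^ ((u - s) ^ 2 / (R : ℂ) - (u - s)) * zpw q u (-1 + 2 * s / R) *
      (zOf q s * (zOf q u)⁻¹)⁻¹)) * key

/-- The factors with `z` form one contraction and those with `1/z` the inverse of another. This
identifies the scalar factor of the `R`-matrix with the exchange factor of `K_-`. -/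
lemma rhoPlus_eq (q R : ℝ) (u : ℂ) :
    rhoPlus q R u = -(q * zpw q u (1 / (R : ℂ))) * ctrK q (nome q R) (nome q R * zOf q u) /
      ctrK q (nome q R) (zOf q u)⁻¹ := by
  have e : ∀ c d : ℂ, poch₂ (c * (nome q R * zOf q u)) d = poch₂ (nome q R * c * zOf q u) d :=
    fun c d => by congr 1; ring
  simp only [rhoPlus, ctrK, e, div_eq_mul_inv, one_mul, mul_inv, inv_inv]
  ring

lemma differentiableAt_ctrA {Q p : ℂ} (hp : ‖p‖ < 1) {x : ℂ} (h : poch (Q * x) p ≠ 0) :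
    DifferentiableAt ℂ (ctrA Q p) x := by
  have hd : ∀ c : ℂ, Differentiable ℂ fun x => poch (c * x) p := fun c =>
    (differentiable_poch hp).comp (by fun_prop)
  exact (hd _ x).div (hd _ x) h

lemma differentiableAt_ctrB {Q p : ℂ} (hp : ‖p‖ < 1) {x : ℂ} (h : poch (Q * x) p ≠ 0)
    (h' : poch (p * (Q ^ 2)⁻¹ * x) p ≠ 0) : DifferentiableAt ℂ (ctrB Q p) x := by
  have hd : ∀ c : ℂ, Differentiable ℂ fun x => poch (c * x) p := fun c =>
    (differentiable_poch hp).comp (by fun_prop)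
  exact (((differentiableAt_const _).sub differentiableAt_id).mul ((hd _ x).mul (hd _ x))).div
    ((hd _ x).mul (hd _ x)) (mul_ne_zero h h')

lemma meromorphicAt_ctrA {Q p : ℂ} (hp : ‖p‖ < 1) (x : ℂ) : MeromorphicAt (ctrA Q p) x := by
  have hd : ∀ c : ℂ, MeromorphicAt (fun x => poch (c * x) p) x := fun c =>
    (Differentiable.analyticAt ((differentiable_poch hp).comp
      (by fun_prop : Differentiable ℂ fun x => c * x)) x).meromorphicAt
  exact (hd _).div (hd _)

lemma meromorphicAt_ctrK {q p : ℂ} (hq : ‖q‖ < 1) (hp : ‖p‖ < 1) (c x : ℂ) :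
    MeromorphicAt (fun x => ctrK q p (c * x)) x := by
  have hq6 : ‖q ^ 6‖ < 1 := by
    rw [norm_pow]; exact pow_lt_one₀ (norm_nonneg _) hq (by norm_num)
  have hd : ∀ d : ℂ, MeromorphicAt (fun x => poch₂ (d * (c * x)) p (q ^ 6)) x := fun d =>
    (Differentiable.analyticAt ((differentiable_poch₂ hp hq6).comp
      (by fun_prop : Differentiable ℂ fun x => d * (c * x))) x).meromorphicAt
  have h1 : MeromorphicAt (fun x => poch₂ (c * x) p (q ^ 6)) x := by simpa using hd 1
  unfold ctrK
  exact (((hd _).mul ((hd _).pow 2)).mul (hd _)).div (((h1.mul (hd _)).mul (hd _)).mul (hd _))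

/-- Every double product in `ctrK` is nonzero as soon as its argument is inside the unit disc, so a
single such point `y` suffices. -/
lemma eventually_ctrK_ne_zero {q p : ℂ} (hq : ‖q‖ < 1) (hp : ‖p‖ < 1) {f : ℂ → ℂ}
    (hf : Differentiable ℂ f) {y : ℂ} (hy : ‖f y‖ < 1) :
    ∀ᶠ u in Filter.codiscrete ℂ, ctrK q p (f u) ≠ 0 := by
  have hq6 : ‖q ^ 6‖ < 1 := by
    rw [norm_pow]; exact pow_lt_one₀ (norm_nonneg _) hq (by norm_num)
  have hd : ∀ n : ℕ, ∀ᶠ u in Filter.codiscrete ℂ, poch₂ (q ^ n * f u) p (q ^ 6) ≠ 0 := by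
    intro n
    refine eventually_codiscrete_ne_zero
      ((differentiable_poch₂ hp hq6).comp (hf.const_mul (q ^ n))) (x := y) ?_
    refine poch₂_ne_zero_of_norm_lt hp hq6 ?_
    rw [norm_mul, norm_pow]
    exact (mul_le_of_le_one_left (norm_nonneg _) (pow_le_one₀ (norm_nonneg _) hq.le)).trans_lt hy
  filter_upwards [hd 0, hd 1, hd 2, hd 3, hd 4, hd 5, hd 6] with u h0 h1 h2 h3 h4 h5 h6
  rw [pow_zero, one_mul] at h0
  rw [pow_one] at h1
  exact div_ne_zero (mul_ne_zero (mul_ne_zero h2 (pow_ne_zero 2 h3)) h4)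
    (mul_ne_zero (mul_ne_zero (mul_ne_zero h0 h1) h5) h6)

lemma exists_norm_zOf_lt {q : ℝ} (hq0 : 0 < q) (hq1 : q < 1) (c : ℂ) {ε : ℝ} (hε : 0 < ε) :
    ∃ u : ℂ, ‖c * zOf q u‖ < ε := by
  have h : Filter.Tendsto (fun n : ℕ => ‖c‖ * (q ^ 2) ^ n) Filter.atTop (nhds (‖c‖ * 0)) :=
    (tendsto_pow_atTop_nhds_zero_of_lt_one (by positivity) (by nlinarith)).const_mul _
  rw [mul_zero] at h
  obtain ⟨n, hn⟩ := (h.eventually (gt_mem_nhds hε)).exists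
  refine ⟨(n : ℂ), ?_⟩
  have : zOf q (n : ℂ) = (((q ^ 2) ^ n : ℝ) : ℂ) := by
    have h2 : (2 * (n : ℂ)) = ((2 * n : ℕ) : ℂ) := by push_cast; rfl
    rw [zOf, h2, Complex.cpow_natCast, pow_mul]
    push_cast
    rfl
  rw [this, norm_mul, Complex.norm_real, Real.norm_of_nonneg (by positivity)]
  exact hn


/-! ### The families `E`, `F`, `K_-`, `Φ_-`, `Ψ*_-` -/

/-- the family `E` -/
def famE (q r : ℝ) (s : ℂ) : Fam where
  γ := alphaCoef q r fun m => -((qnum q m : ℂ))⁻¹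
  δ := (1, -1)
  -- `e^{-Q}` acts before `e^α̂`, so the sign involves the initial value of `x.1`.
  κ := fun x => epsq q * (-1) ^ (-x.1)
  e := fun x => hval x / 2 + 1 / 2 + -(Pval s x - 1 / 2) / ((r : ℂ) - 1)

/-- the family `F` -/
def famF (q r : ℝ) (s : ℂ) : Fam where
  γ := betaCoef q r fun m => ((qnum q m : ℂ))⁻¹
  δ := (-1, 0)
  κ := fun _ => epsq q
  e := fun x => -hval x / 2 + 1 / 2 + ((Pval s x - 1 / 2) / (r : ℂ) + hval x / (2 * (r : ℂ)))

/-- the family `K_-`, as a function of `q^(r+1) z` -/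
def famK (q r : ℝ) (s : ℂ) : Fam where
  γ := alphaCoef q r fun m =>
    ((qnum q m / (qnum q (r * m) * (qnum q (2 * m) - qnum q m)) : ℝ) : ℂ)
  δ := (0, 1)
  κ := fun x => ((Real.exp (-∑' m : ℕ+, qnum q (m : ℝ) ^ 3 /
      ((m : ℝ) * qnum q (r * (m : ℝ)) * qnum q ((r - 1) * (m : ℝ)) *
        (qnum q (2 * (m : ℝ)) - qnum q (m : ℝ)))) : ℝ) : ℂ) * (-1) ^ x.1
  -- The power of `z` stands to the left of `e^Q`, hence is evaluated at `P + 1`.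
  e := fun x => -((1 / (r : ℂ) - 1 / ((r : ℂ) - 1)) * (Pval s x + 1 - 1 / 2) +
    hval x / (2 * (r : ℂ)))

/-- the family `Φ_-` -/
def famPhi (q r : ℝ) (s : ℂ) : Fam where
  γ := betaCoef q r fun m => -(((qnum q (2 * m) - qnum q m : ℝ) : ℂ))⁻¹
  δ := (1, 0)
  κ := fun _ => 1
  e := fun x => hval x / 2 + 1 / 2 +
    (-Pval s x / (r : ℂ) - hval x / (2 * (r : ℂ)) - 1 / (r : ℂ))

/-- the family `Ψ*_-` -/
def famPsi (q r : ℝ) (s : ℂ) : Fam where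
  γ := alphaCoef q r fun m => (((qnum q (2 * m) - qnum q m : ℝ) : ℂ))⁻¹
  δ := (-1, 1)
  κ := fun x => (-1) ^ x.1
  e := fun x => -hval x / 2 + 1 / 2 + (Pval s x / ((r : ℂ) - 1) + 1 / ((r : ℂ) - 1))

lemma eAlpha_single (k : ℤ) (x : ℤ × ℤ) (c : ℂ) :
    eAlpha k (Finsupp.single x c) = Finsupp.single (x.1 + k, x.2) c := by
  simp [eAlpha, Finsupp.lmapDomain_apply, Finsupp.mapDomain_single]

lemma eQ_single (k : ℤ) (x : ℤ × ℤ) (c : ℂ) :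
    eQ k (Finsupp.single x c) = Finsupp.single (x.1, x.2 + k) (c * (-1) ^ (x.1 * k)) := by
  simp [eQ, Finsupp.linearCombination_single]

lemma zdiag_single (s : ℂ) (g : ℂ → ℂ → ℂ) (x : ℤ × ℤ) (c : ℂ) :
    zdiag s g (Finsupp.single x c) = Finsupp.single x (c * g (hval x) (Pval s x)) := by
  simp [zdiag, Finsupp.linearCombination_single]

lemma alphaCoef_mul (q r : ℝ) (c z : ℤ → ℂ) (m : ℤ) :
    alphaCoef q r (fun m => c m * z m) m = alphaCoef q r c m * z m := by
  simp only [alphaCoef]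
  split_ifs <;> ring

lemma betaCoef_mul (q r : ℝ) (c z : ℤ → ℂ) (m : ℤ) :
    betaCoef q r (fun m => c m * z m) m = betaCoef q r c m * z m := by
  simp only [betaCoef, alphaCoef]
  split_ifs <;> ring

lemma smul_vertexOp_eq_op {q : ℝ} (X : Fam) (u a : ℂ) {c : ℤ → ℂ} {Z : ZeroOp}
    {g : ℤ × ℤ → ℂ} (hc : ∀ m, c m = X.coef q u m)
    (hZ : ∀ x, Z (Finsupp.single x 1) = Finsupp.single (x + X.δ) (g x))
    (hg : ∀ x, a * g x = X.zm q u x) : a • vertexOp q c Z = X.op q u := by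
  rw [vertexOp_eq_vop q c hZ, smul_vop, funext hg, funext hc, Fam.op]

lemma curE_eq_op {q : ℝ} (hq0 : 0 < q) (r : ℝ) (s : ℂ) : curE q r s = (famE q r s).op q := by
  funext u
  refine smul_vertexOp_eq_op (famE q r s) u _ (g := fun x => (-1) ^ (-x.1) *
    zpw q u ((famE q r s).e x)) (fun m => ?_) (fun x => ?_) fun x => ?_
  · exact (congrArg (fun c => alphaCoef q r c m) (funext fun m => by ring)).trans
      (alphaCoef_mul q r _ (fun m => zpw q u (-(m : ℂ))) m)
  · simp only [Module.End.mul_apply, zdiag_single, eQ_single, eAlpha_single, famE, zpw_add hq0]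
    refine congrArg₂ Finsupp.single rfl ?_
    rw [mul_neg_one]
    simp only [hval]
    ring
  · simp only [Fam.zm, famE]; ring

lemma curF_eq_op {q : ℝ} (hq0 : 0 < q) (r : ℝ) (s : ℂ) : curF q r s = (famF q r s).op q := by
  funext u
  refine smul_vertexOp_eq_op (famF q r s) u _ (g := fun x =>
    zpw q u ((famF q r s).e x)) (fun m => ?_) (fun x => ?_) fun x => ?_
  · exact (congrArg (fun c => betaCoef q r c m) (funext fun m => by ring)).trans
      (betaCoef_mul q r _ (fun m => zpw q u (-(m : ℂ))) m)
  · simp only [Module.End.mul_apply, zdiag_single, eAlpha_single, famF, zpw_add hq0]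
    refine congrArg₂ Finsupp.single (Prod.ext rfl (add_zero _).symm) ?_
    ring
  · simp only [Fam.zm, famF]

lemma curKm_eq_op {q : ℝ} (r : ℝ) (s u : ℂ) :
    curKm q r s u = (famK q r s).op q (u + ((r : ℂ) + 1) / 2) := by
  refine smul_vertexOp_eq_op (famK q r s) _ _ (g := fun x => (-1) ^ x.1 *
    zpw q (u + ((r : ℂ) + 1) / 2) ((famK q r s).e x)) (fun m => ?_) (fun x => ?_) fun x => ?_
  · exact alphaCoef_mul q r _ (fun m => zpw q _ (-(m : ℂ))) m
  · simp only [Module.End.mul_apply, zdiag_single, eQ_single, famK]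
    refine congrArg₂ Finsupp.single (Prod.ext (add_zero _).symm rfl) ?_
    rw [mul_one, one_mul]
    simp only [hval, Pval]
    push_cast
    rw [add_assoc s]
  · simp only [Fam.zm, famK]; ring

lemma PhiMinus_eq_op {q : ℝ} (hq0 : 0 < q) (r : ℝ) (s : ℂ) :
    PhiMinus q r s = (famPhi q r s).op q := by
  funext u
  rw [← one_smul ℂ (PhiMinus q r s u)]
  refine smul_vertexOp_eq_op (famPhi q r s) u _ (g := fun x =>
    zpw q u ((famPhi q r s).e x)) (fun m => ?_) (fun x => ?_) fun x => ?_
  · exact (congrArg (fun c => betaCoef q r c m) (funext fun m => by ring)).trans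
      (betaCoef_mul q r _ (fun m => zpw q u (-(m : ℂ))) m)
  · simp only [Module.End.mul_apply, zdiag_single, eAlpha_single, famPhi, zpw_add hq0]
    refine congrArg₂ Finsupp.single (Prod.ext rfl (add_zero _).symm) ?_
    ring
  · simp only [Fam.zm, famPhi]

lemma PsiMinus_eq_op {q : ℝ} (hq0 : 0 < q) (r : ℝ) (s : ℂ) :
    PsiMinus q r s = (famPsi q r s).op q := by
  funext u
  rw [← one_smul ℂ (PsiMinus q r s u)]
  refine smul_vertexOp_eq_op (famPsi q r s) u _ (g := fun x => (-1) ^ x.1 *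
    zpw q u ((famPsi q r s).e x)) (fun m => ?_) (fun x => ?_) fun x => ?_
  · exact (congrArg (fun c => alphaCoef q r c m) (funext fun m => by ring)).trans
      (alphaCoef_mul q r _ (fun m => zpw q u (-(m : ℂ))) m)
  · simp only [Module.End.mul_apply, zdiag_single, eQ_single, eAlpha_single, famPsi, zpw_add hq0]
    refine congrArg₂ Finsupp.single rfl ?_
    rw [mul_one]
    simp only [hval]
    ring
  · simp only [Fam.zm, famPsi]; ring


/-! ### Oscillator coefficients -/

lemma qnum_neg (q x : ℝ) : qnum q (-x) = -qnum q x := by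
  simp only [qnum, neg_neg]; ring

lemma alphaCoef_pnat (q r : ℝ) (c : ℤ → ℂ) (m : ℕ+) : alphaCoef q r c (m : ℤ) = c (m : ℤ) := by
  rw [alphaCoef, if_pos (by exact_mod_cast m.pos)]

lemma alphaCoef_neg_pnat (q r : ℝ) (c : ℤ → ℂ) (m : ℕ+) :
    alphaCoef q r c (-(m : ℤ)) =
      c (-(m : ℤ)) * ((qnum q (r * m) / qnum q ((r - 1) * m) * q ^ (m : ℝ) : ℝ) : ℂ) := by
  have h : ¬ (0 : ℤ) < -(m : ℤ) := by
    have := m.pos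
    omega
  have h2 : |((-(m : ℤ) : ℤ) : ℝ)| = (m : ℝ) := by
    push_cast
    rw [abs_neg, abs_of_nonneg (by positivity)]
  rw [alphaCoef, if_neg h, h2]
  push_cast
  simp only [mul_neg, qnum_neg]
  push_cast
  rw [neg_div_neg_eq]

section

variable {q r : ℝ} (s : ℂ) (m : ℕ+)

lemma famE_pnat : (famE q r s).γ (m : ℤ) = ((-(qnum q m)⁻¹ : ℝ) : ℂ) := by
  simp [famE, alphaCoef_pnat]

lemma famE_neg_pnat : (famE q r s).γ (-(m : ℤ)) =
    (((qnum q m)⁻¹ * (qnum q (r * m) / qnum q ((r - 1) * m) * q ^ (m : ℝ)) : ℝ) : ℂ) := by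
  simp [famE, alphaCoef_neg_pnat, qnum_neg]

lemma famF_pnat : (famF q r s).γ (m : ℤ) =
    (((qnum q m)⁻¹ * (qnum q ((r - 1) * m) / qnum q (r * m)) : ℝ) : ℂ) := by
  simp [famF, betaCoef, alphaCoef_pnat]

lemma famF_neg_pnat : (famF q r s).γ (-(m : ℤ)) =
    ((-(qnum q m)⁻¹ * (qnum q ((r - 1) * m) / qnum q (r * m)) *
      (qnum q (r * m) / qnum q ((r - 1) * m) * q ^ (m : ℝ)) : ℝ) : ℂ) := by
  simp [famF, betaCoef, alphaCoef_neg_pnat, qnum_neg]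

lemma famPhi_pnat : (famPhi q r s).γ (m : ℤ) =
    ((-(qnum q (2 * m) - qnum q m)⁻¹ * (qnum q ((r - 1) * m) / qnum q (r * m)) : ℝ) : ℂ) := by
  simp [famPhi, betaCoef, alphaCoef_pnat]

lemma famPhi_neg_pnat : (famPhi q r s).γ (-(m : ℤ)) =
    (((qnum q (2 * m) - qnum q m)⁻¹ * (qnum q ((r - 1) * m) / qnum q (r * m)) *
      (qnum q (r * m) / qnum q ((r - 1) * m) * q ^ (m : ℝ)) : ℝ) : ℂ) := by
  simp [famPhi, betaCoef, alphaCoef_neg_pnat, qnum_neg, ← inv_neg, neg_add_eq_sub]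

lemma famPsi_pnat : (famPsi q r s).γ (m : ℤ) = (((qnum q (2 * m) - qnum q m)⁻¹ : ℝ) : ℂ) := by
  simp [famPsi, alphaCoef_pnat]

lemma famPsi_neg_pnat : (famPsi q r s).γ (-(m : ℤ)) =
    ((-(qnum q (2 * m) - qnum q m)⁻¹ *
      (qnum q (r * m) / qnum q ((r - 1) * m) * q ^ (m : ℝ)) : ℝ) : ℂ) := by
  simp [famPsi, alphaCoef_neg_pnat, qnum_neg, ← inv_neg, neg_add_eq_sub]

lemma famK_pnat : (famK q r s).γ (m : ℤ) =
    ((qnum q m / (qnum q (r * m) * (qnum q (2 * m) - qnum q m)) : ℝ) : ℂ) := by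
  simp [famK, alphaCoef_pnat]

lemma famK_neg_pnat : (famK q r s).γ (-(m : ℤ)) =
    ((-(qnum q m / (qnum q (r * m) * (qnum q (2 * m) - qnum q m))) *
      (qnum q (r * m) / qnum q ((r - 1) * m) * q ^ (m : ℝ)) : ℝ) : ℂ) := by
  simp only [famK, alphaCoef_neg_pnat]
  push_cast
  simp only [mul_neg, qnum_neg]
  push_cast
  rw [show -(qnum q (2 * m) : ℂ) - -(qnum q m : ℂ) = -((qnum q (2 * m) : ℂ) - (qnum q m : ℂ)) by
    ring, neg_mul_neg, neg_div]

end

/-! ### Identities between `q`-numbers -/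

section

variable {q r : ℝ}

lemma rpow_mul_pnat (R : ℝ) (m : ℕ+) (hq0 : 0 < q) : q ^ (R * (m : ℝ)) = (q ^ R) ^ (m : ℕ) := by
  rw [Real.rpow_mul hq0.le, Real.rpow_natCast]

lemma nome_pow (R : ℝ) (m : ℕ+) (hq0 : 0 < q) :
    nome q R ^ (m : ℕ) = (q ^ R) ^ (m : ℕ) * (q ^ R) ^ (m : ℕ) := by
  rw [nome, two_mul, Real.rpow_add hq0, mul_pow]

lemma qnum_mul_pnat (R : ℝ) (m : ℕ+) (hq0 : 0 < q) : qnum q (R * m) =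
    ((q ^ R) ^ (m : ℕ) - ((q ^ R) ^ (m : ℕ))⁻¹) / (q - q⁻¹) := by
  rw [qnum, Real.rpow_neg hq0.le, rpow_mul_pnat R m hq0]

lemma qnum_pnat (m : ℕ+) (hq0 : 0 < q) : qnum q m =
    (q ^ (m : ℕ) - (q ^ (m : ℕ))⁻¹) / (q - q⁻¹) := by
  simpa using qnum_mul_pnat 1 m hq0

lemma sub_inv_ne_zero (hq0 : 0 < q) (hq1 : q < 1) : q - q⁻¹ ≠ 0 :=
  (sub_neg.2 (hq1.trans ((one_lt_inv₀ hq0).2 hq1))).ne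

/-- In this form, divided by `m`, the ratio is the `m`-th coefficient of `log (ctrA q p x)`. -/
lemma qnum_div_typeI (hq0 : 0 < q) (hq1 : q < 1) (hr : 0 < r) (m : ℕ+) :
    qnum q ((r - 1) * m) / qnum q (r * m) =
      (q ^ (m : ℕ) - nome q r ^ (m : ℕ) * (q ^ (m : ℕ))⁻¹) / (1 - nome q r ^ (m : ℕ)) := by
  have h1 : nome q r ^ (m : ℕ) < 1 :=
    pow_lt_one₀ (nome_pos hq0 r).le (nome_lt_one hq0 hq1 hr) m.pos.ne'
  rw [qnum_mul_pnat _ m hq0, qnum_mul_pnat _ m hq0, div_div_div_cancel_right₀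
    (sub_inv_ne_zero hq0 hq1), Real.rpow_sub hq0, Real.rpow_one, div_pow]
  rw [nome_pow r m hq0] at h1 ⊢
  have hT : 0 < (q ^ r) ^ (m : ℕ) := by positivity
  have ht : 0 < q ^ (m : ℕ) := by positivity
  generalize (q ^ r) ^ (m : ℕ) = T at *
  generalize q ^ (m : ℕ) = t at *
  have h2 : 1 - T * T ≠ 0 := by linarith
  have h3 : T - T⁻¹ ≠ 0 := fun h => h2 (by field_simp at h; linarith)
  rw [div_eq_div_iff h3 h2]
  field_simp
  ring

/-- The inverse ratio has the same form with `q` replaced by `q⁻¹` and the nome by `p*`; this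
symmetry produces the type-II side. -/
lemma qnum_div_typeII (hq0 : 0 < q) (hq1 : q < 1) (hr : 0 < r - 1) (m : ℕ+) :
    qnum q (r * m) / qnum q ((r - 1) * m) =
      ((q ^ (m : ℕ))⁻¹ - nome q (r - 1) ^ (m : ℕ) * q ^ (m : ℕ)) /
        (1 - nome q (r - 1) ^ (m : ℕ)) := by
  have h1 : nome q (r - 1) ^ (m : ℕ) < 1 :=
    pow_lt_one₀ (nome_pos hq0 _).le (nome_lt_one hq0 hq1 hr) m.pos.ne'
  have h0 : q ^ r = q ^ (r - 1) * q := by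
    rw [Real.rpow_sub hq0, Real.rpow_one, div_mul_cancel₀ _ hq0.ne']
  rw [qnum_mul_pnat _ m hq0, qnum_mul_pnat _ m hq0, div_div_div_cancel_right₀
    (sub_inv_ne_zero hq0 hq1), h0, mul_pow]
  rw [nome_pow (r - 1) m hq0] at h1 ⊢
  have hT : 0 < (q ^ (r - 1)) ^ (m : ℕ) := by positivity
  have ht : 0 < q ^ (m : ℕ) := by positivity
  generalize (q ^ (r - 1)) ^ (m : ℕ) = T at *
  generalize q ^ (m : ℕ) = t at *
  have h2 : 1 - T * T ≠ 0 := by linarith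
  have h3 : T - T⁻¹ ≠ 0 := fun h => h2 (by field_simp at h; linarith)
  rw [div_eq_div_iff h3 h2]
  field_simp
  ring

lemma qnum_two_mul_sub (hq0 : 0 < q) (m : ℕ+) :
    qnum q (2 * m) - qnum q m = qnum q m * (q ^ (m : ℕ) + (q ^ (m : ℕ))⁻¹ - 1) := by
  have h0 : q ^ (2 : ℝ) = q * q := by rw [Real.rpow_two, sq]
  rw [qnum_mul_pnat _ m hq0, qnum_pnat m hq0, h0, mul_pow]
  have ht : 0 < q ^ (m : ℕ) := by positivity
  generalize q ^ (m : ℕ) = t at *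
  field_simp
  ring

/-- The denominator contains `1 - t + t²` with `t = q^m`. Completing it to `1 - t⁶` introduces the
second base `q⁶`, and the numerator becomes `(1 - t²)²(1 + t + t²)`. -/
lemma qnum_sq_div (hq0 : 0 < q) (hq1 : q < 1) {R : ℝ} (hR : 0 < R) (m : ℕ+) :
    qnum q m ^ 2 / (qnum q (R * m) * (qnum q (2 * m) - qnum q m)) =
      nome q (R / 2) ^ (m : ℕ) * (1 + q ^ (m : ℕ) - (q ^ (m : ℕ)) ^ 2 - 2 * (q ^ (m : ℕ)) ^ 3 -
        (q ^ (m : ℕ)) ^ 4 + (q ^ (m : ℕ)) ^ 5 + (q ^ (m : ℕ)) ^ 6) /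
        ((1 - nome q R ^ (m : ℕ)) * (1 - (q ^ (m : ℕ)) ^ 6)) := by
  have h1 : nome q R ^ (m : ℕ) < 1 :=
    pow_lt_one₀ (nome_pos hq0 R).le (nome_lt_one hq0 hq1 hR) m.pos.ne'
  have h4 : q ^ (m : ℕ) < 1 := pow_lt_one₀ hq0.le hq1 m.pos.ne'
  have h5 : nome q (R / 2) = q ^ R := by rw [nome]; congr 1; ring
  have hqq := sub_inv_ne_zero hq0 hq1
  rw [qnum_two_mul_sub hq0, qnum_mul_pnat _ m hq0, qnum_pnat m hq0, h5]
  rw [nome_pow R m hq0] at h1 ⊢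
  have hT : 0 < (q ^ R) ^ (m : ℕ) := by positivity
  have ht : 0 < q ^ (m : ℕ) := by positivity
  generalize q - q⁻¹ = D at *
  generalize (q ^ R) ^ (m : ℕ) = T at *
  generalize q ^ (m : ℕ) = t at *
  have h2 : 1 - T * T ≠ 0 := by linarith
  have h3 : T - T⁻¹ ≠ 0 := fun h => h2 (by field_simp at h; linarith)
  have h6 : 1 - t ^ 6 ≠ 0 := (sub_pos.2 (pow_lt_one₀ ht.le h4 (by norm_num))).ne'
  have h7 : t - t⁻¹ ≠ 0 := (sub_neg.2 (h4.trans ((one_lt_inv₀ ht).2 h4))).ne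
  have h8 : t + t⁻¹ - 1 ≠ 0 := by
    have := (one_lt_inv₀ ht).2 h4
    linarith
  have e1 : ((t - t⁻¹) / D) ^ 2 / ((T - T⁻¹) / D * ((t - t⁻¹) / D * (t + t⁻¹ - 1))) =
      (t - t⁻¹) / ((T - T⁻¹) * (t + t⁻¹ - 1)) := by
    field_simp
  rw [e1, div_eq_div_iff (mul_ne_zero h3 h8) (mul_ne_zero h2 h6)]
  field_simp
  ring

end


/-! ### Contractions -/

lemma Fam.HasCtr.of_expSum {q : ℝ} {X Y : Fam} {ρ : ℝ} {G : ℂ → ℂ} (hρ : 0 < ρ) (c : ℕ+ → ℝ)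
    (hc : ∀ m : ℕ+, X.γ m * (heis q m : ℂ) * Y.γ (-(m : ℤ)) = (c m : ℂ))
    (h : ∀ x : ℂ, ‖x‖ < ρ → ExpSum (fun m => (c m : ℂ) * x ^ (m : ℕ)) (G x)) :
    Fam.HasCtr q X Y ρ G := by
  refine ⟨hρ, fun x hx => ?_, fun x hx => ?_⟩
  · simpa only [hc] using (h x hx).1
  · simpa only [hc] using (h x hx).2

/-- Shifting the two arguments by `a` and `b` rescales `z₂/z₁` by `q^{2(b - a)}`. -/
lemma Fam.HasCtr.shift {q : ℝ} (hq0 : 0 < q) {X Y : Fam} {ρ ρ' : ℝ} {G G' : ℂ → ℂ}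
    (h : Fam.HasCtr q X Y ρ G) (a b : ℂ) (hρ' : 0 < ρ') (hρ : ‖zOf q (b - a)‖ * ρ' ≤ ρ)
    (hG : ∀ x, G (zOf q (b - a) * x) = G' x) :
    Fam.HasCtr q (X.shift q a) (Y.shift q b) ρ' G' := by
  have hc : ∀ (x : ℂ) (m : ℕ+), (X.shift q a).γ m * (heis q m : ℂ) *
      (Y.shift q b).γ (-(m : ℤ)) * x ^ (m : ℕ) =
      X.γ m * (heis q m : ℂ) * Y.γ (-(m : ℤ)) * (zOf q (b - a) * x) ^ (m : ℕ) := fun x m => by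
    have := Fam.coef_mul_coef hq0 X Y a b m
    simp only [Fam.coef] at this
    simp only [Fam.shift]
    rw [this]; ring
  have hx : ∀ x : ℂ, ‖x‖ < ρ' → ‖zOf q (b - a) * x‖ < ρ := fun x hx => by
    rw [norm_mul]
    exact (mul_lt_mul_of_pos_left hx (norm_zOf_pos hq0 _)).trans_le hρ
  refine ⟨hρ', fun x h' => ?_, fun x h' => ?_⟩
  · simpa only [hc] using h.summable _ (hx x h')
  · simpa only [hc, hG] using h.exp_eq _ (hx x h')

lemma expSum_ctrA {Q p x : ℂ} (hp : ‖p‖ < 1) (h1 : ‖Q * x‖ < 1) (h2 : ‖p * Q⁻¹ * x‖ < 1) :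
    ExpSum (fun m => (Q ^ (m : ℕ) - p ^ (m : ℕ) * (Q⁻¹) ^ (m : ℕ)) / (1 - p ^ (m : ℕ)) /
      ((m : ℕ) : ℂ) * x ^ (m : ℕ)) (ctrA Q p x) := by
  refine ((expSum_poch h2 hp).add (expSum_poch h1 hp).neg).congr (fun m => ?_) ?_
  · simp only [mul_pow]
    rw [mul_comm ((m : ℕ) : ℂ), ← div_div, ← div_div]; ring
  · rw [ctrA, div_eq_mul_inv]

/-- With `Q`, `P` standing for `m`-th powers, `(Q - P/Q)(Q + 1/Q - 1)` equals `(1 - P) + Q² - Q -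
P/Q² + P/Q`. After division by `1 - P` the five terms give `1 - x` and the four products. -/
lemma expSum_ctrB {Q p x : ℂ} (hQ : Q ≠ 0) (hp : ‖p‖ < 1) (h0 : ‖x‖ < 1) (h1 : ‖Q * x‖ < 1)
    (h2 : ‖p * Q⁻¹ * x‖ < 1) (h3 : ‖Q ^ 2 * x‖ < 1) (h4 : ‖p * (Q ^ 2)⁻¹ * x‖ < 1) :
    ExpSum (fun m => -((Q ^ (m : ℕ) - p ^ (m : ℕ) * (Q⁻¹) ^ (m : ℕ)) / (1 - p ^ (m : ℕ)) *
      (Q ^ (m : ℕ) + (Q⁻¹) ^ (m : ℕ) - 1)) / ((m : ℕ) : ℂ) * x ^ (m : ℕ)) (ctrB Q p x) := by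
  refine (((expSum_one_sub h0).add ((expSum_poch h3 hp).add (expSum_poch h2 hp))).add
    ((expSum_poch h1 hp).add (expSum_poch h4 hp)).neg).congr (fun m => ?_) ?_
  · have hpm : 1 - p ^ (m : ℕ) ≠ 0 := by
      refine sub_ne_zero.2 fun h => ?_
      have : ‖p ^ (m : ℕ)‖ < 1 := by
        rw [norm_pow]; exact pow_lt_one₀ (norm_nonneg _) hp m.pos.ne'
      simp [← h] at this
    have hm : ((m : ℕ) : ℂ) ≠ 0 := by exact_mod_cast m.pos.ne'
    have hQm : Q ^ (m : ℕ) ≠ 0 := pow_ne_zero _ hQ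
    simp only [mul_pow, inv_pow, ← pow_mul, mul_comm 2 (m : ℕ)]
    simp only [pow_mul]
    generalize p ^ (m : ℕ) = P at *
    generalize Q ^ (m : ℕ) = T at *
    field_simp
    ring
  · rw [ctrB, div_eq_mul_inv]

lemma norm_pow_mul_lt {q : ℝ} (hq0 : 0 < q) (hq1 : q < 1) {x : ℂ} (hx : ‖x‖ < 1) (n : ℕ) :
    ‖(q : ℂ) ^ n * x‖ < 1 := by
  rw [norm_mul, norm_pow, Complex.norm_real, Real.norm_of_nonneg hq0.le]
  exact (mul_le_of_le_one_left (norm_nonneg _) (pow_le_one₀ hq0.le hq1.le)).trans_lt hx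

lemma expSum_ctrK {q : ℝ} (hq0 : 0 < q) (hq1 : q < 1) {p x : ℂ} (hp : ‖p‖ < 1) (hx : ‖x‖ < 1) :
    ExpSum (fun m => (1 + (q : ℂ) ^ (m : ℕ) - ((q : ℂ) ^ (m : ℕ)) ^ 2 -
        2 * ((q : ℂ) ^ (m : ℕ)) ^ 3 - ((q : ℂ) ^ (m : ℕ)) ^ 4 + ((q : ℂ) ^ (m : ℕ)) ^ 5 +
        ((q : ℂ) ^ (m : ℕ)) ^ 6) / ((1 - p ^ (m : ℕ)) * (1 - ((q : ℂ) ^ (m : ℕ)) ^ 6)) /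
      ((m : ℕ) : ℂ) * x ^ (m : ℕ)) (ctrK q p x) := by
  have hq6 : ‖(q : ℂ) ^ 6‖ < 1 := by
    rw [norm_pow, Complex.norm_real, Real.norm_of_nonneg hq0.le]
    exact pow_lt_one₀ hq0.le hq1 (by norm_num)
  have H := fun n => expSum_poch₂ (norm_pow_mul_lt hq0 hq1 hx n) hp hq6
  have h0 := expSum_poch₂ hx hp hq6
  have h1 := H 1
  rw [pow_one] at h1
  refine ((((H 2).add ((H 3).add (H 3))).add (H 4)).add
    (((h0.add h1).add (H 5)).add (H 6)).neg).congr (fun m => ?_) ?_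
  · simp only [mul_pow, ← pow_mul, mul_comm _ (m : ℕ)]
    simp only [pow_mul]
    generalize (1 - p ^ (m : ℕ)) * (1 - ((q : ℂ) ^ (m : ℕ)) ^ 6) = D
    ring
  · rw [ctrK, div_eq_mul_inv, sq (poch₂ _ _ _)]

lemma heis_eq {q : ℝ} (hq0 : 0 < q) (m : ℕ+) :
    heis q m = (qnum q (2 * m) - qnum q m) * qnum q m / (m * q ^ (m : ℝ)) := by
  rw [heis, Real.rpow_neg hq0.le]
  field_simp

lemma qnum_facts {q r : ℝ} (hq0 : 0 < q) (hq1 : q < 1) (hr : 1 < r) (m : ℕ+) :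
    qnum q m ≠ 0 ∧ qnum q (2 * m) - qnum q m ≠ 0 ∧ qnum q (r * m) ≠ 0 ∧
      qnum q ((r - 1) * m) ≠ 0 ∧ q ^ (m : ℝ) ≠ 0 ∧ (m : ℝ) ≠ 0 := by
  have hm : (0 : ℝ) < m := by exact_mod_cast m.pos
  refine ⟨(qnum_pos hq0 hq1 hm).ne', (sub_pos.2 (qnum_lt_qnum hq0 hq1 (by linarith))).ne',
    (qnum_pos hq0 hq1 (mul_pos (by linarith) hm)).ne',
    (qnum_pos hq0 hq1 (mul_pos (by linarith) hm)).ne', (Real.rpow_pos_of_pos hq0 _).ne', hm.ne'⟩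

/-! ### Contraction series for the two nomes -/

section

variable {q r : ℝ}

lemma nome_lt_sq (hq0 : 0 < q) (hq1 : q < 1) (hr : 1 < r) : nome q r < q ^ 2 := by
  rw [nome, ← Real.rpow_two]
  exact Real.rpow_lt_rpow_of_exponent_gt hq0 hq1 (by linarith)

lemma norm_ofReal_mul {a : ℝ} (ha : 0 ≤ a) (x : ℂ) : ‖(a : ℂ) * x‖ = a * ‖x‖ := by
  rw [norm_mul, Complex.norm_real, Real.norm_of_nonneg ha]

/-- The radius is set by the pole at `q⁻¹`; the first zero, at `q p⁻¹`, is farther away because `p <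
q²`. -/
lemma expSum_ctrA_typeI (hq0 : 0 < q) (hq1 : q < 1) (hr : 1 < r) {x : ℂ} (hx : ‖x‖ < q⁻¹) :
    ExpSum (fun m => ((qnum q ((r - 1) * m) / qnum q (r * m) / m : ℝ) : ℂ) * x ^ (m : ℕ))
      (ctrA q (nome q r) x) := by
  have hp := nome_lt_sq hq0 hq1 hr
  have hp0 := nome_pos hq0 r
  have h1 : ‖(q : ℂ) * x‖ < 1 := by
    rw [norm_ofReal_mul hq0.le]
    calc q * ‖x‖ < q * q⁻¹ := mul_lt_mul_of_pos_left hx hq0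
      _ = 1 := mul_inv_cancel₀ hq0.ne'
  have h2 : ‖(nome q r : ℂ) * (q : ℂ)⁻¹ * x‖ < 1 := by
    rw [← Complex.ofReal_inv, ← Complex.ofReal_mul, norm_ofReal_mul (by positivity)]
    calc nome q r * q⁻¹ * ‖x‖ ≤ nome q r * q⁻¹ * q⁻¹ := by gcongr
      _ < q ^ 2 * q⁻¹ * q⁻¹ := by gcongr
      _ = 1 := by field_simp
  refine (expSum_ctrA (norm_nome_lt_one hq0 hq1 (by linarith)) h1 h2).congr (fun m => ?_) rfl
  rw [qnum_div_typeI hq0 hq1 (by linarith)]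
  push_cast
  rw [inv_pow]

lemma expSum_ctrA_typeII (hq0 : 0 < q) (hq1 : q < 1) (hr : 1 < r) {x : ℂ} (hx : ‖x‖ < q) :
    ExpSum (fun m => ((qnum q (r * m) / qnum q ((r - 1) * m) / m : ℝ) : ℂ) * x ^ (m : ℕ))
      (ctrA (q : ℂ)⁻¹ (nome q (r - 1)) x) := by
  have hp := nome_lt_one hq0 hq1 (sub_pos.2 hr)
  have hp0 := nome_pos hq0 (r - 1)
  have h1 : ‖(q : ℂ)⁻¹ * x‖ < 1 := by
    rw [← Complex.ofReal_inv, norm_ofReal_mul (by positivity)]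
    calc q⁻¹ * ‖x‖ < q⁻¹ * q := by gcongr
      _ = 1 := inv_mul_cancel₀ hq0.ne'
  have h2 : ‖(nome q (r - 1) : ℂ) * ((q : ℂ)⁻¹)⁻¹ * x‖ < 1 := by
    rw [inv_inv, ← Complex.ofReal_mul, norm_ofReal_mul (by positivity)]
    calc nome q (r - 1) * q * ‖x‖ ≤ 1 * 1 * ‖x‖ := by gcongr
      _ < 1 := by linarith
  refine (expSum_ctrA (norm_nome_lt_one hq0 hq1 (by linarith)) h1 h2).congr (fun m => ?_) rfl
  rw [qnum_div_typeII hq0 hq1 (by linarith)]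
  push_cast
  rw [inv_inv, inv_pow]

lemma expSum_ctrB_typeI (hq0 : 0 < q) (hq1 : q < 1) (hr : 1 < r) {x : ℂ} (hx : ‖x‖ < 1) :
    ExpSum (fun m => ((-(qnum q ((r - 1) * m) / qnum q (r * m)) *
      ((qnum q (2 * m) - qnum q m) / qnum q m) / m : ℝ) : ℂ) * x ^ (m : ℕ))
      (ctrB q (nome q r) x) := by
  have hp := nome_lt_sq hq0 hq1 hr
  have hp0 := nome_pos hq0 r
  have h1 := norm_pow_mul_lt hq0 hq1 hx 1
  rw [pow_one] at h1
  have h4 : ‖(nome q r : ℂ) * ((q : ℂ) ^ 2)⁻¹ * x‖ < 1 := by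
    rw [← Complex.ofReal_pow, ← Complex.ofReal_inv, ← Complex.ofReal_mul,
      norm_ofReal_mul (by positivity)]
    calc nome q r * (q ^ 2)⁻¹ * ‖x‖ ≤ q ^ 2 * (q ^ 2)⁻¹ * ‖x‖ := by gcongr
      _ < 1 := by rw [mul_inv_cancel₀ (by positivity), one_mul]; exact hx
  have h2 : ‖(nome q r : ℂ) * (q : ℂ)⁻¹ * x‖ < 1 := by
    rw [← Complex.ofReal_inv, ← Complex.ofReal_mul, norm_ofReal_mul (by positivity)]
    calc nome q r * q⁻¹ * ‖x‖ ≤ q ^ 2 * q⁻¹ * ‖x‖ := by gcongr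
      _ = q * ‖x‖ := by field_simp
      _ ≤ 1 * ‖x‖ := by gcongr
      _ < 1 := by linarith
  refine (expSum_ctrB (ofReal_ne_zero_of_pos hq0) (norm_nome_lt_one hq0 hq1 (by linarith)) hx h1 h2
    (norm_pow_mul_lt hq0 hq1 hx 2) h4).congr (fun m => ?_) rfl
  obtain ⟨hA, -⟩ := qnum_facts hq0 hq1 hr m
  rw [qnum_div_typeI hq0 hq1 (by linarith), qnum_two_mul_sub hq0, mul_div_cancel_left₀ _ hA]
  push_cast
  rw [inv_pow]
  ring

/-- The radius `q²` comes from a zero, not a pole: only the logarithm stops there, and the function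
continues past it. The contours for `E E` use that continuation. -/
lemma expSum_ctrB_typeII (hq0 : 0 < q) (hq1 : q < 1) (hr : 1 < r) {x : ℂ} (hx : ‖x‖ < q ^ 2) :
    ExpSum (fun m => ((-(qnum q (r * m) / qnum q ((r - 1) * m)) *
      ((qnum q (2 * m) - qnum q m) / qnum q m) / m : ℝ) : ℂ) * x ^ (m : ℕ))
      (ctrB (q : ℂ)⁻¹ (nome q (r - 1)) x) := by
  have hp := nome_lt_one hq0 hq1 (sub_pos.2 hr)
  have hp0 := nome_pos hq0 (r - 1)
  have hx1 : ‖x‖ < 1 := hx.trans (pow_lt_one₀ hq0.le hq1 (by norm_num))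
  have h1 : ‖(q : ℂ)⁻¹ * x‖ < 1 := by
    rw [← Complex.ofReal_inv, norm_ofReal_mul (by positivity)]
    calc q⁻¹ * ‖x‖ < q⁻¹ * q ^ 2 := by gcongr
      _ = q := by field_simp
      _ < 1 := hq1
  have h3 : ‖((q : ℂ)⁻¹) ^ 2 * x‖ < 1 := by
    rw [← Complex.ofReal_inv, ← Complex.ofReal_pow, norm_ofReal_mul (by positivity)]
    calc q⁻¹ ^ 2 * ‖x‖ < q⁻¹ ^ 2 * q ^ 2 := by gcongr
      _ = 1 := by field_simp
  have h2 : ‖(nome q (r - 1) : ℂ) * ((q : ℂ)⁻¹)⁻¹ * x‖ < 1 := by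
    rw [inv_inv, ← Complex.ofReal_mul, norm_ofReal_mul (by positivity)]
    calc nome q (r - 1) * q * ‖x‖ ≤ 1 * 1 * ‖x‖ := by gcongr
      _ < 1 := by linarith
  have h4 : ‖(nome q (r - 1) : ℂ) * (((q : ℂ)⁻¹) ^ 2)⁻¹ * x‖ < 1 := by
    rw [inv_pow, inv_inv, ← Complex.ofReal_pow, ← Complex.ofReal_mul,
      norm_ofReal_mul (by positivity)]
    calc nome q (r - 1) * q ^ 2 * ‖x‖ ≤ 1 * 1 ^ 2 * ‖x‖ := by gcongr
      _ < 1 := by linarith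
  refine (expSum_ctrB (inv_ne_zero (ofReal_ne_zero_of_pos hq0))
    (norm_nome_lt_one hq0 hq1 (by linarith)) hx1 h1 h2 h3 h4).congr (fun m => ?_) rfl
  obtain ⟨hA, -⟩ := qnum_facts hq0 hq1 hr m
  rw [qnum_div_typeII hq0 hq1 (by linarith), qnum_two_mul_sub hq0, mul_div_cancel_left₀ _ hA]
  push_cast
  rw [inv_inv, inv_pow]
  ring

/-- The factor `q^{Rm}` of the coefficients is the `m`-th power of the square root of the nome, and
rescales the argument of `ctrK`. -/
lemma expSum_ctrK_half {R : ℝ} (hq0 : 0 < q) (hq1 : q < 1) (hR : 0 < R) {x : ℂ} (hx : ‖x‖ < 1) :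
    ExpSum (fun m => ((qnum q m ^ 2 / (qnum q (R * m) * (qnum q (2 * m) - qnum q m)) / m : ℝ) : ℂ) *
      x ^ (m : ℕ)) (ctrK q (nome q R) (nome q (R / 2) * x)) := by
  have h1 : ‖(nome q (R / 2) : ℂ) * x‖ < 1 := by
    rw [norm_ofReal_mul (nome_pos hq0 _).le]
    exact (mul_le_of_le_one_left (norm_nonneg _)
      (nome_lt_one hq0 hq1 (by linarith)).le).trans_lt hx
  refine (expSum_ctrK hq0 hq1 (norm_nome_lt_one hq0 hq1 hR) h1).congr (fun m => ?_) rfl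
  rw [qnum_sq_div hq0 hq1 hR, mul_pow]
  push_cast
  ring

lemma expSum_neg_inv {x : ℂ} (hx : ‖x‖ < 1) :
    ExpSum (fun m => ((-(m : ℝ)⁻¹ : ℝ) : ℂ) * x ^ (m : ℕ)) (1 - x) := by
  refine (expSum_one_sub hx).congr (fun m => ?_) rfl
  push_cast
  ring

end



/-! ### Contractions of the individual pairs of families -/

namespace Fam

/-- Here, as for every pair below, the weight `q^m` in the negative modes cancels the `q^{-m}` of
the commutator, and one factor `[m]_q` or `[2m]_q - [m]_q` cancels against each vertex operator's
denominator. -/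
lemma hasCtr_famPhi_famF {q r : ℝ} (hq0 : 0 < q) (hq1 : q < 1) (hr : 1 < r) (s : ℂ) :
    HasCtr q (famPhi q r s) (famF q r s) q⁻¹ (ctrA q (nome q r)) := by
  refine HasCtr.of_expSum (inv_pos.2 hq0) (fun m => qnum q ((r - 1) * m) / qnum q (r * m) / m)
    (fun m => ?_) fun x hx => expSum_ctrA_typeI hq0 hq1 hr hx
  obtain ⟨hA, hB, hR, hS, ht, hm⟩ := qnum_facts hq0 hq1 hr m
  rw [famPhi_pnat, famF_neg_pnat, heis_eq hq0]
  simp only [← Complex.ofReal_mul]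
  refine congrArg _ ?_
  generalize qnum q (2 * m) - qnum q m = B at *
  generalize qnum q m = A at *
  generalize qnum q (r * m) = R at *
  generalize qnum q ((r - 1) * m) = S at *
  field_simp

lemma hasCtr_famF_famPhi {q r : ℝ} (hq0 : 0 < q) (hq1 : q < 1) (hr : 1 < r) (s : ℂ) :
    HasCtr q (famF q r s) (famPhi q r s) q⁻¹ (ctrA q (nome q r)) := by
  refine HasCtr.of_expSum (inv_pos.2 hq0) (fun m => qnum q ((r - 1) * m) / qnum q (r * m) / m)
    (fun m => ?_) fun x hx => expSum_ctrA_typeI hq0 hq1 hr hx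
  obtain ⟨hA, hB, hR, hS, ht, hm⟩ := qnum_facts hq0 hq1 hr m
  rw [famF_pnat, famPhi_neg_pnat, heis_eq hq0]
  simp only [← Complex.ofReal_mul]
  refine congrArg _ ?_
  generalize qnum q (2 * m) - qnum q m = B at *
  generalize qnum q m = A at *
  generalize qnum q (r * m) = R at *
  generalize qnum q ((r - 1) * m) = S at *
  field_simp

lemma hasCtr_famF_famF {q r : ℝ} (hq0 : 0 < q) (hq1 : q < 1) (hr : 1 < r) (s : ℂ) :
    HasCtr q (famF q r s) (famF q r s) 1 (ctrB q (nome q r)) := by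
  refine HasCtr.of_expSum (one_pos) (fun m => -(qnum q ((r - 1) * m) / qnum q (r * m)) *
      ((qnum q (2 * m) - qnum q m) / qnum q m) / m)
    (fun m => ?_) fun x hx => expSum_ctrB_typeI hq0 hq1 hr hx
  obtain ⟨hA, hB, hR, hS, ht, hm⟩ := qnum_facts hq0 hq1 hr m
  rw [famF_pnat, famF_neg_pnat, heis_eq hq0]
  simp only [← Complex.ofReal_mul]
  refine congrArg _ ?_
  generalize qnum q (2 * m) - qnum q m = B at *
  generalize qnum q m = A at *
  generalize qnum q (r * m) = R at *
  generalize qnum q ((r - 1) * m) = S at *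
  field_simp

lemma hasCtr_famPsi_famE {q r : ℝ} (hq0 : 0 < q) (hq1 : q < 1) (hr : 1 < r) (s : ℂ) :
    HasCtr q (famPsi q r s) (famE q r s) q (ctrA (q : ℂ)⁻¹ (nome q (r - 1))) := by
  refine HasCtr.of_expSum (hq0) (fun m => qnum q (r * m) / qnum q ((r - 1) * m) / m)
    (fun m => ?_) fun x hx => expSum_ctrA_typeII hq0 hq1 hr hx
  obtain ⟨hA, hB, hR, hS, ht, hm⟩ := qnum_facts hq0 hq1 hr m
  rw [famPsi_pnat, famE_neg_pnat, heis_eq hq0]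
  simp only [← Complex.ofReal_mul]
  refine congrArg _ ?_
  generalize qnum q (2 * m) - qnum q m = B at *
  generalize qnum q m = A at *
  generalize qnum q (r * m) = R at *
  generalize qnum q ((r - 1) * m) = S at *
  field_simp

lemma hasCtr_famE_famPsi {q r : ℝ} (hq0 : 0 < q) (hq1 : q < 1) (hr : 1 < r) (s : ℂ) :
    HasCtr q (famE q r s) (famPsi q r s) q (ctrA (q : ℂ)⁻¹ (nome q (r - 1))) := by
  refine HasCtr.of_expSum (hq0) (fun m => qnum q (r * m) / qnum q ((r - 1) * m) / m)
    (fun m => ?_) fun x hx => expSum_ctrA_typeII hq0 hq1 hr hx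
  obtain ⟨hA, hB, hR, hS, ht, hm⟩ := qnum_facts hq0 hq1 hr m
  rw [famE_pnat, famPsi_neg_pnat, heis_eq hq0]
  simp only [← Complex.ofReal_mul]
  refine congrArg _ ?_
  generalize qnum q (2 * m) - qnum q m = B at *
  generalize qnum q m = A at *
  generalize qnum q (r * m) = R at *
  generalize qnum q ((r - 1) * m) = S at *
  field_simp

lemma hasCtr_famE_famE {q r : ℝ} (hq0 : 0 < q) (hq1 : q < 1) (hr : 1 < r) (s : ℂ) :
    HasCtr q (famE q r s) (famE q r s) (q ^ 2) (ctrB (q : ℂ)⁻¹ (nome q (r - 1))) := by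
  refine HasCtr.of_expSum (pow_pos hq0 2) (fun m => -(qnum q (r * m) / qnum q ((r - 1) * m)) *
      ((qnum q (2 * m) - qnum q m) / qnum q m) / m)
    (fun m => ?_) fun x hx => expSum_ctrB_typeII hq0 hq1 hr hx
  obtain ⟨hA, hB, hR, hS, ht, hm⟩ := qnum_facts hq0 hq1 hr m
  rw [famE_pnat, famE_neg_pnat, heis_eq hq0]
  simp only [← Complex.ofReal_mul]
  refine congrArg _ ?_
  generalize qnum q (2 * m) - qnum q m = B at *
  generalize qnum q m = A at *
  generalize qnum q (r * m) = R at *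
  generalize qnum q ((r - 1) * m) = S at *
  field_simp

/-- The ratios defining `β_m` and `α_{-m}` cancel, so only `-1/m` survives and no nome appears. -/
lemma hasCtr_famPhi_famE {q r : ℝ} (hq0 : 0 < q) (hq1 : q < 1) (hr : 1 < r) (s : ℂ) :
    HasCtr q (famPhi q r s) (famE q r s) 1 (fun x => 1 - x) := by
  refine HasCtr.of_expSum (one_pos) (fun m => -(m : ℝ)⁻¹)
    (fun m => ?_) fun x hx => expSum_neg_inv hx
  obtain ⟨hA, hB, hR, hS, ht, hm⟩ := qnum_facts hq0 hq1 hr m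
  rw [famPhi_pnat, famE_neg_pnat, heis_eq hq0]
  simp only [← Complex.ofReal_mul]
  refine congrArg _ ?_
  generalize qnum q (2 * m) - qnum q m = B at *
  generalize qnum q m = A at *
  generalize qnum q (r * m) = R at *
  generalize qnum q ((r - 1) * m) = S at *
  field_simp

lemma hasCtr_famE_famPhi {q r : ℝ} (hq0 : 0 < q) (hq1 : q < 1) (hr : 1 < r) (s : ℂ) :
    HasCtr q (famE q r s) (famPhi q r s) 1 (fun x => 1 - x) := by
  refine HasCtr.of_expSum (one_pos) (fun m => -(m : ℝ)⁻¹)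
    (fun m => ?_) fun x hx => expSum_neg_inv hx
  obtain ⟨hA, hB, hR, hS, ht, hm⟩ := qnum_facts hq0 hq1 hr m
  rw [famE_pnat, famPhi_neg_pnat, heis_eq hq0]
  simp only [← Complex.ofReal_mul]
  refine congrArg _ ?_
  generalize qnum q (2 * m) - qnum q m = B at *
  generalize qnum q m = A at *
  generalize qnum q (r * m) = R at *
  generalize qnum q ((r - 1) * m) = S at *
  field_simp

lemma hasCtr_famPsi_famF {q r : ℝ} (hq0 : 0 < q) (hq1 : q < 1) (hr : 1 < r) (s : ℂ) :
    HasCtr q (famPsi q r s) (famF q r s) 1 (fun x => 1 - x) := by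
  refine HasCtr.of_expSum (one_pos) (fun m => -(m : ℝ)⁻¹)
    (fun m => ?_) fun x hx => expSum_neg_inv hx
  obtain ⟨hA, hB, hR, hS, ht, hm⟩ := qnum_facts hq0 hq1 hr m
  rw [famPsi_pnat, famF_neg_pnat, heis_eq hq0]
  simp only [← Complex.ofReal_mul]
  refine congrArg _ ?_
  generalize qnum q (2 * m) - qnum q m = B at *
  generalize qnum q m = A at *
  generalize qnum q (r * m) = R at *
  generalize qnum q ((r - 1) * m) = S at *
  field_simp

lemma hasCtr_famF_famPsi {q r : ℝ} (hq0 : 0 < q) (hq1 : q < 1) (hr : 1 < r) (s : ℂ) :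
    HasCtr q (famF q r s) (famPsi q r s) 1 (fun x => 1 - x) := by
  refine HasCtr.of_expSum (one_pos) (fun m => -(m : ℝ)⁻¹)
    (fun m => ?_) fun x hx => expSum_neg_inv hx
  obtain ⟨hA, hB, hR, hS, ht, hm⟩ := qnum_facts hq0 hq1 hr m
  rw [famF_pnat, famPsi_neg_pnat, heis_eq hq0]
  simp only [← Complex.ofReal_mul]
  refine congrArg _ ?_
  generalize qnum q (2 * m) - qnum q m = B at *
  generalize qnum q m = A at *
  generalize qnum q (r * m) = R at *
  generalize qnum q ((r - 1) * m) = S at *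
  field_simp

lemma hasCtr_famPhi_famK {q r : ℝ} (hq0 : 0 < q) (hq1 : q < 1) (hr : 1 < r) (s : ℂ) :
    HasCtr q (famPhi q r s) (famK q r s) 1 (fun x => ctrK q (nome q r) (nome q (r / 2) * x)) := by
  refine HasCtr.of_expSum (one_pos) (fun m => qnum q m ^ 2 / (qnum q (r * m) * (qnum q (2 * m) - qnum q m)) / m)
    (fun m => ?_) fun x hx => expSum_ctrK_half hq0 hq1 (zero_lt_one.trans hr) hx
  obtain ⟨hA, hB, hR, hS, ht, hm⟩ := qnum_facts hq0 hq1 hr m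
  rw [famPhi_pnat, famK_neg_pnat, heis_eq hq0]
  simp only [← Complex.ofReal_mul]
  refine congrArg _ ?_
  generalize qnum q (2 * m) - qnum q m = B at *
  generalize qnum q m = A at *
  generalize qnum q (r * m) = R at *
  generalize qnum q ((r - 1) * m) = S at *
  field_simp

lemma hasCtr_famK_famPhi {q r : ℝ} (hq0 : 0 < q) (hq1 : q < 1) (hr : 1 < r) (s : ℂ) :
    HasCtr q (famK q r s) (famPhi q r s) 1 (fun x => ctrK q (nome q r) (nome q (r / 2) * x)) := by
  refine HasCtr.of_expSum (one_pos) (fun m => qnum q m ^ 2 / (qnum q (r * m) * (qnum q (2 * m) - qnum q m)) / m)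
    (fun m => ?_) fun x hx => expSum_ctrK_half hq0 hq1 (zero_lt_one.trans hr) hx
  obtain ⟨hA, hB, hR, hS, ht, hm⟩ := qnum_facts hq0 hq1 hr m
  rw [famK_pnat, famPhi_neg_pnat, heis_eq hq0]
  simp only [← Complex.ofReal_mul]
  refine congrArg _ ?_
  generalize qnum q (2 * m) - qnum q m = B at *
  generalize qnum q m = A at *
  generalize qnum q (r * m) = R at *
  generalize qnum q ((r - 1) * m) = S at *
  field_simp

lemma hasCtr_famPsi_famK {q r : ℝ} (hq0 : 0 < q) (hq1 : q < 1) (hr : 1 < r) (s : ℂ) :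
    HasCtr q (famPsi q r s) (famK q r s) 1 (fun x => (ctrK q (nome q (r - 1)) (nome q ((r - 1) / 2) * x))⁻¹) := by
  refine HasCtr.of_expSum (one_pos) (fun m => -(qnum q m ^ 2 / (qnum q ((r - 1) * m) * (qnum q (2 * m) - qnum q m)) / m))
    (fun m => ?_) fun x hx => (expSum_ctrK_half hq0 hq1 (sub_pos.2 hr) hx).neg.congr (fun m => by push_cast; ring) rfl
  obtain ⟨hA, hB, hR, hS, ht, hm⟩ := qnum_facts hq0 hq1 hr m
  rw [famPsi_pnat, famK_neg_pnat, heis_eq hq0]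
  simp only [← Complex.ofReal_mul]
  refine congrArg _ ?_
  generalize qnum q (2 * m) - qnum q m = B at *
  generalize qnum q m = A at *
  generalize qnum q (r * m) = R at *
  generalize qnum q ((r - 1) * m) = S at *
  field_simp

lemma hasCtr_famK_famPsi {q r : ℝ} (hq0 : 0 < q) (hq1 : q < 1) (hr : 1 < r) (s : ℂ) :
    HasCtr q (famK q r s) (famPsi q r s) 1 (fun x => (ctrK q (nome q (r - 1)) (nome q ((r - 1) / 2) * x))⁻¹) := by
  refine HasCtr.of_expSum (one_pos) (fun m => -(qnum q m ^ 2 / (qnum q ((r - 1) * m) * (qnum q (2 * m) - qnum q m)) / m))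
    (fun m => ?_) fun x hx => (expSum_ctrK_half hq0 hq1 (sub_pos.2 hr) hx).neg.congr (fun m => by push_cast; ring) rfl
  obtain ⟨hA, hB, hR, hS, ht, hm⟩ := qnum_facts hq0 hq1 hr m
  rw [famK_pnat, famPsi_neg_pnat, heis_eq hq0]
  simp only [← Complex.ofReal_mul]
  refine congrArg _ ?_
  generalize qnum q (2 * m) - qnum q m = B at *
  generalize qnum q m = A at *
  generalize qnum q (r * m) = R at *
  generalize qnum q ((r - 1) * m) = S at *
  field_simp

end Fam


/-! ### Exchange relations of the currents and the vertex operators -/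

namespace Fam

lemma Local.shift {q : ℝ} (hq0 : 0 < q) {X Y : Fam} {σ c : ℂ} (h : Local X Y σ c) (a b : ℂ) :
    Local (X.shift q a) (Y.shift q b) (σ * zpw q (a - b) c) c := by
  refine ⟨fun x => ?_, h.left, h.right⟩
  have h1 := h.sign x
  have h2 : zpw q (a - b) c * zpw q b c = zpw q a c := by
    rw [← zpw_add_arg hq0, sub_add_cancel]
  simp only [Fam.shift, h.left, h.right, zpw_add hq0]
  rw [← h2]
  linear_combination zpw q a (X.e x) * zpw q b (Y.e x) * (zpw q (a - b) c * zpw q b c) * h1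

variable {q r : ℝ} (s : ℂ)

lemma local_famPhi_famF (hr : r ≠ 0) : Local (famPhi q r s) (famF q r s) 1 (-1 + 1 / r) := by
  have hr' : (r : ℂ) ≠ 0 := by exact_mod_cast hr
  refine ⟨fun x => ?_, fun x => ?_, fun x => ?_⟩ <;>
    simp only [famPhi, famF, hval, Pval, Prod.fst_add, Prod.snd_add] <;> push_cast <;>
    field_simp <;> ring

lemma local_famPsi_famE (hr : r - 1 ≠ 0) :
    Local (famPsi q r s) (famE q r s) 1 (-1 - 1 / ((r : ℂ) - 1)) := by
  have hr' : (r : ℂ) - 1 ≠ 0 := by exact_mod_cast hr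
  have h1 : (-1 : ℂ) ≠ 0 := by norm_num
  refine ⟨fun x => ?_, fun x => ?_, fun x => ?_⟩
  · simp only [famPsi, famE, Prod.fst_add, zpow_add₀ h1, zpow_neg]
    norm_num
    ring
  all_goals
    simp only [famPsi, famE, hval, Pval, Prod.fst_add, Prod.snd_add]
    push_cast
    field_simp
    ring

/-- The sign is that of `e^Q e^α̂ = -e^α̂ e^Q`; together with `z₁/z₂` it carries `1 - z₂/z₁` to `1 -
z₁/z₂`, whence exact commutation. -/
lemma local_famPhi_famE (hr : r ≠ 0) (hr1 : r - 1 ≠ 0) :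
    Local (famPhi q r s) (famE q r s) (-1) 1 := by
  have hr' : (r : ℂ) ≠ 0 := by exact_mod_cast hr
  have hr1' : (r : ℂ) - 1 ≠ 0 := by exact_mod_cast hr1
  have h1 : (-1 : ℂ) ≠ 0 := by norm_num
  refine ⟨fun x => ?_, fun x => ?_, fun x => ?_⟩
  · simp only [famPhi, famE, Prod.fst_add, zpow_add₀ h1, zpow_neg]
    norm_num
  all_goals
    simp only [famPhi, famE, hval, Pval, Prod.fst_add, Prod.snd_add]
    push_cast
    field_simp
    ring

lemma local_famPsi_famF (hr : r ≠ 0) (hr1 : r - 1 ≠ 0) :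
    Local (famPsi q r s) (famF q r s) (-1) 1 := by
  have hr' : (r : ℂ) ≠ 0 := by exact_mod_cast hr
  have hr1' : (r : ℂ) - 1 ≠ 0 := by exact_mod_cast hr1
  have h1 : (-1 : ℂ) ≠ 0 := by norm_num
  refine ⟨fun x => ?_, fun x => ?_, fun x => ?_⟩
  · simp only [famPsi, famF, Prod.fst_add, zpow_add₀ h1, zpow_neg]
    norm_num
    ring
  all_goals
    simp only [famPsi, famF, hval, Pval, Prod.fst_add, Prod.snd_add]
    push_cast
    field_simp
    ring

lemma local_famPhi_famK (hr : r ≠ 0) (hr1 : r - 1 ≠ 0) :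
    Local (famPhi q r s) (famK q r s) (-1) (-(1 / r)) := by
  have hr' : (r : ℂ) ≠ 0 := by exact_mod_cast hr
  have hr1' : (r : ℂ) - 1 ≠ 0 := by exact_mod_cast hr1
  have h1 : (-1 : ℂ) ≠ 0 := by norm_num
  refine ⟨fun x => ?_, fun x => ?_, fun x => ?_⟩
  · simp only [famPhi, famK, Prod.fst_add, zpow_add₀ h1]
    norm_num
  all_goals
    simp only [famPhi, famK, hval, Pval, Prod.fst_add, Prod.snd_add]
    push_cast
    field_simp
    ring

lemma local_famK_famPsi (hr : r ≠ 0) (hr1 : r - 1 ≠ 0) :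
    Local (famK q r s) (famPsi q r s) (-1) (1 / ((r : ℂ) - 1)) := by
  have hr' : (r : ℂ) ≠ 0 := by exact_mod_cast hr
  have hr1' : (r : ℂ) - 1 ≠ 0 := by exact_mod_cast hr1
  have h1 : (-1 : ℂ) ≠ 0 := by norm_num
  refine ⟨fun x => ?_, fun x => ?_, fun x => ?_⟩
  · simp only [famPsi, famK, Prod.fst_add, zpow_add₀ h1]
    norm_num
    ring
  all_goals
    simp only [famPsi, famK, hval, Pval, Prod.fst_add, Prod.snd_add]
    push_cast
    field_simp
    ring

end Fam

/-! ### Exchange relations of the highest components with `K_-`, `E` and `F` -/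

section

variable {q r : ℝ}

lemma nome_half_mul (hq0 : 0 < q) (R : ℝ) :
    (nome q (R / 2) : ℂ) * nome q (R / 2) = nome q R := by
  rw [← Complex.ofReal_mul, nome, nome, ← Real.rpow_add hq0]
  congr 2
  ring

lemma nome_neg (hq0 : 0 < q) (R : ℝ) : (nome q (-R) : ℂ) = (nome q R : ℂ)⁻¹ := by
  rw [nome, mul_neg, Real.rpow_neg hq0.le, Complex.ofReal_inv]; rfl

/-- The relative shift `r/2` supplies the second square root of the nome; in the opposite order the
two square roots cancel, leaving `ctrK` at `x` itself. -/
lemma PhiMinus_famK_ctr (hq0 : 0 < q) (hq1 : q < 1) (hr : 1 < r) (s : ℂ) :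
    Fam.HasCtr q ((famPhi q r s).shift q (1 / 2)) ((famK q r s).shift q (((r : ℂ) + 1) / 2)) 1
      (fun x => ctrK q (nome q r) (nome q r * x)) := by
  have e : ((r : ℂ) + 1) / 2 - 1 / 2 = ((r / 2 : ℝ) : ℂ) := by push_cast; ring
  refine (Fam.hasCtr_famPhi_famK hq0 hq1 hr s).shift hq0 _ _ one_pos ?_ fun x => ?_
  · rw [e, zOf_ofReal hq0, norm_nome hq0, mul_one]
    exact (nome_lt_one hq0 hq1 (by linarith)).le
  · rw [e, zOf_ofReal hq0, ← mul_assoc, nome_half_mul hq0]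

lemma famK_PhiMinus_ctr (hq0 : 0 < q) (hq1 : q < 1) (hr : 1 < r) (s : ℂ) :
    Fam.HasCtr q ((famK q r s).shift q (((r : ℂ) + 1) / 2)) ((famPhi q r s).shift q (1 / 2))
      (nome q (r / 2)) (ctrK q (nome q r)) := by
  have e : 1 / 2 - ((r : ℂ) + 1) / 2 = ((-(r / 2) : ℝ) : ℂ) := by push_cast; ring
  have hp := nome_pos hq0 (r / 2)
  refine (Fam.hasCtr_famK_famPhi hq0 hq1 hr s).shift hq0 _ _ hp ?_ fun x => ?_
  · rw [e, zOf_ofReal hq0, nome_neg hq0, norm_inv, norm_nome hq0, inv_mul_cancel₀ hp.ne']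
  · rw [e, zOf_ofReal hq0, nome_neg hq0, mul_inv_cancel_left₀ (nome_ne_zero hq0 _)]

lemma PsiMinus_famK_ctr (hq0 : 0 < q) (hq1 : q < 1) (hr : 1 < r) (s : ℂ) :
    Fam.HasCtr q ((famPsi q r s).shift q 1) ((famK q r s).shift q (((r : ℂ) + 1) / 2)) 1
      (fun x => (ctrK q (nome q (r - 1)) (nome q (r - 1) * x))⁻¹) := by
  have e : ((r : ℂ) + 1) / 2 - 1 = (((r - 1) / 2 : ℝ) : ℂ) := by push_cast; ring
  refine (Fam.hasCtr_famPsi_famK hq0 hq1 hr s).shift hq0 _ _ one_pos ?_ fun x => ?_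
  · rw [e, zOf_ofReal hq0, norm_nome hq0, mul_one]
    exact (nome_lt_one hq0 hq1 (by linarith)).le
  · rw [e, zOf_ofReal hq0, ← mul_assoc, nome_half_mul hq0]

lemma famK_PsiMinus_ctr (hq0 : 0 < q) (hq1 : q < 1) (hr : 1 < r) (s : ℂ) :
    Fam.HasCtr q ((famK q r s).shift q (((r : ℂ) + 1) / 2)) ((famPsi q r s).shift q 1)
      (nome q ((r - 1) / 2)) (fun x => (ctrK q (nome q (r - 1)) x)⁻¹) := by
  have e : 1 - ((r : ℂ) + 1) / 2 = ((-((r - 1) / 2) : ℝ) : ℂ) := by push_cast; ring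
  have hp := nome_pos hq0 ((r - 1) / 2)
  refine (Fam.hasCtr_famK_famPsi hq0 hq1 hr s).shift hq0 _ _ hp ?_ fun x => ?_
  · rw [e, zOf_ofReal hq0, nome_neg hq0, norm_inv, norm_nome hq0, inv_mul_cancel₀ hp.ne']
  · rw [e, zOf_ofReal hq0, nome_neg hq0, mul_inv_cancel_left₀ (nome_ne_zero hq0 _)]

lemma norm_ofReal_lt_one (hq0 : 0 < q) (hq1 : q < 1) : ‖(q : ℂ)‖ < 1 := by
  rw [Complex.norm_real, Real.norm_of_nonneg hq0.le]; exact hq1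

theorem exchangeRel_Phi_K (hq0 : 0 < q) (hq1 : q < 1) (hr : 1 < r) (s : ℂ) :
    ExchangeRel q (fun u₂ => PhiMinus q r s (u₂ + 1 / 2)) (curKm q r s)
      (fun u₂ u₁ => rhoPlus q r (u₁ - u₂)) := by
  have hr0 : r ≠ 0 := by linarith
  have hrc : (r : ℂ) ≠ 0 := by exact_mod_cast hr0
  have hr1 : r - 1 ≠ 0 := by linarith
  have hp := norm_nome_lt_one hq0 hq1 (zero_lt_one.trans hr)
  have hq := norm_ofReal_lt_one hq0 hq1
  have e1 : (fun u₂ => PhiMinus q r s (u₂ + 1 / 2)) = ((famPhi q r s).shift q (1 / 2)).op q := by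
    funext u
    rw [PhiMinus_eq_op hq0, Fam.op_shift hq0]
  have e2 : curKm q r s = ((famK q r s).shift q (((r : ℂ) + 1) / 2)).op q := by
    funext u
    rw [curKm_eq_op, Fam.op_shift hq0]
  -- The shifts enter the zero-mode power with net effect `q`, the prefactor of `ρ⁺`; its sign is
  -- that of the cocycle.
  have e3 : zpw q (1 / 2 - ((r : ℂ) + 1) / 2) (-(1 / r)) = q := by
    rw [zpw, show 2 * (1 / 2 - ((r : ℂ) + 1) / 2) * -(1 / r) = 1 by field_simp; ring,
      Complex.cpow_one]
  rw [e1, e2]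
  refine Fam.exchangeRel hq0 (PhiMinus_famK_ctr hq0 hq1 hr s) (famK_PhiMinus_ctr hq0 hq1 hr s)
    (meromorphicAt_ctrK hq hp _) (fun x => by simpa using meromorphicAt_ctrK hq hp 1 x)
    ((Fam.local_famPhi_famK s hr0 hr1).shift hq0 _ _) fun u₁ => ?_
  obtain ⟨y, hy⟩ := exists_norm_zOf_lt hq0 hq1 1 one_pos
  have hd : Differentiable ℂ fun u₂ => zOf q (u₁ - u₂) :=
    (differentiable_zOf hq0).comp (by fun_prop)
  -- Zeros of the contraction in the denominator of `ρ⁺` form the exceptional discrete set.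
  filter_upwards [eventually_ctrK_ne_zero hq hp hd (y := u₁ - y)
    (by simpa using hy)] with u₂ h
  rw [e3, rhoPlus_eq, ← neg_sub u₂ u₁, zpw_neg_arg, neg_neg, zOf_neg]
  rw [← neg_sub u₂ u₁, zOf_neg] at h
  rw [div_mul_cancel₀ _ h]
  ring

theorem exchangeRel_K_Psi (hq0 : 0 < q) (hq1 : q < 1) (hr : 1 < r) (s : ℂ) :
    ExchangeRel q (curKm q r s) (fun u₂ => PsiMinus q r s (u₂ + 1))
      (fun u₁ u₂ => rhoPlus q (r - 1) (u₁ - u₂)) := by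
  have hr0 : r ≠ 0 := by linarith
  have hr1 : r - 1 ≠ 0 := by linarith
  have hrc : (r : ℂ) - 1 ≠ 0 := by exact_mod_cast hr1
  have hp := norm_nome_lt_one hq0 hq1 (sub_pos.2 hr)
  have hq := norm_ofReal_lt_one hq0 hq1
  have e1 : (fun u₂ => PsiMinus q r s (u₂ + 1)) = ((famPsi q r s).shift q 1).op q := by
    funext u
    rw [PsiMinus_eq_op hq0, Fam.op_shift hq0]
  have e2 : curKm q r s = ((famK q r s).shift q (((r : ℂ) + 1) / 2)).op q := by
    funext u
    rw [curKm_eq_op, Fam.op_shift hq0]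
  have e3 : zpw q (((r : ℂ) + 1) / 2 - 1) (1 / ((r : ℂ) - 1)) = q := by
    rw [zpw, show 2 * (((r : ℂ) + 1) / 2 - 1) * (1 / ((r : ℂ) - 1)) = 1 by field_simp; ring,
      Complex.cpow_one]
  rw [e1, e2]
  -- `K_-` and `Ψ*_-` contract to the inverse of `ctrK`, so here `K_-` must stand on the left for
  -- the quotient to be `ρ⁺*` and not its inverse.
  refine Fam.exchangeRel hq0 (famK_PsiMinus_ctr hq0 hq1 hr s) (PsiMinus_famK_ctr hq0 hq1 hr s)
    (fun x => MeromorphicAt.inv (by simpa using meromorphicAt_ctrK hq hp 1 x))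
    (fun x => (meromorphicAt_ctrK hq hp _ x).inv)
    ((Fam.local_famK_famPsi s hr0 hr1).shift hq0 _ _) fun u₁ => ?_
  obtain ⟨y, hy⟩ := exists_norm_zOf_lt hq0 hq1 (nome q (r - 1)) one_pos
  have hd : Differentiable ℂ fun u₂ => (nome q (r - 1) : ℂ) * zOf q (u₁ - u₂) :=
    ((differentiable_zOf hq0).comp (by fun_prop : Differentiable ℂ fun u => u₁ - u)).const_mul _
  filter_upwards [eventually_ctrK_ne_zero hq hp hd (y := u₁ - y) (by simpa using hy)] with u₂ h
  have e4 : (((r - 1 : ℝ)) : ℂ) = (r : ℂ) - 1 := by push_cast; rfl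
  rw [e3, rhoPlus_eq, ← neg_sub u₁ u₂, zOf_neg, e4, div_mul_eq_mul_div, mul_inv_cancel_right₀ h]
  ring

theorem exchangeRel_Phi_E (hq0 : 0 < q) (hq1 : q < 1) (hr : 1 < r) (s : ℂ) :
    ExchangeRel q (PhiMinus q r s) (curE q r s) (fun _ _ => 1) := by
  have hm : ∀ x : ℂ, MeromorphicAt (fun x : ℂ => 1 - x) x := fun x => by fun_prop
  rw [PhiMinus_eq_op hq0, curE_eq_op hq0]
  refine Fam.exchangeRel hq0 (Fam.hasCtr_famPhi_famE hq0 hq1 hr s)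
    (Fam.hasCtr_famE_famPhi hq0 hq1 hr s) hm hm
    (Fam.local_famPhi_famE s (by linarith) (by linarith)) fun u₁ =>
      Filter.Eventually.of_forall fun u₂ => ?_
  have h := zOf_ne_zero hq0 (u₁ - u₂)
  have h1 : zpw q (u₁ - u₂) 1 = zOf q (u₁ - u₂) := by simp [zpw, zOf]
  rw [h1, ← neg_sub u₁ u₂, zOf_neg]
  field_simp
  ring

theorem exchangeRel_Psi_F (hq0 : 0 < q) (hq1 : q < 1) (hr : 1 < r) (s : ℂ) :
    ExchangeRel q (PsiMinus q r s) (curF q r s) (fun _ _ => 1) := by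
  have hm : ∀ x : ℂ, MeromorphicAt (fun x : ℂ => 1 - x) x := fun x => by fun_prop
  rw [PsiMinus_eq_op hq0, curF_eq_op hq0]
  refine Fam.exchangeRel hq0 (Fam.hasCtr_famPsi_famF hq0 hq1 hr s)
    (Fam.hasCtr_famF_famPsi hq0 hq1 hr s) hm hm
    (Fam.local_famPsi_famF s (by linarith) (by linarith)) fun u₁ =>
      Filter.Eventually.of_forall fun u₂ => ?_
  have h := zOf_ne_zero hq0 (u₁ - u₂)
  have h1 : zpw q (u₁ - u₂) 1 = zOf q (u₁ - u₂) := by simp [zpw, zOf]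
  rw [h1, ← neg_sub u₁ u₂, zOf_neg]
  field_simp
  ring

/-- the exchange of the contractions of `Φ_-` and `F` -/
lemma br_mul_ctrA_typeI (hq0 : 0 < q) (hq1 : q < 1) (hr : 1 < r)
    (u : ℂ) (h1 : br q r (u - 1 / 2) ≠ 0) (h2 : br q r (u + 1 / 2) ≠ 0) :
    br q r (u - 1 / 2) * (ctrA q (nome q r) (zOf q (-u)) * (1 * zpw q u (-1 + 1 / r))) =
      -(br q r (u + 1 / 2) * ctrA q (nome q r) (zOf q u)) := by
  have := br_mul_ctrA hq0 hq1 (zero_lt_one.trans hr) (1 / 2) u h1 h2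
  rw [zOf_half, mul_one_div_cancel (two_ne_zero : (2 : ℂ) ≠ 0)] at this
  rw [one_mul]
  exact this

/-- the exchange of the contractions of `Ψ*_-` and `E` -/
lemma br_mul_ctrA_typeII (hq0 : 0 < q) (hq1 : q < 1) (hr : 1 < r)
    (u : ℂ) (h1 : br q (r - 1) (u + 1 / 2) ≠ 0)
    (h2 : br q (r - 1) (u - 1 / 2) ≠ 0) :
    br q (r - 1) (u + 1 / 2) * (ctrA (q : ℂ)⁻¹ (nome q (r - 1)) (zOf q (-u)) *
      (1 * zpw q u (-1 - 1 / ((r : ℂ) - 1)))) =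
      -(br q (r - 1) (u - 1 / 2) * ctrA (q : ℂ)⁻¹ (nome q (r - 1)) (zOf q u)) := by
  have := br_mul_ctrA hq0 hq1 (sub_pos.2 hr) (-(1 / 2)) u (by rwa [sub_neg_eq_add])
    (by rwa [← sub_eq_add_neg])
  rw [zOf_neg_half, sub_neg_eq_add, ← sub_eq_add_neg, mul_neg,
    mul_one_div_cancel (two_ne_zero : (2 : ℂ) ≠ 0), neg_div, ← sub_eq_add_neg] at this
  rw [one_mul]
  simpa using this

theorem exchangeRel_Phi_F (hq0 : 0 < q) (hq1 : q < 1) (hr : 1 < r) (s : ℂ) :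
    ExchangeRel q (PhiMinus q r s) (curF q r s)
    (fun u₁ u₂ => -(br q r (u₁ - u₂ + 1 / 2) / br q r (u₁ - u₂ - 1 / 2))) := by
  have hr0 : 0 < r := by linarith
  have hm := meromorphicAt_ctrA (Q := (q : ℂ)) (norm_nome_lt_one hq0 hq1 hr0)
  rw [PhiMinus_eq_op hq0, curF_eq_op hq0]
  refine Fam.exchangeRel hq0 (Fam.hasCtr_famPhi_famF hq0 hq1 hr s)
    (Fam.hasCtr_famF_famPhi hq0 hq1 hr s) hm hm (Fam.local_famPhi_famF s hr0.ne') fun u₁ => ?_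
  filter_upwards [eventually_br_ne_zero hq0 hq1 hr0 (u₁ - 1 / 2),
    eventually_br_ne_zero hq0 hq1 hr0 (u₁ + 1 / 2)] with u₂ h1 h2
  rw [sub_right_comm] at h1
  rw [add_sub_right_comm] at h2
  have := br_mul_ctrA_typeI hq0 hq1 hr _ h1 h2
  rw [neg_sub] at this
  rw [neg_mul, div_mul_eq_mul_div, eq_neg_iff_add_eq_zero, ← eq_neg_iff_add_eq_zero,
    ← neg_div, eq_div_iff h1, ← this]
  ring

theorem exchangeRel_Psi_E (hq0 : 0 < q) (hq1 : q < 1) (hr : 1 < r) (s : ℂ) :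
    ExchangeRel q (PsiMinus q r s) (curE q r s)
    (fun u₁ u₂ => -(br q (r - 1) (u₁ - u₂ - 1 / 2) / br q (r - 1) (u₁ - u₂ + 1 / 2))) := by
  have hr0 : 0 < r - 1 := by linarith
  have hm := meromorphicAt_ctrA (Q := (q : ℂ)⁻¹) (norm_nome_lt_one hq0 hq1 hr0)
  rw [PsiMinus_eq_op hq0, curE_eq_op hq0]
  refine Fam.exchangeRel hq0 (Fam.hasCtr_famPsi_famE hq0 hq1 hr s)
    (Fam.hasCtr_famE_famPsi hq0 hq1 hr s) hm hm (Fam.local_famPsi_famE s hr0.ne') fun u₁ => ?_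
  filter_upwards [eventually_br_ne_zero hq0 hq1 hr0 (u₁ - 1 / 2),
    eventually_br_ne_zero hq0 hq1 hr0 (u₁ + 1 / 2)] with u₂ h1 h2
  rw [sub_right_comm] at h1
  rw [add_sub_right_comm] at h2
  have := br_mul_ctrA_typeII hq0 hq1 hr _ h2 h1
  rw [neg_sub] at this
  rw [neg_mul, div_mul_eq_mul_div, ← neg_div, eq_div_iff h2, ← this]
  ring

theorem PhiMinus_mul_Pval (hq0 : 0 < q) (s : ℂ) (u : ℂ) (w v : State) :
    PhiMinus q r s u w v * Pval s v.2 = Pval s w.2 * PhiMinus q r s u w v := by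
  rw [PhiMinus_eq_op hq0, Fam.op, vop]
  split_ifs with h
  · rw [h, famPhi, Pval, Pval]
    simp [mul_comm]
  · simp

theorem PsiMinus_mul_Sval (hq0 : 0 < q) (s : ℂ) (u : ℂ) (w v : State) :
    PsiMinus q r s u w v * Sval s v.2 = Sval s w.2 * PsiMinus q r s u w v := by
  rw [PsiMinus_eq_op hq0, Fam.op, vop]
  split_ifs with h
  · have : Sval s w.2 = Sval s v.2 := by
      rw [h]
      simp only [famPsi, Sval, Pval, hval, Prod.fst_add, Prod.snd_add]
      push_cast
      ring
    rw [this, mul_comm]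
  · simp

end


/-! ### Points on circles -/

/-- the point `u` with `z = q^(2u)` on the circle `|z| = q^(2x)` -/
def circPt (q x t : ℝ) : ℂ :=
  (x : ℂ) + (t : ℂ) * ((Real.pi : ℂ) * Complex.I / (Real.log q : ℂ))

lemma continuous_circPt (q x : ℝ) : Continuous (circPt q x) := by
  unfold circPt; fun_prop

lemma circ_eq (q x : ℝ) (f : ℂ → ℂ) : circ q x f = ∫ t in (0 : ℝ)..1, f (circPt q x t) := rfl

lemma norm_zOf_circPt {q : ℝ} (hq0 : 0 < q) (x t : ℝ) : ‖zOf q (circPt q x t)‖ = q ^ (2 * x) := by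
  rw [zOf, Complex.norm_cpow_eq_rpow_re_of_pos hq0]
  congr 1
  have h : (2 * circPt q x t) = ((2 * x : ℝ) : ℂ) +
      ((2 * t * Real.pi * (Real.log q)⁻¹ : ℝ) : ℂ) * Complex.I := by
    rw [circPt]; push_cast; ring
  rw [h, Complex.add_re, Complex.re_ofReal_mul, Complex.I_re, Complex.ofReal_re]
  ring

lemma circPt_injective {q : ℝ} (hq0 : 0 < q) (hq1 : q < 1) (x : ℝ) :
    Function.Injective (circPt q x) := by
  intro t t' h
  have hl : (Real.log q : ℂ) ≠ 0 := by
    exact_mod_cast (Real.log_neg hq0 hq1).ne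
  have hc : ((Real.pi : ℂ) * Complex.I / (Real.log q : ℂ)) ≠ 0 :=
    div_ne_zero (mul_ne_zero (by exact_mod_cast Real.pi_ne_zero) Complex.I_ne_zero) hl
  exact_mod_cast mul_right_cancel₀ hc (add_left_cancel h)

/-- The exceptional set is discrete in a separable space, hence countable, and it meets the
injectively parametrized circle in a null set. -/
lemma ae_circPt_of_codiscrete {q : ℝ} (hq0 : 0 < q) (hq1 : q < 1) (x : ℝ) {P : ℂ → Prop}
    (h : ∀ᶠ u in Filter.codiscrete ℂ, P u) : ∀ᵐ t : ℝ, P (circPt q x t) := by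
  have h1 : ({u | P u}ᶜ).Countable := by
    have := (mem_codiscrete'.1 h).2.to_subtype
    exact TopologicalSpace.separableSpace_iff_countable.1 inferInstance
  have h2 := h1.preimage_of_injOn (f := circPt q x) (circPt_injective hq0 hq1 x).injOn
  filter_upwards [h2.ae_notMem MeasureTheory.volume] with t ht
  by_contra hP
  exact ht hP

/-! ### The domains of the continuations -/

lemma differentiableAt_ctrA_typeI {q r : ℝ} (hq0 : 0 < q) (hq1 : q < 1) (hr : 1 < r) {x : ℂ}
    (hx : x ∉ polPhiF q r) : DifferentiableAt ℂ (ctrA q (nome q r)) x := by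
  have hq := ofReal_ne_zero_of_pos hq0
  have hp := nome_ne_zero hq0 r
  refine differentiableAt_ctrA (norm_nome_lt_one hq0 hq1 (by linarith))
    (poch_ne_zero (norm_nome_lt_one hq0 hq1 (by linarith)) fun n hn => hx ⟨n, ?_⟩)
  push_cast
  field_simp
  linear_combination hn

lemma differentiableAt_ctrB_typeI {q r : ℝ} (hq0 : 0 < q) (hq1 : q < 1) (hr : 1 < r) {x : ℂ}
    (hx : x ∉ polFF q r) : DifferentiableAt ℂ (ctrB q (nome q r)) x := by
  have hq := ofReal_ne_zero_of_pos hq0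
  have hp := nome_ne_zero hq0 r
  have hp1 := norm_nome_lt_one (R := r) hq0 hq1 (by linarith)
  refine differentiableAt_ctrB hp1 (poch_ne_zero hp1 fun n hn => hx ⟨n, Or.inl ?_⟩)
    (poch_ne_zero hp1 fun n hn => hx ⟨n, Or.inr ?_⟩)
  · push_cast
    field_simp
    linear_combination hn
  · push_cast
    field_simp at hn ⊢
    linear_combination hn

lemma differentiableAt_ctrA_typeII {q r : ℝ} (hq0 : 0 < q) (hq1 : q < 1) (hr : 1 < r) {x : ℂ}
    (hx : x ∉ polPsiE q r) : DifferentiableAt ℂ (ctrA (q : ℂ)⁻¹ (nome q (r - 1))) x := by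
  have hq := ofReal_ne_zero_of_pos hq0
  have hp := nome_ne_zero hq0 (r - 1)
  have hp1 := norm_nome_lt_one (R := r - 1) hq0 hq1 (by linarith)
  refine differentiableAt_ctrA hp1 (poch_ne_zero hp1 fun n hn => hx ⟨n, ?_⟩)
  push_cast
  field_simp at hn ⊢
  linear_combination hn

lemma differentiableAt_ctrB_typeII {q r : ℝ} (hq0 : 0 < q) (hq1 : q < 1) (hr : 1 < r) {x : ℂ}
    (hx : x ∉ polEE q r) : DifferentiableAt ℂ (ctrB (q : ℂ)⁻¹ (nome q (r - 1))) x := by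
  have hq := ofReal_ne_zero_of_pos hq0
  have hp := nome_ne_zero hq0 (r - 1)
  have hp1 := norm_nome_lt_one (R := r - 1) hq0 hq1 (by linarith)
  refine differentiableAt_ctrB hp1 (poch_ne_zero hp1 fun n hn => hx ⟨n, Or.inl ?_⟩)
    (poch_ne_zero hp1 fun n hn => hx ⟨n, Or.inr ?_⟩)
  · push_cast
    field_simp at hn ⊢
    linear_combination hn
  · push_cast
    field_simp at hn ⊢
    linear_combination hn


/-! ### The type-I vertex operators -/

lemma continuous_kF0 {T : Type*} [TopologicalSpace T] {q r : ℝ} (hq0 : 0 < q) (hq1 : q < 1)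
    (hr : 0 < r) {y : T → ℂ} (hy : Continuous y) (h : ∀ t, br q r (y t) ≠ 0) (S : ℂ) :
    Continuous fun t => kF0 q r (y t) S := by
  have hb := (differentiable_br hq0 hq1 hr).continuous
  have hP := (differentiable_brP hq0 hq1 hr).continuous
  simp only [kF0, ← div_div]
  exact ((((hP.comp ((hy.add continuous_const).sub continuous_const)).mul
    continuous_const)).div (hb.comp hy) h).div_const _

lemma continuous_kF2 {T : Type*} [TopologicalSpace T] {q r : ℝ} (hq0 : 0 < q) (hq1 : q < 1)
    (hr : 0 < r) {y y' : T → ℂ} (hy : Continuous y) (hy' : Continuous y')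
    (h : ∀ t, br q r (y t) ≠ 0) (h' : ∀ t, br q r (y' t) ≠ 0)
    (h'' : ∀ t, br q r (y' t - y t + 1 / 2) ≠ 0) (S : ℂ) :
    Continuous fun t => kF2 q r (y t) (y' t) S := by
  have hb := (differentiable_br hq0 hq1 hr).continuous
  have hP := (differentiable_brP hq0 hq1 hr).continuous
  refine Continuous.div (continuous_const.mul (((hb.comp ?_).mul (hb.comp ?_)).mul (hP.comp ?_)))
    (((hb.comp hy).mul (hb.comp hy')).mul (hb.comp ?_))
    fun t => mul_ne_zero (mul_ne_zero (h t) (h' t)) (h'' t)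
  all_goals fun_prop

section

variable {q r : ℝ}

/-- the kernel of `F_{0,-}(u - r - 1/2)` next to `Φ_-(u)` -/
lemma kF0_shift (hq0 : 0 < q) (hq1 : q < 1) (hr : 1 < r) (u u' S : ℂ) :
    kF0 q r (u - r - 1 / 2 - u') (S + 1) =
      -(brP q r (u - u' + S) * br q r 1 / (br q r (u - u' - 1 / 2) * brP q r (S + 1 / 2))) := by
  have hr0 : 0 < r := by linarith
  -- Every bracket containing the spectral variable becomes a translate by exactly `r`. The `S + 1`
  -- accounts for the action of `Φ_-` on `h/2`.
  have e1 : u - r - 1 / 2 - u' + (S + 1) - 1 / 2 = u - u' + S - r := by ring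
  have e2 : u - r - 1 / 2 - u' = u - u' - 1 / 2 - r := by ring
  have e3 : S + 1 - 1 / 2 = S + 1 / 2 := by ring
  rw [kF0, e1, e2, e3, br_sub_nome hq0 hq1 hr0, brP_sub_nome hq0 hq1 hr0, neg_mul, div_neg]

/-- the kernel of `F_{+,-}(u - r - 1/2)` next to `Φ_-(u)` -/
lemma kF2_shift (hq0 : 0 < q) (hq1 : q < 1) (hr : 1 < r) (u u' u'' S : ℂ) :
    kF2 q r (u - r - 1 / 2 - u') (u - r - 1 / 2 - u'') (S + 1) =
      brP q r S * br q r 1 ^ 2 / (brP q r (S - 1 / 2) * brP q r (S - 1) * br q r (2 * S)) *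
        (br q r (u - u' + 2 * S - 3 / 2) * brP q r (u' - u'' + S) * br q r (u - u'' + 1 / 2)) /
        (br q r (u - u' - 1 / 2) * br q r (u - u'' - 1 / 2) * br q r (u' - u'' + 1 / 2)) := by
  have hr0 : 0 < r := by linarith
  have e1 : u - r - 1 / 2 - u' + 2 * (S + 1) - 3 = u - u' + 2 * S - 3 / 2 - r := by ring
  have e2 : ∀ x, u - r - 1 / 2 - x = u - x - 1 / 2 - r := fun x => by ring
  have e3 : u - r - 1 / 2 - u'' + 1 = u - u'' + 1 / 2 - r := by ring
  have e4 : u - r - 1 / 2 - u'' - (u - r - 1 / 2 - u') = u' - u'' := by ring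
  have e5 : S + 1 - 3 / 2 = S - 1 / 2 := by ring
  have e6 : S + 1 - 2 = S - 1 := by ring
  have e7 : 2 * (S + 1) - 2 = 2 * S := by ring
  have e8 : u' - u'' + (S + 1) - 1 = u' - u'' + S := by ring
  -- Two ordinary brackets in the numerator and two in the denominator are translated by `r`, so
  -- their signs cancel; those of `u' - u''` do not see the shift.
  rw [kF2, e1, e3, e4, e5, e6, e7, e8, add_sub_cancel_right, e2, e2, br_sub_nome hq0 hq1 hr0,
    br_sub_nome hq0 hq1 hr0, br_sub_nome hq0 hq1 hr0, br_sub_nome hq0 hq1 hr0]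
  simp only [neg_mul, mul_neg, neg_neg]
  ring

/-- exchange of `Φ_-` and `F` -/
lemma prod₂_Phi_F (hq0 : 0 < q) (hq1 : q < 1) (hr : 1 < r) (s u u' : ℂ) (w v : State)
    (h1 : br q r (u - u' - 1 / 2) ≠ 0) (h2 : br q r (u - u' + 1 / 2) ≠ 0) :
    Fam.prod₂ q (famPhi q r s) (famF q r s) (ctrA q (nome q r)) w v u u' /
        br q r (u - u' + 1 / 2) =
      -(Fam.prod₂ q (famF q r s) (famPhi q r s) (ctrA q (nome q r)) w v u' u /
        br q r (u - u' - 1 / 2)) := by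
  have key := br_mul_ctrA_typeI hq0 hq1 hr _ h1 h2
  rw [Fam.prod₂, (Fam.local_famPhi_famF s (by linarith)).nop₂_comm hq0, Fam.prod₂,
    Fam.nop₂_eq_mul, Fam.nop₂_eq_mul (g := ctrA _ _ _), ← neg_sub u u', ← neg_div,
    div_eq_div_iff h2 h1]
  linear_combination Fam.nop₂ q (famF q r s) (famPhi q r s) 1 u' u w v * key

/-- exchange of `Φ_-` and `F F` -/
lemma prod₃_Phi_F_F (hq0 : 0 < q) (hq1 : q < 1) (hr : 1 < r) (s u u' u'' : ℂ) (w v : State)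
    (h1 : br q r (u - u' - 1 / 2) ≠ 0) (h2 : br q r (u - u' + 1 / 2) ≠ 0)
    (h3 : br q r (u - u'' - 1 / 2) ≠ 0) (h4 : br q r (u - u'' + 1 / 2) ≠ 0) :
    Fam.prod₃ q (famPhi q r s) (famF q r s) (famF q r s) (ctrA q (nome q r)) (ctrA q (nome q r))
        (ctrB q (nome q r)) w v u u' u'' / br q r (u - u' + 1 / 2) =
      Fam.prod₃ q (famF q r s) (famF q r s) (famPhi q r s) (ctrB q (nome q r))
        (ctrA q (nome q r)) (ctrA q (nome q r)) w v u' u'' u * br q r (u - u'' + 1 / 2) /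
        (br q r (u - u' - 1 / 2) * br q r (u - u'' - 1 / 2)) := by
  have key := br_mul_ctrA_typeI hq0 hq1 hr _ h1 h2
  have key' := br_mul_ctrA_typeI hq0 hq1 hr _ h3 h4
  have hl := Fam.local_famPhi_famF (q := q) s (by linarith : r ≠ 0)
  rw [Fam.prod₃, hl.nop₃_rotate hq0 hl, Fam.prod₃, Fam.nop₃_eq_mul,
    Fam.nop₃_eq_mul (g := ctrB _ _ _ * _ * _), ← neg_sub u u', ← neg_sub u u'',
    div_eq_div_iff h2 (mul_ne_zero h1 h3)]
  generalize Fam.nop₃ q (famF q r s) (famF q r s) (famPhi q r s) 1 u' u'' u w v = N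
  generalize ctrB _ _ _ = B
  generalize ctrA _ _ (zOf q (-(u - u'))) = A1 at *
  generalize ctrA _ _ (zOf q (-(u - u''))) = A2 at *
  -- The exchange at `u'` is combined with the one at `u''`: `Φ_-` passes the two currents in turn.
  linear_combination N * B * br q r (u - u'' - 1 / 2) * (A2 * (1 * zpw q (u - u'') (-1 + 1 / r))) *
    key - N * B * br q r (u - u' + 1 / 2) * ctrA q (nome q r) (zOf q (u - u')) * key'

/-- The two inequalities say that `z_v/z'`, with `v = u - r - 1/2`, lies in the zero-free annulus;
the second bracket is the first one translated by `r`. -/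
lemma br_ne_zero_on_circle (hq0 : 0 < q) (hq1 : q < 1) (hr : 1 < r) {u u' : ℂ}
    (h1 : q⁻¹ * ‖zOf q u‖ < ‖zOf q u'‖) (h2 : ‖zOf q u'‖ < (nome q r)⁻¹ * q⁻¹ * ‖zOf q u‖) :
    br q r (u - r - 1 / 2 - u') ≠ 0 ∧ br q r (u - u' - 1 / 2) ≠ 0 := by
  have hr0 : 0 < r := by linarith
  have hp := nome_pos hq0 r
  have hz := norm_zOf_pos hq0 u
  have hz' := norm_zOf_pos hq0 u'
  have e : u - r - 1 / 2 - u' = u - u' - 1 / 2 - r := by ring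
  have h3 : br q r (u - r - 1 / 2 - u') ≠ 0 := by
    have hn : ‖zOf q (u - r - 1 / 2 - u')‖ =
        (nome q r)⁻¹ * q⁻¹ * ‖zOf q u‖ / ‖zOf q u'‖ := by
      rw [zOf_sub hq0, zOf_sub hq0, zOf_sub hq0, zOf_half, zOf_ofReal hq0, norm_div, norm_div,
        norm_div, norm_nome hq0, Complex.norm_real, Real.norm_of_nonneg hq0.le]
      field_simp
    refine br_ne_zero_of_norm hq0 hq1 hr0 ?_ ?_
    · rw [hn, one_lt_div hz']; exact h2
    · rw [hn, ← mul_div_assoc, div_lt_one hz', mul_assoc, mul_inv_cancel_left₀ hp.ne']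
      exact h1
  refine ⟨h3, fun h => h3 ?_⟩
  rw [e, br_sub_nome hq0 hq1 hr0, h, neg_zero]

lemma Sval_add_one (s : ℂ) (x : ℤ × ℤ) : Sval s (x + (1, 0)) = Sval s x + 1 := by
  simp only [Sval, Pval, hval, Prod.fst_add, Prod.snd_add]
  push_cast
  ring

theorem hasSum_Phi_zero (hq0 : 0 < q) (hq1 : q < 1) (hr : 1 < r) (s a : ℂ) (w v : State) (u : ℂ)
    (x : ℝ) (h1 : q⁻¹ * ‖zOf q u‖ < q ^ (2 * x))
    (h2 : q ^ (2 * x) < (nome q r)⁻¹ * q⁻¹ * ‖zOf q u‖) :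
    HasSum (fun n => halfF0 q r s a x (u - r - 1 / 2) w n * PhiMinus q r s u n v)
      (-(a * circ q x fun u' =>
        Fam.prod₂ q (famF q r s) (famPhi q r s) (ctrA q (nome q r)) w v u' u *
        (brP q r (u - u' + Sval s v.2) * br q r 1 /
          (br q r (u - u' - 1 / 2) * brP q r (Sval s v.2 + 1 / 2))))) := by
  have hr0 : 0 < r := by linarith
  have hc : ∀ t, br q r (u - r - 1 / 2 - circPt q x t) ≠ 0 := fun t =>
    (br_ne_zero_on_circle hq0 hq1 hr (by rwa [norm_zOf_circPt hq0])
      (by rwa [norm_zOf_circPt hq0])).1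
  have hz := norm_zOf_pos hq0 u
  have H := Fam.hasSum_integral_op_mul hq0 hq1 (Fam.hasCtr_famF_famPhi hq0 hq1 hr s)
    (continuous_circPt q x) (k := fun t z => kF0 q r (u - r - 1 / 2 - circPt q x t) (Sval s z))
    (fun z => continuous_kF0 hq0 hq1 hr0 (continuous_const.sub (continuous_circPt q x)) hc _)
    (u := u) (fun t _ => by
      rw [norm_zOf_circPt hq0, inv_mul_eq_div, lt_div_iff₀ hq0]
      -- Convergence of `F Φ_-` asks only for `|z| < q⁻¹|z'|`, weaker than the contour condition.
      have hq' : q < q⁻¹ := hq1.trans ((one_lt_inv₀ hq0).2 hq1)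
      nlinarith) w v
  refine hasSum_of_eq (H.mul_left a) (fun n => ?_) ?_
  · rw [halfF0, circ_eq, curF_eq_op hq0, PhiMinus_eq_op hq0, mul_assoc]
  · rw [circ_eq, ← mul_neg, ← intervalIntegral.integral_neg]
    congr 1
    refine intervalIntegral.integral_congr fun t _ => ?_
    -- `Φ_-` acts before the half current, so `S` in the kernel is evaluated one unit higher.
    have e : v.2 + (famPhi q r s).δ = v.2 + (1, 0) := rfl
    rw [e, Sval_add_one, kF0_shift hq0 hq1 hr, mul_neg]

/-- The exchange identity holds where `[u - u' + 1/2]` is nonzero. The circle may contain zeros of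
this bracket, but they form a null set for the integral. -/
theorem circ_Phi_zero (hq0 : 0 < q) (hq1 : q < 1) (hr : 1 < r) (s a : ℂ) (w v : State) (u : ℂ)
    (x : ℝ) (h1 : q⁻¹ * ‖zOf q u‖ < q ^ (2 * x))
    (h2 : q ^ (2 * x) < (nome q r)⁻¹ * q⁻¹ * ‖zOf q u‖) :
    (-(a * circ q x fun u' =>
        Fam.prod₂ q (famF q r s) (famPhi q r s) (ctrA q (nome q r)) w v u' u *
        (brP q r (u - u' + Sval s v.2) * br q r 1 /
          (br q r (u - u' - 1 / 2) * brP q r (Sval s v.2 + 1 / 2))))) =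
    a * circ q x fun u' =>
        Fam.prod₂ q (famPhi q r s) (famF q r s) (ctrA q (nome q r)) w v u u' *
        (brP q r (u - u' + Sval s v.2) * br q r 1 /
          (br q r (u - u' + 1 / 2) * brP q r (Sval s v.2 + 1 / 2))) := by
  have hr0 : 0 < r := by linarith
  rw [circ_eq, circ_eq, ← mul_neg, ← intervalIntegral.integral_neg]
  congr 1
  refine intervalIntegral.integral_congr_ae ?_
  filter_upwards [ae_circPt_of_codiscrete hq0 hq1 x
    (eventually_br_ne_zero hq0 hq1 hr0 (u + 1 / 2))] with t h _
  rw [add_sub_right_comm] at h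
  have h' := (br_ne_zero_on_circle hq0 hq1 hr (u := u) (u' := circPt q x t)
    (by rwa [norm_zOf_circPt hq0]) (by rwa [norm_zOf_circPt hq0])).2
  have key := prod₂_Phi_F hq0 hq1 hr s u _ w v h' h
  linear_combination (-(brP q r (u - circPt q x t + Sval s v.2) * br q r 1 /
    brP q r (Sval s v.2 + 1 / 2))) * key

theorem hasSum_Phi_plus (hq0 : 0 < q) (hq1 : q < 1) (hr : 1 < r) (s a : ℂ) (w v : State) (u : ℂ)
    (x' x'' : ℝ) (h1 : q⁻¹ * ‖zOf q u‖ < q ^ (2 * x'))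
    (h2 : q ^ (2 * x') < (nome q r)⁻¹ * q⁻¹ * ‖zOf q u‖)
    (h3 : q⁻¹ * ‖zOf q u‖ < q ^ (2 * x''))
    (h4 : q ^ (2 * x'') < (nome q r)⁻¹ * q⁻¹ * ‖zOf q u‖)
    (h5 : nome q r * q * q ^ (2 * x') < q ^ (2 * x''))
    (h6 : q ^ (2 * x'') < q * q ^ (2 * x')) :
    HasSum (fun n => -(halfF2 q r s a x' x'' (u - r - 1 / 2) w n * PhiMinus q r s u n v))
      (-(a ^ 2 * circ q x' fun u' => circ q x'' fun u'' =>
        Fam.prod₃ q (famF q r s) (famF q r s) (famPhi q r s) (ctrB q (nome q r))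
          (ctrA q (nome q r)) (ctrA q (nome q r)) w v u' u'' u *
        (brP q r (Sval s v.2) * br q r 1 ^ 2 /
            (brP q r (Sval s v.2 - 1 / 2) * brP q r (Sval s v.2 - 1) *
              br q r (2 * Sval s v.2)) *
          (br q r (u - u' + 2 * Sval s v.2 - 3 / 2) * brP q r (u' - u'' + Sval s v.2) *
            br q r (u - u'' + 1 / 2)) /
          (br q r (u - u' - 1 / 2) * br q r (u - u'' - 1 / 2) *
            br q r (u' - u'' + 1 / 2))))) := by
  have hr0 : 0 < r := by linarith
  have hp := nome_pos hq0 r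
  have hp2 := nome_lt_sq hq0 hq1 hr
  have hz := norm_zOf_pos hq0 u
  have hx' := Real.rpow_pos_of_pos hq0 (2 * x')
  have hx'' := Real.rpow_pos_of_pos hq0 (2 * x'')
  have hq' : q < q⁻¹ := hq1.trans ((one_lt_inv₀ hq0).2 hq1)
  have hc : ∀ t, br q r (u - r - 1 / 2 - circPt q x' t) ≠ 0 := fun t =>
    (br_ne_zero_on_circle hq0 hq1 hr (by rwa [norm_zOf_circPt hq0])
      (by rwa [norm_zOf_circPt hq0])).1
  have hc' : ∀ t, br q r (u - r - 1 / 2 - circPt q x'' t) ≠ 0 := fun t =>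
    (br_ne_zero_on_circle hq0 hq1 hr (by rwa [norm_zOf_circPt hq0])
      (by rwa [norm_zOf_circPt hq0])).1
  have hp' : Continuous fun x : ℝ × ℝ => circPt q x' x.1 :=
    (continuous_circPt q x').comp continuous_fst
  have hp'' : Continuous fun x : ℝ × ℝ => circPt q x'' x.2 :=
    (continuous_circPt q x'').comp continuous_snd
  -- On these circles `|z''| < q|z'|`, so the sum over states defining the product of the two
  -- currents converges.
  have hlt : ∀ t t', ‖zOf q (circPt q x'' t' - circPt q x' t)‖ < 1 := fun t t' =>
    Fam.norm_zOf_sub_lt hq0 (by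
      rw [norm_zOf_circPt hq0, norm_zOf_circPt hq0]; nlinarith)
  -- The condition relating the two circles is precisely that `q z'/z''` lies in the zero-free
  -- annulus.
  have hcc : ∀ t t', br q r (u - r - 1 / 2 - circPt q x'' t' -
      (u - r - 1 / 2 - circPt q x' t) + 1 / 2) ≠ 0 := fun t t' => by
    have hn : ‖zOf q (u - r - 1 / 2 - circPt q x'' t' -
      (u - r - 1 / 2 - circPt q x' t) + 1 / 2)‖ = q * q ^ (2 * x') / q ^ (2 * x'') := by
      rw [sub_sub_sub_cancel_left, zOf_add hq0, zOf_half, zOf_sub hq0, norm_mul, norm_div,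
        norm_zOf_circPt hq0, norm_zOf_circPt hq0, Complex.norm_real, Real.norm_of_nonneg hq0.le]
      ring
    refine br_ne_zero_of_norm hq0 hq1 hr0 ?_ ?_
    · rw [hn, one_lt_div hx'']; exact h6
    · rw [hn, ← mul_div_assoc, div_lt_one hx'', ← mul_assoc]; exact h5
  have hG : Continuous fun x : ℝ × ℝ =>
      ctrB q (nome q r) (zOf q (circPt q x'' x.2 - circPt q x' x.1)) := by
    have hz2 : Continuous fun x : ℝ × ℝ => zOf q (circPt q x'' x.2 - circPt q x' x.1) :=
      (continuous_zOf hq0).comp (hp''.sub hp')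
    have hp1 := norm_nome_lt_one hq0 hq1 hr0
    refine continuous_iff_continuousAt.2 fun x => ContinuousAt.comp (g := ctrB q (nome q r))
      (f := fun x : ℝ × ℝ => zOf q (circPt q x'' x.2 - circPt q x' x.1))
      (DifferentiableAt.continuousAt (𝕜 := ℂ) (differentiableAt_ctrB hp1
        (poch_ne_zero_of_norm_lt hp1 ?_) (poch_ne_zero_of_norm_lt hp1 ?_))) hz2.continuousAt
    · simpa using norm_pow_mul_lt hq0 hq1 (hlt x.1 x.2) 1
    · rw [← Complex.ofReal_pow, ← Complex.ofReal_inv, ← Complex.ofReal_mul,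
        norm_ofReal_mul (by positivity)]
      -- The second family of poles of `ctrB` starts at `q² p⁻¹ > 1`, outside the range of `z''/z'`.
      have : nome q r * (q ^ 2)⁻¹ < 1 := by
        rw [← div_eq_mul_inv, div_lt_one (by positivity)]; exact hp2
      have h0 := hlt x.1 x.2
      have h0' := norm_nonneg (zOf q (circPt q x'' x.2 - circPt q x' x.1))
      nlinarith
  have hrad : ∀ y t, q⁻¹ * ‖zOf q u‖ < q ^ (2 * y) → ‖zOf q u‖ < q⁻¹ * ‖zOf q (circPt q y t)‖ := by
    intro y t hy
    rw [norm_zOf_circPt hq0, inv_mul_eq_div, lt_div_iff₀ hq0]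
    nlinarith
  have H := Fam.hasSum_integral_prod₂_mul hq0 hq1 (Fam.hasCtr_famF_famPhi hq0 hq1 hr s)
    (Fam.hasCtr_famF_famPhi hq0 hq1 hr s) (p := fun t _ => circPt q x' t)
    (p' := fun _ t => circPt q x'' t) (G := ctrB q (nome q r)) hp' hp'' hG
    (k := fun t t' z => kF2 q r (u - r - 1 / 2 - circPt q x' t) (u - r - 1 / 2 - circPt q x'' t')
      (Sval s z))
    (fun z => continuous_kF2 hq0 hq1 hr0 (continuous_const.sub hp') (continuous_const.sub hp'')
      (fun x => hc x.1) (fun x => hc' x.2) (fun x => hcc x.1 x.2) _) (u := u)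
    (fun t _ _ _ => hrad x' t h1) (fun _ _ t _ => hrad x'' t h3) w v
  refine hasSum_of_eq (H.mul_left (a ^ 2)).neg (fun n => ?_) ?_
  · simp only [halfF2, circ_eq, curF_eq_op hq0, PhiMinus_eq_op hq0, mul_assoc]
    simp only [(Fam.hasSum_prod₂ hq0 (Fam.hasCtr_famF_famF hq0 hq1 hr s) (hlt _ _) _ _).tsum_eq]
  · simp only [circ_eq]
    have e : v.2 + (famPhi q r s).δ = v.2 + (1, 0) := rfl
    simp only [e, Sval_add_one, kF2_shift hq0 hq1 hr]

/-- Inserts an exchange identity into a kernel whose remaining factors `K`, `N`, `E` are inert; no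
nonvanishing is required. -/
lemma mul_kernel_eq {F P A B C D : ℂ} (h : P / B = F * C / (A * D)) (K N E : ℂ) :
    F * (K * (N * C) / (A * D * E)) = P * (K * N / (B * E)) := by
  linear_combination (-(K * N / E)) * h

theorem circ_Phi_plus (hq0 : 0 < q) (hq1 : q < 1) (hr : 1 < r) (s a : ℂ) (w v : State) (u : ℂ)
    (x' x'' : ℝ) (h1 : q⁻¹ * ‖zOf q u‖ < q ^ (2 * x'))
    (h2 : q ^ (2 * x') < (nome q r)⁻¹ * q⁻¹ * ‖zOf q u‖)
    (h3 : q⁻¹ * ‖zOf q u‖ < q ^ (2 * x''))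
    (h4 : q ^ (2 * x'') < (nome q r)⁻¹ * q⁻¹ * ‖zOf q u‖) :
    (-(a ^ 2 * circ q x' fun u' => circ q x'' fun u'' =>
        Fam.prod₃ q (famF q r s) (famF q r s) (famPhi q r s) (ctrB q (nome q r))
          (ctrA q (nome q r)) (ctrA q (nome q r)) w v u' u'' u *
        (brP q r (Sval s v.2) * br q r 1 ^ 2 /
            (brP q r (Sval s v.2 - 1 / 2) * brP q r (Sval s v.2 - 1) *
              br q r (2 * Sval s v.2)) *
          (br q r (u - u' + 2 * Sval s v.2 - 3 / 2) * brP q r (u' - u'' + Sval s v.2) *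
            br q r (u - u'' + 1 / 2)) /
          (br q r (u - u' - 1 / 2) * br q r (u - u'' - 1 / 2) *
            br q r (u' - u'' + 1 / 2))))) =
    -(a ^ 2 * circ q x' fun u' => circ q x'' fun u'' =>
        Fam.prod₃ q (famPhi q r s) (famF q r s) (famF q r s) (ctrA q (nome q r))
          (ctrA q (nome q r)) (ctrB q (nome q r)) w v u u' u'' *
        (brP q r (Sval s v.2) * br q r 1 ^ 2 /
            (brP q r (Sval s v.2 - 1 / 2) * brP q r (Sval s v.2 - 1) *
              br q r (2 * Sval s v.2)) *
          (br q r (u - u' + 2 * Sval s v.2 - 3 / 2) * brP q r (u' - u'' + Sval s v.2)) /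
          (br q r (u - u' + 1 / 2) * br q r (u' - u'' + 1 / 2)))) := by
  have hr0 : 0 < r := by linarith
  simp only [circ_eq]
  refine congrArg (fun I => -(a ^ 2 * I)) ?_
  refine intervalIntegral.integral_congr_ae ?_
  filter_upwards [ae_circPt_of_codiscrete hq0 hq1 x'
    (eventually_br_ne_zero hq0 hq1 hr0 (u + 1 / 2))] with t h _
  refine intervalIntegral.integral_congr_ae ?_
  filter_upwards [ae_circPt_of_codiscrete hq0 hq1 x''
    (eventually_br_ne_zero hq0 hq1 hr0 (u + 1 / 2))] with t' h' _
  rw [add_sub_right_comm] at h h'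
  have hn := (br_ne_zero_on_circle hq0 hq1 hr (u := u) (u' := circPt q x' t)
    (by rwa [norm_zOf_circPt hq0]) (by rwa [norm_zOf_circPt hq0])).2
  have hn' := (br_ne_zero_on_circle hq0 hq1 hr (u := u) (u' := circPt q x'' t')
    (by rwa [norm_zOf_circPt hq0]) (by rwa [norm_zOf_circPt hq0])).2
  have key := prod₃_Phi_F_F hq0 hq1 hr s u _ _ w v hn h hn' h'
  exact mul_kernel_eq key _ _ _

end


/-! ### The type-II vertex operators -/

lemma Loop.integral_congr {q : ℝ} (γ : Loop q) {f g : ℂ → ℂ}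
    (h : ∀ t, f (γ.path t) = g (γ.path t)) : γ.integral f = γ.integral g := by
  simp only [Loop.integral, Loop.integralAux, h]

lemma Loop.integral₂_congr {q : ℝ} (γ : Loop q) (η : ℝ → Loop q) {f g : ℂ → ℂ → ℂ}
    (h : ∀ t t', f (γ.path t) ((η t).path t') = g (γ.path t) ((η t).path t')) :
    γ.integral₂ η f = γ.integral₂ η g := by
  simp only [Loop.integral₂, Loop.integralAux, Loop.integral, h]

lemma Loop.integral_neg {q : ℝ} (γ : Loop q) (f : ℂ → ℂ) :
    γ.integral (fun u => -f u) = -γ.integral f := by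
  simp only [Loop.integral, Loop.integralAux, neg_mul, intervalIntegral.integral_neg, mul_neg]

lemma Loop.continuous_path {q : ℝ} (γ : Loop q) : Continuous γ.path := γ.smooth.continuous

lemma Loop.continuous_deriv_path {q : ℝ} (γ : Loop q) : Continuous (deriv γ.path) :=
  γ.smooth.continuous_deriv le_rfl

lemma continuous_kE0 {T : Type*} [TopologicalSpace T] {q r : ℝ} (hq0 : 0 < q) (hq1 : q < 1)
    (hr : 0 < r - 1) {y : T → ℂ} (hy : Continuous y) (h : ∀ t, br q (r - 1) (y t + 1 / 2) ≠ 0)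
    (P : ℂ) : Continuous fun t => kE0 q r (y t) P := by
  have hb := (differentiable_br hq0 hq1 hr).continuous
  have hP := (differentiable_brP hq0 hq1 hr).continuous
  simp only [kE0, ← div_div]
  exact ((((hP.comp ((hy.sub continuous_const).add continuous_const)).mul
    continuous_const)).div (hb.comp (hy.add continuous_const)) h).div_const _

lemma continuous_kE2 {T : Type*} [TopologicalSpace T] {q r : ℝ} (hq0 : 0 < q) (hq1 : q < 1)
    (hr : 0 < r - 1) {y d : T → ℂ} (hy : Continuous y) (hd : Continuous d)
    (h : ∀ t, br q (r - 1) (y t + 1 / 2) ≠ 0) (h' : ∀ t, br q (r - 1) (d t - 1 / 2) ≠ 0) (P : ℂ) :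
    Continuous fun t => kE2 q r (y t) (d t) P := by
  have hb := (differentiable_br hq0 hq1 hr).continuous
  have hP := (differentiable_brP hq0 hq1 hr).continuous
  refine Continuous.div (continuous_const.mul ((hb.comp ?_).mul (hP.comp ?_)))
    ((hb.comp ?_).mul (hb.comp ?_)) fun t => mul_ne_zero (h t) (h' t)
  all_goals fun_prop

section

variable {q r : ℝ}

/-- the kernel of `E_{-,0}(u - 1 - r*)` next to `Ψ*_-(u)` -/
lemma kE0_shift (hq0 : 0 < q) (hq1 : q < 1) (hr : 1 < r) (u u' P : ℂ) :
    kE0 q r (u - 1 - (r - 1) - u') P =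
      -(brP q (r - 1) (u - u' - P) * br q (r - 1) 1 /
        (br q (r - 1) (u - u' - 1 / 2) * brP q (r - 1) (P - 1 / 2))) := by
  have hr0 : 0 < r - 1 := by linarith
  -- The half current now acts first, so `P` is that of the initial vector and is not shifted, in
  -- contrast with `S` for type I.
  have e1 : u - 1 - (r - 1) - u' - P + 1 = u - u' - P - ((r - 1 : ℝ) : ℂ) := by push_cast; ring
  have e2 : u - 1 - (r - 1) - u' + 1 / 2 = u - u' - 1 / 2 - ((r - 1 : ℝ) : ℂ) := by
    push_cast; ring
  rw [kE0, e1, e2, br_sub_nome hq0 hq1 hr0, brP_sub_nome hq0 hq1 hr0, neg_mul, div_neg]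

/-- the kernel of `E_{-,+}(u - 1 - r*)` next to `Ψ*_-(u)` -/
lemma kE2_shift (hq0 : 0 < q) (hq1 : q < 1) (hr : 1 < r) (u u' d P : ℂ) :
    kE2 q r (u - 1 - (r - 1) - u') d P =
      br q (r - 1) 1 ^ 2 / (brP q (r - 1) (P - 1 / 2) * br q (r - 1) (2 * P - 2)) *
        (br q (r - 1) (u - u' - 2 * P + 3 / 2) * brP q (r - 1) (d - P)) /
        (br q (r - 1) (u - u' - 1 / 2) * br q (r - 1) (d - 1 / 2)) := by
  have hr0 : 0 < r - 1 := by linarith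
  have e1 : u - 1 - (r - 1) - u' - 2 * P + 5 / 2 =
      u - u' - 2 * P + 3 / 2 - ((r - 1 : ℝ) : ℂ) := by push_cast; ring
  have e2 : u - 1 - (r - 1) - u' + 1 / 2 = u - u' - 1 / 2 - ((r - 1 : ℝ) : ℂ) := by
    push_cast; ring
  rw [kE2, e1, e2, br_sub_nome hq0 hq1 hr0, br_sub_nome hq0 hq1 hr0, neg_mul, neg_mul, mul_neg,
    neg_div_neg_eq]

/-- exchange of `Ψ*_-` and `E` -/
lemma prod₂_Psi_E (hq0 : 0 < q) (hq1 : q < 1) (hr : 1 < r) (s u u' : ℂ) (w v : State)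
    (h1 : br q (r - 1) (u - u' - 1 / 2) ≠ 0) (h2 : br q (r - 1) (u - u' + 1 / 2) ≠ 0) :
    Fam.prod₂ q (famPsi q r s) (famE q r s) (ctrA (q : ℂ)⁻¹ (nome q (r - 1))) w v u u' /
        br q (r - 1) (u - u' - 1 / 2) =
      -(Fam.prod₂ q (famE q r s) (famPsi q r s) (ctrA (q : ℂ)⁻¹ (nome q (r - 1))) w v u' u /
        br q (r - 1) (u - u' + 1 / 2)) := by
  have key := br_mul_ctrA_typeII hq0 hq1 hr _ h2 h1
  rw [Fam.prod₂, (Fam.local_famPsi_famE s (by linarith)).nop₂_comm hq0, Fam.prod₂,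
    Fam.nop₂_eq_mul, Fam.nop₂_eq_mul (g := ctrA _ _ _), ← neg_sub u u', ← neg_div,
    div_eq_div_iff h1 h2]
  linear_combination Fam.nop₂ q (famE q r s) (famPsi q r s) 1 u' u w v * key

/-- exchange of `Ψ*_-` and `E E` -/
lemma prod₃_Psi_E_E (hq0 : 0 < q) (hq1 : q < 1) (hr : 1 < r) (s u u' u'' : ℂ) (w v : State)
    (h1 : br q (r - 1) (u - u' - 1 / 2) ≠ 0) (h2 : br q (r - 1) (u - u' + 1 / 2) ≠ 0)
    (h3 : br q (r - 1) (u - u'' - 1 / 2) ≠ 0) (h4 : br q (r - 1) (u - u'' + 1 / 2) ≠ 0) :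
    Fam.prod₃ q (famPsi q r s) (famE q r s) (famE q r s) (ctrA (q : ℂ)⁻¹ (nome q (r - 1)))
        (ctrA (q : ℂ)⁻¹ (nome q (r - 1))) (ctrB (q : ℂ)⁻¹ (nome q (r - 1))) w v u u' u'' /
        br q (r - 1) (u - u' - 1 / 2) =
      Fam.prod₃ q (famE q r s) (famE q r s) (famPsi q r s) (ctrB (q : ℂ)⁻¹ (nome q (r - 1)))
        (ctrA (q : ℂ)⁻¹ (nome q (r - 1))) (ctrA (q : ℂ)⁻¹ (nome q (r - 1))) w v u' u'' u *
        br q (r - 1) (u - u'' - 1 / 2) /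
        (br q (r - 1) (u - u' + 1 / 2) * br q (r - 1) (u - u'' + 1 / 2)) := by
  have key := br_mul_ctrA_typeII hq0 hq1 hr _ h2 h1
  have key' := br_mul_ctrA_typeII hq0 hq1 hr _ h4 h3
  have hl := Fam.local_famPsi_famE (q := q) s (by linarith : r - 1 ≠ 0)
  rw [Fam.prod₃, hl.nop₃_rotate hq0 hl, Fam.prod₃, Fam.nop₃_eq_mul,
    Fam.nop₃_eq_mul (g := ctrB _ _ _ * _ * _), ← neg_sub u u', ← neg_sub u u'',
    div_eq_div_iff h1 (mul_ne_zero h2 h4)]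
  generalize Fam.nop₃ q (famE q r s) (famE q r s) (famPsi q r s) 1 u' u'' u w v = N
  generalize ctrB _ _ _ = B
  generalize ctrA _ _ (zOf q (-(u - u'))) = A1 at *
  generalize ctrA _ _ (zOf q (-(u - u''))) = A2 at *
  linear_combination N * B * br q (r - 1) (u - u'' + 1 / 2) *
    (A2 * (1 * zpw q (u - u'') (-1 - 1 / ((r : ℂ) - 1)))) * key -
    N * B * br q (r - 1) (u - u' - 1 / 2) * ctrA (q : ℂ)⁻¹ (nome q (r - 1)) (zOf q (u - u')) * key'

/-- the theta functions of `u - u'` do not vanish when `z'` runs along a contour around `z` -/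
lemma br_ne_zero_on_loop (hq0 : 0 < q) (hq1 : q < 1) (hr : 1 < r) {γ : Loop q} {u : ℂ}
    (h : γ.Btw (nome q (r - 1)) ((q : ℂ)⁻¹ * zOf q u) ((q : ℂ) * zOf q u)) (t : ℝ) :
    br q (r - 1) (u - γ.path t - 1 / 2) ≠ 0 ∧ br q (r - 1) (u - γ.path t + 1 / 2) ≠ 0 := by
  have hr0 : 0 < r - 1 := by linarith
  have hq := ofReal_ne_zero_of_pos hq0
  have hz' := zOf_ne_zero hq0 (γ.path t)
  have hp := nome_ne_zero hq0 (r - 1)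
  refine ⟨br_ne_zero hq0 hq1 hr0 fun k hk => (h.2 (-k) t).1 ?_,
    br_ne_zero hq0 hq1 hr0 fun k hk => (h.2 (-k) t).2 ?_⟩
  · rw [zOf_sub hq0, zOf_sub hq0, zOf_half] at hk
    rw [zpow_neg, ← hk, Loop.pt]
    have hz := zOf_ne_zero hq0 u
    field_simp
  · rw [zOf_add hq0, zOf_sub hq0, zOf_half] at hk
    rw [zpow_neg, ← hk, Loop.pt]
    have hz := zOf_ne_zero hq0 u
    field_simp

lemma br_add_half_ne_zero_on_circle (hq0 : 0 < q) (hq1 : q < 1) (hr : 1 < r) {u₀ : ℂ} {x : ℝ}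
    (h1 : nome q (r - 1) * q * ‖zOf q u₀‖ < q ^ (2 * x)) (h2 : q ^ (2 * x) < q * ‖zOf q u₀‖)
    (t : ℝ) : br q (r - 1) (u₀ - circPt q x t + 1 / 2) ≠ 0 := by
  have hx := Real.rpow_pos_of_pos hq0 (2 * x)
  have hn : ‖zOf q (u₀ - circPt q x t + 1 / 2)‖ = q * ‖zOf q u₀‖ / q ^ (2 * x) := by
    rw [zOf_add hq0, zOf_sub hq0, zOf_half, norm_mul, norm_div, norm_zOf_circPt hq0,
      Complex.norm_real, Real.norm_of_nonneg hq0.le]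
    ring
  refine br_ne_zero_of_norm hq0 hq1 (sub_pos.2 hr) ?_ ?_
  · rw [hn, one_lt_div hx]; exact h2
  · rw [hn, ← mul_div_assoc, div_lt_one hx, ← mul_assoc]; exact h1

/-- The first two inequalities keep the kernel regular and the third is convergence of `Ψ*_- E`.
They are compatible only for suitable `u₀`, not at `u₀ = u - 1 - r*`. -/
theorem hasSum_Psi_zero (hq0 : 0 < q) (hq1 : q < 1) (hr : 1 < r) (s b : ℂ) (w v : State)
    (u u₀ : ℂ) (x : ℝ) (h1 : nome q (r - 1) * q * ‖zOf q u₀‖ < q ^ (2 * x))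
    (h2 : q ^ (2 * x) < q * ‖zOf q u₀‖) (h3 : q ^ (2 * x) < q * ‖zOf q u‖) :
    HasSum (fun n => PsiMinus q r s u w n * halfE0 q r s b x u₀ n v)
      (b * circ q x fun u' =>
        Fam.prod₂ q (famPsi q r s) (famE q r s) (ctrA (q : ℂ)⁻¹ (nome q (r - 1))) w v u u' *
          kE0 q r (u₀ - u') (Pval s v.2)) := by
  have H := Fam.hasSum_op_mul_integral hq0 hq1 (Fam.hasCtr_famPsi_famE hq0 hq1 hr s)
    (continuous_circPt q x) (k := fun t z => kE0 q r (u₀ - circPt q x t) (Pval s z))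
    (fun z => continuous_kE0 hq0 hq1 (sub_pos.2 hr)
      (continuous_const.sub (continuous_circPt q x))
      (br_add_half_ne_zero_on_circle hq0 hq1 hr h1 h2) _)
    (u := u) (fun t _ => by rwa [norm_zOf_circPt hq0]) w v
  refine hasSum_of_eq (H.mul_left b) (fun n => ?_) rfl
  rw [halfE0, circ_eq, curE_eq_op hq0, PsiMinus_eq_op hq0, mul_left_comm]

/-- The product `E E` enters through its continuation, so only its poles must be avoided.
Convergence concerns `Ψ*_-` against each of the two points, `|z'|` and `|z''|` both below `q|z|`. -/
theorem hasSum_Psi_plus (hq0 : 0 < q) (hq1 : q < 1) (hr : 1 < r) (s b : ℂ) (w v : State)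
    (u u₀ : ℂ) (x : ℝ) (h1 : nome q (r - 1) * q * ‖zOf q u₀‖ < q ^ (2 * x))
    (h2 : q ^ (2 * x) < q * ‖zOf q u₀‖) (h3 : q ^ (2 * x) < q * ‖zOf q u‖) (η : Loop q)
    (hη : η.Btw (nome q (r - 1)) ((q : ℂ)⁻¹) (q : ℂ))
    (hη' : ∀ k : ℕ, η.Excl (((q : ℂ) ^ 2)⁻¹ * ((nome q (r - 1) : ℂ) ^ (k + 1))⁻¹))
    (hη'' : ∀ t, ‖η.pt t‖ * q ^ (2 * x) < q * ‖zOf q u‖) :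
    HasSum (fun n => PsiMinus q r s u w n * halfE2 q r s b
        (Fam.prod₂ q (famE q r s) (famE q r s) (ctrB (q : ℂ)⁻¹ (nome q (r - 1)))) x η u₀ n v)
      (b ^ 2 * circ q x fun u' => η.integral fun y =>
        Fam.prod₃ q (famPsi q r s) (famE q r s) (famE q r s) (ctrA (q : ℂ)⁻¹ (nome q (r - 1)))
          (ctrA (q : ℂ)⁻¹ (nome q (r - 1))) (ctrB (q : ℂ)⁻¹ (nome q (r - 1))) w v u u' (u' + y) *
          kE2 q r (u₀ - u') (-y) (Pval s v.2)) := by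
  have hr0 : 0 < r - 1 := sub_pos.2 hr
  have hp : Continuous fun x' : ℝ × ℝ => circPt q x x'.1 :=
    (continuous_circPt q x).comp continuous_fst
  have hy : Continuous fun x' : ℝ × ℝ => η.path x'.2 := η.continuous_path.comp continuous_snd
  have hG : Continuous fun x' : ℝ × ℝ => ctrB (q : ℂ)⁻¹ (nome q (r - 1))
      (zOf q (circPt q x x'.1 + η.path x'.2 - circPt q x x'.1)) := by
    simp only [add_sub_cancel_left]
    refine continuous_iff_continuousAt.2 fun x' => ContinuousAt.comp
      (g := ctrB (q : ℂ)⁻¹ (nome q (r - 1))) (f := fun x' : ℝ × ℝ => zOf q (η.path x'.2))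
      (DifferentiableAt.continuousAt (𝕜 := ℂ) (differentiableAt_ctrB_typeII hq0 hq1 hr ?_))
      ((continuous_zOf hq0).comp hy).continuousAt
    -- The two families of poles of `ctrB` in `z''/z'` are excluded by `hη` and `hη'` respectively.
    rintro ⟨k, h | h⟩
    · refine (hη.2 (-(k : ℤ)) x'.2).2 (h.trans ?_)
      rw [zpow_neg, zpow_natCast]
      push_cast
      rfl
    · refine (hη' k).1 x'.2 (h.trans ?_)
      push_cast
      rfl
  have hd : ∀ t, br q (r - 1) (-η.path t - 1 / 2) ≠ 0 := fun t => by
    refine br_ne_zero hq0 hq1 hr0 fun k hk => (hη.2 (-k) t).1 ?_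
    have hq := ofReal_ne_zero_of_pos hq0
    have hz := zOf_ne_zero hq0 (η.path t)
    rw [zOf_sub hq0, zOf_neg, zOf_half] at hk
    rw [zpow_neg, ← hk, Loop.pt]
    field_simp
  have H := Fam.hasSum_mul_integral_prod₂ hq0 hq1 (Fam.hasCtr_famPsi_famE hq0 hq1 hr s)
    (Fam.hasCtr_famPsi_famE hq0 hq1 hr s) (p := fun t _ => circPt q x t)
    (p' := fun t t' => circPt q x t + η.path t') (G := ctrB (q : ℂ)⁻¹ (nome q (r - 1)))
    hp (hp.add hy) hG
    -- The normalization and the derivative of the loop are absorbed into the kernel, so that the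
    -- loop integral becomes an ordinary integral over `[0, 1]`.
    (k := fun t t' z => (Real.log q : ℂ) / ((Real.pi : ℂ) * Complex.I) *
      (kE2 q r (u₀ - circPt q x t) (-η.path t') (Pval s z) * deriv η.path t'))
    (fun z => continuous_const.mul ((continuous_kE2 hq0 hq1 hr0 (continuous_const.sub hp) hy.neg
      (fun x' => br_add_half_ne_zero_on_circle hq0 hq1 hr h1 h2 x'.1) (fun x' => hd x'.2) _).mul
      (η.continuous_deriv_path.comp continuous_snd))) (u := u)
    (fun t _ _ _ => by rwa [norm_zOf_circPt hq0])
    (fun t _ t' _ => by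
      rw [zOf_add hq0, norm_mul, norm_zOf_circPt hq0, mul_comm]; exact hη'' t') w v
  refine hasSum_of_eq (H.mul_left (b ^ 2)) (fun n => ?_) ?_
  · rw [halfE2, circ_eq, PsiMinus_eq_op hq0, mul_left_comm]
    simp only [Loop.integral, Loop.integralAux, ← intervalIntegral.integral_const_mul]
    simp only [mul_assoc, mul_left_comm ((Real.log q : ℂ) / ((Real.pi : ℂ) * Complex.I))]
  · rw [circ_eq]
    simp only [Loop.integral, Loop.integralAux, ← intervalIntegral.integral_const_mul]
    simp only [mul_assoc, mul_left_comm ((Real.log q : ℂ) / ((Real.pi : ℂ) * Complex.I))]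

/-- The loop avoids every zero of the brackets involved, so the exchange identity holds at each of
its points and needs no null-set argument. -/
theorem loop_Psi_zero (hq0 : 0 < q) (hq1 : q < 1) (hr : 1 < r) (s : ℂ) (w v : State) (u : ℂ)
    (γ : Loop q) (h : γ.Btw (nome q (r - 1)) ((q : ℂ)⁻¹ * zOf q u) ((q : ℂ) * zOf q u)) :
    γ.integral (fun u' =>
        Fam.prod₂ q (famPsi q r s) (famE q r s) (ctrA (q : ℂ)⁻¹ (nome q (r - 1))) w v u u' *
          kE0 q r (u - 1 - (r - 1) - u') (Pval s v.2)) =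
      γ.integral fun u' =>
        Fam.prod₂ q (famE q r s) (famPsi q r s) (ctrA (q : ℂ)⁻¹ (nome q (r - 1))) w v u' u *
        (brP q (r - 1) (u - u' - Pval s v.2) * br q (r - 1) 1 /
          (br q (r - 1) (u - u' + 1 / 2) * brP q (r - 1) (Pval s v.2 - 1 / 2))) := by
  refine γ.integral_congr fun t => ?_
  obtain ⟨h1, h2⟩ := br_ne_zero_on_loop hq0 hq1 hr h t
  have key := prod₂_Psi_E hq0 hq1 hr s u _ w v h1 h2
  rw [kE0_shift hq0 hq1 hr]
  linear_combination (-(brP q (r - 1) (u - γ.path t - Pval s v.2) * br q (r - 1) 1 /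
    brP q (r - 1) (Pval s v.2 - 1 / 2))) * key

theorem loop_Psi_plus (hq0 : 0 < q) (hq1 : q < 1) (hr : 1 < r) (s : ℂ) (w v : State) (u : ℂ)
    (γ : Loop q) (η : ℝ → Loop q)
    (h : γ.Btw (nome q (r - 1)) ((q : ℂ)⁻¹ * zOf q u) ((q : ℂ) * zOf q u))
    (h' : ∀ t, (η t).Btw (nome q (r - 1)) ((q : ℂ)⁻¹ * zOf q u) ((q : ℂ) * zOf q u)) :
    (γ.integral₂ η fun u' u'' =>
        Fam.prod₃ q (famPsi q r s) (famE q r s) (famE q r s) (ctrA (q : ℂ)⁻¹ (nome q (r - 1)))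
          (ctrA (q : ℂ)⁻¹ (nome q (r - 1))) (ctrB (q : ℂ)⁻¹ (nome q (r - 1))) w v u u' u'' *
          kE2 q r (u - 1 - (r - 1) - u') (u' - u'') (Pval s v.2)) =
      γ.integral₂ η fun u' u'' =>
        Fam.prod₃ q (famE q r s) (famE q r s) (famPsi q r s) (ctrB (q : ℂ)⁻¹ (nome q (r - 1)))
          (ctrA (q : ℂ)⁻¹ (nome q (r - 1))) (ctrA (q : ℂ)⁻¹ (nome q (r - 1))) w v u' u'' u *
        (br q (r - 1) 1 ^ 2 /
            (brP q (r - 1) (Pval s v.2 - 1 / 2) * br q (r - 1) (2 * Pval s v.2 - 2)) *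
          (br q (r - 1) (u - u' - 2 * Pval s v.2 + 3 / 2) *
            brP q (r - 1) (u' - u'' - Pval s v.2) * br q (r - 1) (u - u'' - 1 / 2)) /
          (br q (r - 1) (u - u' + 1 / 2) * br q (r - 1) (u - u'' + 1 / 2) *
            br q (r - 1) (u' - u'' - 1 / 2))) := by
  refine γ.integral₂_congr η fun t t' => ?_
  obtain ⟨h1, h2⟩ := br_ne_zero_on_loop hq0 hq1 hr h t
  obtain ⟨h3, h4⟩ := br_ne_zero_on_loop hq0 hq1 hr (h' t) t'
  have key := prod₃_Psi_E_E hq0 hq1 hr s u _ _ w v h1 h2 h3 h4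
  rw [kE2_shift hq0 hq1 hr]
  exact (mul_kernel_eq key _ _ _).symm

end

end EllA22

end

/-! ### The theorem -/

open EllA22 in
theorem mainTheorem7 (q r : ℝ) (hq0 : 0 < q) (hq1 : q < 1) (hr : 1 < r) (s : ℂ)
    (hs : Generic q r s) (a b : ℂ) :
    -- conditions on the highest type-I component
    ExchangeRel q (fun u₂ => PhiMinus q r s (u₂ + 1 / 2)) (curKm q r s)
      (fun u₂ u₁ => rhoPlus q r (u₁ - u₂)) ∧
    ExchangeRel q (PhiMinus q r s) (curE q r s) (fun _ _ => 1) ∧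
    (∀ u w v, PhiMinus q r s u w v * Pval s v.2 = Pval s w.2 * PhiMinus q r s u w v) ∧
    ExchangeRel q (PhiMinus q r s) (curF q r s)
      (fun u₁ u₂ => -(br q r (u₁ - u₂ + 1 / 2) / br q r (u₁ - u₂ - 1 / 2))) ∧
    -- conditions on the highest type-II component
    ExchangeRel q (curKm q r s) (fun u₂ => PsiMinus q r s (u₂ + 1))
      (fun u₁ u₂ => rhoPlus q (r - 1) (u₁ - u₂)) ∧
    ExchangeRel q (PsiMinus q r s) (curF q r s) (fun _ _ => 1) ∧
    (∀ u w v, PsiMinus q r s u w v * Sval s v.2 = Sval s w.2 * PsiMinus q r s u w v) ∧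
    ExchangeRel q (PsiMinus q r s) (curE q r s)
      (fun u₁ u₂ => -(br q (r - 1) (u₁ - u₂ - 1 / 2) / br q (r - 1) (u₁ - u₂ + 1 / 2))) ∧
    -- the type-I components `Φ_0 = F_{0,-}(u - r - 1/2) Φ_-(u)`
    -- and `Φ_+ = - F_{+,-}(u - r - 1/2) Φ_-(u)`
    (∃ (PF FP : State → State → ℂ → ℂ → ℂ) (PFF FFP : State → State → ℂ → ℂ → ℂ → ℂ),
      (∀ w v, IsCont₂ q (PhiMinus q r s) (curF q r s) (Dom₂ q (polPhiF q r)) w v (PF w v) ∧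
        IsCont₂ q (curF q r s) (PhiMinus q r s) (Dom₂ q (polPhiF q r)) w v (FP w v) ∧
        IsCont₃ q (PhiMinus q r s) (curF q r s) (curF q r s)
          (Dom₃ q (polPhiF q r) (polPhiF q r) (polFF q r)) w v (PFF w v) ∧
        IsCont₃ q (curF q r s) (curF q r s) (PhiMinus q r s)
          (Dom₃ q (polFF q r) (polPhiF q r) (polPhiF q r)) w v (FFP w v)) ∧
      (∀ (w v : State) (u : ℂ) (x : ℝ),
        q⁻¹ * ‖zOf q u‖ < q ^ (2 * x) → q ^ (2 * x) < (nome q r)⁻¹ * q⁻¹ * ‖zOf q u‖ →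
        HasSum (fun n => halfF0 q r s a x (u - r - 1 / 2) w n * PhiMinus q r s u n v)
          (a * circ q x fun u' => PF w v u u' *
            (brP q r (u - u' + Sval s v.2) * br q r 1 /
              (br q r (u - u' + 1 / 2) * brP q r (Sval s v.2 + 1 / 2)))) ∧
        HasSum (fun n => halfF0 q r s a x (u - r - 1 / 2) w n * PhiMinus q r s u n v)
          (-(a * circ q x fun u' => FP w v u' u *
            (brP q r (u - u' + Sval s v.2) * br q r 1 /
              (br q r (u - u' - 1 / 2) * brP q r (Sval s v.2 + 1 / 2)))))) ∧
      (∀ (w v : State) (u : ℂ) (x' x'' : ℝ),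
        q⁻¹ * ‖zOf q u‖ < q ^ (2 * x') → q ^ (2 * x') < (nome q r)⁻¹ * q⁻¹ * ‖zOf q u‖ →
        q⁻¹ * ‖zOf q u‖ < q ^ (2 * x'') → q ^ (2 * x'') < (nome q r)⁻¹ * q⁻¹ * ‖zOf q u‖ →
        nome q r * q * q ^ (2 * x') < q ^ (2 * x'') → q ^ (2 * x'') < q * q ^ (2 * x') →
        HasSum (fun n => -(halfF2 q r s a x' x'' (u - r - 1 / 2) w n * PhiMinus q r s u n v))
          (-(a ^ 2 * circ q x' fun u' => circ q x'' fun u'' => PFF w v u u' u'' *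
            (brP q r (Sval s v.2) * br q r 1 ^ 2 /
                (brP q r (Sval s v.2 - 1 / 2) * brP q r (Sval s v.2 - 1) *
                  br q r (2 * Sval s v.2)) *
              (br q r (u - u' + 2 * Sval s v.2 - 3 / 2) * brP q r (u' - u'' + Sval s v.2)) /
              (br q r (u - u' + 1 / 2) * br q r (u' - u'' + 1 / 2))))) ∧
        HasSum (fun n => -(halfF2 q r s a x' x'' (u - r - 1 / 2) w n * PhiMinus q r s u n v))
          (-(a ^ 2 * circ q x' fun u' => circ q x'' fun u'' => FFP w v u' u'' u *
            (brP q r (Sval s v.2) * br q r 1 ^ 2 /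
                (brP q r (Sval s v.2 - 1 / 2) * brP q r (Sval s v.2 - 1) *
                  br q r (2 * Sval s v.2)) *
              (br q r (u - u' + 2 * Sval s v.2 - 3 / 2) * brP q r (u' - u'' + Sval s v.2) *
                br q r (u - u'' + 1 / 2)) /
              (br q r (u - u' - 1 / 2) * br q r (u - u'' - 1 / 2) *
                br q r (u' - u'' + 1 / 2))))))) ∧
    -- the type-II components `Ψ*_0 = Ψ*_-(u) E_{-,0}(u - 1 - r*)`
    -- and `Ψ*_+ = - Ψ*_-(u) E_{-,+}(u - 1 - r*)`
    (∃ (PE EP EE : State → State → ℂ → ℂ → ℂ) (PEE EEP : State → State → ℂ → ℂ → ℂ → ℂ),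
      (∀ w v, IsCont₂ q (PsiMinus q r s) (curE q r s) (Dom₂ q (polPsiE q r)) w v (PE w v) ∧
        IsCont₂ q (curE q r s) (PsiMinus q r s) (Dom₂ q (polPsiE q r)) w v (EP w v) ∧
        IsCont₂ q (curE q r s) (curE q r s) (Dom₂ q (polEE q r)) w v (EE w v) ∧
        IsCont₃ q (PsiMinus q r s) (curE q r s) (curE q r s)
          (Dom₃ q (polPsiE q r) (polPsiE q r) (polEE q r)) w v (PEE w v) ∧
        IsCont₃ q (curE q r s) (curE q r s) (PsiMinus q r s)
          (Dom₃ q (polEE q r) (polPsiE q r) (polPsiE q r)) w v (EEP w v)) ∧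
      -- where `Ψ*_-(u) E_{-,0}(u₀)` and `Ψ*_-(u) E_{-,+}(u₀)` converge, they are contour integrals
      -- of the products of currents
      (∀ (w v : State) (u u₀ : ℂ) (x : ℝ),
        nome q (r - 1) * q * ‖zOf q u₀‖ < q ^ (2 * x) → q ^ (2 * x) < q * ‖zOf q u₀‖ →
        q ^ (2 * x) < q * ‖zOf q u‖ →
        HasSum (fun n => PsiMinus q r s u w n * halfE0 q r s b x u₀ n v)
          (b * circ q x fun u' => PE w v u u' * kE0 q r (u₀ - u') (Pval s v.2)) ∧
        ∀ η : Loop q, η.Btw (nome q (r - 1)) ((q : ℂ)⁻¹) (q : ℂ) →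
          (∀ k : ℕ, η.Excl (((q : ℂ) ^ 2)⁻¹ * ((nome q (r - 1) : ℂ) ^ (k + 1))⁻¹)) →
          (∀ t, ‖η.pt t‖ * q ^ (2 * x) < q * ‖zOf q u‖) →
          HasSum (fun n => PsiMinus q r s u w n * halfE2 q r s b EE x η u₀ n v)
            (b ^ 2 * circ q x fun u' => η.integral fun y =>
              PEE w v u u' (u' + y) * kE2 q r (u₀ - u') (-y) (Pval s v.2))) ∧
      -- `Ψ*_0(u)`: the same integral at `u₀ = u - 1 - r*`, on the contour `C*_0`
      (∀ (w v : State) (u : ℂ) (γ : Loop q),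
        γ.Btw (nome q (r - 1)) ((q : ℂ)⁻¹ * zOf q u) ((q : ℂ) * zOf q u) →
        b * γ.integral (fun u' => PE w v u u' * kE0 q r (u - 1 - (r - 1) - u') (Pval s v.2)) =
          -(b * γ.integral fun u' => PE w v u u' *
            (brP q (r - 1) (u - u' - Pval s v.2) * br q (r - 1) 1 /
              (br q (r - 1) (u - u' - 1 / 2) * brP q (r - 1) (Pval s v.2 - 1 / 2)))) ∧
        b * γ.integral (fun u' => PE w v u u' * kE0 q r (u - 1 - (r - 1) - u') (Pval s v.2)) =
          b * γ.integral fun u' => EP w v u' u *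
            (brP q (r - 1) (u - u' - Pval s v.2) * br q (r - 1) 1 /
              (br q (r - 1) (u - u' + 1 / 2) * brP q (r - 1) (Pval s v.2 - 1 / 2)))) ∧
      -- `Ψ*_+(u)`, on the contour `C*_+`
      (∀ (w v : State) (u : ℂ) (γ : Loop q) (η : ℝ → Loop q),
        γ.Btw (nome q (r - 1)) ((q : ℂ)⁻¹ * zOf q u) ((q : ℂ) * zOf q u) →
        γ.Btw (nome q (r - 1)) (((q : ℂ) ^ 2)⁻¹ * zOf q u) ((q : ℂ) ^ 2 * zOf q u) →
        (∀ t, (η t).Btw (nome q (r - 1)) ((q : ℂ)⁻¹ * zOf q u) ((q : ℂ) * zOf q u) ∧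
          (η t).Btw (nome q (r - 1)) ((q : ℂ)⁻¹ * γ.pt t) ((q : ℂ) * γ.pt t) ∧
          ∀ k : ℕ, (η t).Excl
            (((q : ℂ) ^ 2)⁻¹ * ((nome q (r - 1) : ℂ) ^ (k + 1))⁻¹ * γ.pt t)) →
        -(b ^ 2 * γ.integral₂ η fun u' u'' => PEE w v u u' u'' *
            kE2 q r (u - 1 - (r - 1) - u') (u' - u'') (Pval s v.2)) =
          -(b ^ 2 * γ.integral₂ η fun u' u'' => PEE w v u u' u'' *
            (br q (r - 1) 1 ^ 2 /
                (brP q (r - 1) (Pval s v.2 - 1 / 2) * br q (r - 1) (2 * Pval s v.2 - 2)) *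
              (br q (r - 1) (u - u' - 2 * Pval s v.2 + 3 / 2) *
                brP q (r - 1) (u' - u'' - Pval s v.2)) /
              (br q (r - 1) (u - u' - 1 / 2) * br q (r - 1) (u' - u'' - 1 / 2)))) ∧
        -(b ^ 2 * γ.integral₂ η fun u' u'' => PEE w v u u' u'' *
            kE2 q r (u - 1 - (r - 1) - u') (u' - u'') (Pval s v.2)) =
          -(b ^ 2 * γ.integral₂ η fun u' u'' => EEP w v u' u'' u *
            (br q (r - 1) 1 ^ 2 /
                (brP q (r - 1) (Pval s v.2 - 1 / 2) * br q (r - 1) (2 * Pval s v.2 - 2)) *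
              (br q (r - 1) (u - u' - 2 * Pval s v.2 + 3 / 2) *
                brP q (r - 1) (u' - u'' - Pval s v.2) * br q (r - 1) (u - u'' - 1 / 2)) /
              (br q (r - 1) (u - u' + 1 / 2) * br q (r - 1) (u - u'' + 1 / 2) *
                br q (r - 1) (u' - u'' - 1 / 2)))))) := by
  have hcF : ∀ x ∉ polPhiF q r, DifferentiableAt ℂ (ctrA q (nome q r)) x := fun x hx =>
    differentiableAt_ctrA_typeI hq0 hq1 hr hx
  have hcFF : ∀ x ∉ polFF q r, DifferentiableAt ℂ (ctrB q (nome q r)) x := fun x hx =>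
    differentiableAt_ctrB_typeI hq0 hq1 hr hx
  have hcE : ∀ x ∉ polPsiE q r, DifferentiableAt ℂ (ctrA (q : ℂ)⁻¹ (nome q (r - 1))) x :=
    fun x hx => differentiableAt_ctrA_typeII hq0 hq1 hr hx
  have hcEE : ∀ x ∉ polEE q r, DifferentiableAt ℂ (ctrB (q : ℂ)⁻¹ (nome q (r - 1))) x :=
    fun x hx => differentiableAt_ctrB_typeII hq0 hq1 hr hx
  -- The continuations asked for are the normally ordered products with their contractions; one
  -- choice serves both the analyticity claims and the integral formulas.
  refine ⟨exchangeRel_Phi_K hq0 hq1 hr s, exchangeRel_Phi_E hq0 hq1 hr s,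
    PhiMinus_mul_Pval hq0 s, exchangeRel_Phi_F hq0 hq1 hr s, exchangeRel_K_Psi hq0 hq1 hr s,
    exchangeRel_Psi_F hq0 hq1 hr s, PsiMinus_mul_Sval hq0 s, exchangeRel_Psi_E hq0 hq1 hr s,
    ⟨Fam.prod₂ q (famPhi q r s) (famF q r s) (ctrA q (nome q r)),
      Fam.prod₂ q (famF q r s) (famPhi q r s) (ctrA q (nome q r)),
      Fam.prod₃ q (famPhi q r s) (famF q r s) (famF q r s) (ctrA q (nome q r))
        (ctrA q (nome q r)) (ctrB q (nome q r)),
      Fam.prod₃ q (famF q r s) (famF q r s) (famPhi q r s) (ctrB q (nome q r))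
        (ctrA q (nome q r)) (ctrA q (nome q r)), fun w v => ?_, fun w v u x h1 h2 => ?_,
      fun w v u x' x'' h1 h2 h3 h4 h5 h6 => ?_⟩,
    ⟨Fam.prod₂ q (famPsi q r s) (famE q r s) (ctrA (q : ℂ)⁻¹ (nome q (r - 1))),
      Fam.prod₂ q (famE q r s) (famPsi q r s) (ctrA (q : ℂ)⁻¹ (nome q (r - 1))),
      Fam.prod₂ q (famE q r s) (famE q r s) (ctrB (q : ℂ)⁻¹ (nome q (r - 1))),
      Fam.prod₃ q (famPsi q r s) (famE q r s) (famE q r s) (ctrA (q : ℂ)⁻¹ (nome q (r - 1)))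
        (ctrA (q : ℂ)⁻¹ (nome q (r - 1))) (ctrB (q : ℂ)⁻¹ (nome q (r - 1))),
      Fam.prod₃ q (famE q r s) (famE q r s) (famPsi q r s) (ctrB (q : ℂ)⁻¹ (nome q (r - 1)))
        (ctrA (q : ℂ)⁻¹ (nome q (r - 1))) (ctrA (q : ℂ)⁻¹ (nome q (r - 1))), fun w v => ?_,
      fun w v u u₀ x h1 h2 h3 => ⟨hasSum_Psi_zero hq0 hq1 hr s b w v u u₀ x h1 h2 h3,
        fun η => hasSum_Psi_plus hq0 hq1 hr s b w v u u₀ x h1 h2 h3 η⟩,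
      fun w v u γ h => ⟨?_, ?_⟩, fun w v u γ η h _ hη => ⟨?_, ?_⟩⟩⟩
  · have hΦF := Fam.hasCtr_famPhi_famF hq0 hq1 hr s
    have hFΦ := Fam.hasCtr_famF_famPhi hq0 hq1 hr s
    have hFF := Fam.hasCtr_famF_famF hq0 hq1 hr s
    rw [PhiMinus_eq_op hq0, curF_eq_op hq0]
    exact ⟨Fam.isCont₂_prod₂ hq0 hΦF hcF w v, Fam.isCont₂_prod₂ hq0 hFΦ hcF w v,
      Fam.isCont₃_prod₃ hq0 hq1 hΦF hΦF hFF hcF hcF hcFF w v,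
      Fam.isCont₃_prod₃ hq0 hq1 hFF hFΦ hFΦ hcFF hcF hcF w v⟩
  · have H := hasSum_Phi_zero hq0 hq1 hr s a w v u x h1 h2
    exact ⟨circ_Phi_zero hq0 hq1 hr s a w v u x h1 h2 ▸ H, H⟩
  · have H := hasSum_Phi_plus hq0 hq1 hr s a w v u x' x'' h1 h2 h3 h4 h5 h6
    exact ⟨circ_Phi_plus hq0 hq1 hr s a w v u x' x'' h1 h2 h3 h4 ▸ H, H⟩
  · have hΨE := Fam.hasCtr_famPsi_famE hq0 hq1 hr s
    have hEΨ := Fam.hasCtr_famE_famPsi hq0 hq1 hr s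
    have hEE := Fam.hasCtr_famE_famE hq0 hq1 hr s
    rw [PsiMinus_eq_op hq0, curE_eq_op hq0]
    exact ⟨Fam.isCont₂_prod₂ hq0 hΨE hcE w v, Fam.isCont₂_prod₂ hq0 hEΨ hcE w v,
      Fam.isCont₂_prod₂ hq0 hEE hcEE w v,
      Fam.isCont₃_prod₃ hq0 hq1 hΨE hΨE hEE hcE hcE hcEE w v,
      Fam.isCont₃_prod₃ hq0 hq1 hEE hEΨ hEΨ hcEE hcE hcE w v⟩
  · simp only [kE0_shift hq0 hq1 hr, mul_neg, Loop.integral_neg]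
  · rw [loop_Psi_zero hq0 hq1 hr s w v u γ h]
  · simp only [kE2_shift hq0 hq1 hr]
  · rw [loop_Psi_plus hq0 hq1 hr s w v u γ η h fun t => (hη t).1]
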